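/- **Setting.** Let $d\ge 1$, $T\ge 2$ be integers, $\mathcal X=\{x\in\mathbb R^d:\|x\|_2\le 1,\ x_1=\tfrac12\}$, and $\mathcal F_1^{\mathsf{lin}}=\{x\mapsto\langle\theta,x\rangle:\ \theta\in\mathbb R^d,\ |\langle\theta,x\rangle|\le 1\text{ for all }x\in\mathcal X\}$ (functions on $\mathcal X$). Put $N=\big\lceil (T/(d\log T))^{1/3}\big\rceil$ and $\mathcal Z=\{z_0,\dots,z_N\}$ with $z_j=j/N$. An oblivious adversary fixes $(x_1,y_1),\dots,(x_T,y_T)\in\mathcal X\times\{0,1\}$ in advance. In round $t$ the forecaster sees $x_t$, outputs a distribution $\mathcal P_t$ on $\mathcal Z$ that is a deterministic function of $(x_1,y_1),\dots,(x_{t-1},y_{t-1}),x_t$ (and $d,N,T$), then $p_t\sim\mathcal P_t$ is drawn independently, and $y_t$ is revealed. The $\ell_2$-swap multicalibration error is $$\mathsf{SMCal}=\sup_{\{f_p\in\mathcal F_1^{\mathsf{lin}}\}_{p\in\mathcal Z}}\ \sum_{p\in\mathcal Z} n_p\,\rho_{p,f_p}^2,\qquad n_p=\sum_{t\le T}\mathbb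 I[p_t=p],\qquad \rho_{p,f}=\frac1{n_p}\sum_{t\le T}\mathbb I[p_t=p]\,f(x_t)(y_t-p)$$ (terms with $n_p=0$ are $0$). Say that $(\mathcal P_t)$ *achieves the bounds with constant $C$* if for every $\delta\in(0,1]$, with probability at least $1-\delta$, $$\mathsf{SMCal}\le C\Big(T^{1/3}d^{2/3}(\log T)^{2/3}+\Big(\frac{T}{d\log T}\Big)^{1/3}\log\frac1\delta\Big),$$ and moreover $\mathbb E[\mathsf{SMCal}]\le C\,T^{1/3}d^{2/3}(\log T)^{2/3}$. **Algorithm.** For $\varepsilon\ge0$, an *$\varepsilon$-accurate run* is a sequence $\mathcal P_1,\dots,\mathcal P_T$ of distributions on $\mathcal Z$ for which there are $\theta_{t,i}\in\mathbb R^d$, $\|\theta_{t,i}\|_2\le4$ ($1\le t\le T$, $0\le i\le N$), such that, writing $p_{t,i}=\mathcal P_t(z_i)$: * *(Blum–Mansour reduction.)* $\sum_{j}\big|\sum_i q_{t,i}(j)\,p_{t,i}-p_{t,j}\big|\le\varepsilon$, where $q_{t,i}$ is the randomized rounding of $w_{t,i}=\min(1,\max(0,\langle\theta_{t,i},x_t\rangle))$,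 i.e. the distribution on the two neighbouring grid points $z_m\le w_{t,i}<z_{m+1}$ with mean $w_{t,i}$ (the point mass at $z_N$ if $w_{t,i}=1$). * *(Online Newton Step.)* With $\nabla_{t,i}=2p_{t,i}(\langle\theta_{t,i},x_t\rangle-y_t)x_t$, $\beta=\frac1{640}$ and $A_{t,i}=\sum_{\tau\le t}\nabla_{\tau,i}\nabla_{\tau,i}^{\top}+\frac1{4\beta^2}I_d$, for $t<T$ the vector $\theta_{t+1,i}$ has Euclidean distance at most $\varepsilon$ from the minimizer over $\|u\|_2\le4$ of $(v-u)^\top A_{t,i}(v-u)$, where $v=\theta_{t,i}-\frac1\beta A_{t,i}^{-1}\nabla_{t,i}$. A $0$-accurate run is a run of the exact algorithm; initial points and stationary distributions are arbitrary. **Theorem.** There is an absolute constant $C>0$ such that: 1. (*Efficient algorithm.*) There are a fixed online program for a real random access machine (fixed finite code without real constants; exact real arithmetic, square roots and comparisons, natural-number arithmetic for counters and addresses, each at unit cost, and bounded loops), given $d,N,T$ as input, and absolute constants $c,k$, such that for all $d\ge1$, $T\ge2$ and all sequences $(x_t,y_t)$ the program performs at most $c\,(d+T)^k$ steps in total to compute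 $\mathcal P_1,\dots,\mathcal P_T$; these form a $T^{-2}$-accurate run; and they achieve the bounds with constant $C$. 2. (*Exact algorithm.*) For all $d\ge1$, $T\ge2$ and all sequences $(x_t,y_t)$, every $0$-accurate run achieves the bounds with constant $C$. -/

import Mathlib

open scoped BigOperators

noncomputable section

namespace SwapMultical

/-! ### Contexts, hypotheses, grid and swap multicalibration error -/

/-- Vectors of dimension `d` with the Euclidean norm. -/
abbrev Vec (d : ℕ) : Type := EuclideanSpace ℝ (Fin d)

/-- The context space: the vectors of the Euclidean unit ball of dimension `d` whose first
coordinate is `1/2`. -/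
def Context (d : ℕ) : Type :=
  {x : Vec d // ‖x‖ ≤ 1 ∧ ∀ i : Fin d, (i : ℕ) = 0 → x i = 1 / 2}

/-- The linear functions `x ↦ ⟪θ, x⟫` on the context space whose square is at most `b`. -/
def linClass (d : ℕ) (b : ℝ) : Set (Context d → ℝ) :=
  {f | (∃ θ : Vec d, ∀ x : Context d, f x = inner ℝ θ x.1) ∧ ∀ x, f x ^ 2 ≤ b}

/-- The grid points `z_j = j / N`, `j = 0, …, N`. -/
def gridPoint (N : ℕ) (j : Fin (N + 1)) : ℝ := (j : ℝ) / N

/-- The number of rounds in which the prediction is `z_j`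
(predictions are recorded by their index in the grid). -/
def hits {N T : ℕ} (p : Fin T → Fin (N + 1)) (j : Fin (N + 1)) : ℝ :=
  ∑ t : Fin T, if p t = j then 1 else 0

/-- The average of `f (x_t) (y_t - z_j)` over the rounds in which the prediction is `z_j`
(with value `0` if there is no such round). -/
def rho {X : Type*} {N T : ℕ} (x : ℕ → X) (y : ℕ → ℝ) (p : Fin T → Fin (N + 1))
    (j : Fin (N + 1)) (f : X → ℝ) : ℝ :=
  (∑ t : Fin T, if p t = j then f (x t) * (y t - gridPoint N j) else 0) / hits p j

/-- The `ℓ_q`-swap multicalibration error of the predictions `p` against the class `F`: the supremum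
over all comparator profiles `(f_j)`, one member of `F` for each grid point. -/
def SMCal {X : Type*} {N T : ℕ} (F : Set (X → ℝ)) (q : ℕ) (x : ℕ → X) (y : ℕ → ℝ)
    (p : Fin T → Fin (N + 1)) : ℝ :=
  ⨆ f : Fin (N + 1) → F, ∑ j, hits p j * |rho x y p j (f j).1| ^ q

/-- The law of the predictions `p_0, …, p_{T-1}` when they are drawn independently, `p_t` from the
probability vector `P t`. -/
def predictionLaw {N : ℕ} (T : ℕ) (P : ℕ → Fin (N + 1) → ℝ) :
    MeasureTheory.Measure (Fin T → Fin (N + 1)) :=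
  MeasureTheory.Measure.pi fun t : Fin T =>
    ∑ j, ENNReal.ofReal (P t j) • MeasureTheory.Measure.dirac j

/-- The grid parameter `N`: the least natural number `≥ (T / (d log T))^(1/3)`. -/
def gridSize (d T : ℕ) : ℕ := ⌈((T : ℝ) / (d * Real.log T)) ^ (1 / 3 : ℝ)⌉₊

/-- The leading term `T^(1/3) d^(2/3) (log T)^(2/3)` of the error bounds. -/
def leadingRate (d T : ℕ) : ℝ :=
  (T : ℝ) ^ (1 / 3 : ℝ) * (d : ℝ) ^ (2 / 3 : ℝ) * Real.log T ^ (2 / 3 : ℝ)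

/-- With constant `C`, predictions drawn from `P` have small `ℓ_2`-swap multicalibration error
against the linear functions bounded by `1`, with high probability and in expectation. -/
def AchievesBounds (C : ℝ) {N : ℕ} (d T : ℕ) (x : ℕ → Context d) (y : ℕ → ℝ)
    (P : ℕ → Fin (N + 1) → ℝ) : Prop :=
  (∀ δ : ℝ, 0 < δ → δ ≤ 1 →
    1 - δ ≤ (predictionLaw T P).real
      {p | SMCal (linClass d 1) 2 x y p ≤
        C * (leadingRate d T
          + ((T : ℝ) / (d * Real.log T)) ^ (1 / 3 : ℝ) * Real.log (1 / δ))}) ∧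
  ∫ p, SMCal (linClass d 1) 2 x y p ∂(predictionLaw T P) ≤ C * leadingRate d T

/-! ### The Blum–Mansour reduction with Online Newton Step learners and randomized rounding -/

/-- Randomized rounding of `w ∈ [0, 1]` to the two neighbouring grid points
(all the mass is on the last grid point if `w = 1`). -/
def rround (N : ℕ) (w : ℝ) (j : Fin (N + 1)) : ℝ :=
  if (j : ℕ) = ⌊N * w⌋₊ then ⌊N * w⌋₊ + 1 - N * w
  else if (j : ℕ) = ⌊N * w⌋₊ + 1 then N * w - ⌊N * w⌋₊
  else 0

/-- Projection of a real number to `[0, 1]`. -/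
def clip (w : ℝ) : ℝ := max 0 (min w 1)

/-- The gradient at `θ` of the scaled squared loss `θ ↦ α (⟪θ, x⟫ - y)^2`. -/
def onsGrad {d : ℕ} (α : ℝ) (x : Vec d) (y : ℝ) (θ : Vec d) : Vec d :=
  (2 * α * (inner ℝ θ x - y)) • x

/-- The parameter `β` of the Online Newton Step. -/
def onsBeta : ℝ := 1 / 640

/-- The matrix `∑_{τ ≤ t} g_τ g_τᵀ + ω I` with `ω = 1 / (4 β^2)`. -/
def onsMatrix {d : ℕ} (g : ℕ → Vec d) (t : ℕ) : Matrix (Fin d) (Fin d) ℝ :=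
  ∑ τ ∈ Finset.range (t + 1), Matrix.vecMulVec (g τ).ofLp (g τ).ofLp
    + (1 / (4 * onsBeta ^ 2)) • (1 : Matrix (Fin d) (Fin d) ℝ)

/-- The unprojected Newton step `θ - β⁻¹ A⁻¹ g`. -/
def newtonStep {d : ℕ} (A : Matrix (Fin d) (Fin d) ℝ) (θ g : Vec d) : Vec d :=
  θ - (1 / onsBeta) • WithLp.toLp 2 (A⁻¹.mulVec g.ofLp)

/-- `u` is the projection of `v` to the Euclidean ball of radius `4`, for the norm induced by the
positive definite matrix `A`. -/
def IsProjBall {d : ℕ} (A : Matrix (Fin d) (Fin d) ℝ) (v u : Vec d) : Prop :=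
  ‖u‖ ≤ 4 ∧ ∀ w : Vec d, ‖w‖ ≤ 4 →
    dotProduct (v - u).ofLp (A.mulVec (v - u).ofLp) ≤
      dotProduct (v - w).ofLp (A.mulVec (v - w).ofLp)

/-- `P` is a sequence of prediction distributions produced by the Blum–Mansour reduction over the
grid of `N + 1` points, with one Online Newton Step learner per grid point and randomized rounding,
where stationary distributions and Newton projections are computed up to an error of at most `ε`.
For `ε = 0` this is the exact algorithm. Here `θ t i` is the iterate of learner `i` in round `t`
(rounds are numbered from `0`); the initial iterates are arbitrary. -/
def IsBMRun (ε : ℝ) {N : ℕ} (d T : ℕ) (x : ℕ → Context d) (y : ℕ → ℝ)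
    (P : ℕ → Fin (N + 1) → ℝ) : Prop :=
  ∃ θ : ℕ → Fin (N + 1) → Vec d,
    (∀ i, ‖θ 0 i‖ ≤ 4) ∧
    (∀ t < T, P t ∈ stdSimplex ℝ (Fin (N + 1)) ∧
      ∑ j, |(∑ i, rround N (clip (inner ℝ (θ t i) (x t).1)) j * P t i) - P t j| ≤ ε) ∧
    (∀ t, t + 1 < T → ∀ i,
      let g : ℕ → Vec d := fun τ => onsGrad (P τ i) (x τ).1 (y τ) (θ τ i)
      ‖θ (t + 1) i‖ ≤ 4 ∧
      ∃ u, IsProjBall (onsMatrix g t) (newtonStep (onsMatrix g t) (θ t i) (g t)) u ∧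
        ‖θ (t + 1) i - u‖ ≤ ε)

/-! ### A real random access machine with a step count -/

/-- Expressions for natural numbers (sizes, counters and array positions). -/
inductive NExpr where
  | const (n : ℕ)
  | var (v : ℕ)
  | add (a b : NExpr)
  | sub (a b : NExpr)
  | mul (a b : NExpr)

/-- Expressions for real numbers: `read a e` is the entry of array `a` at position `e`. -/
inductive RExpr where
  | ofNat (e : NExpr)
  | read (a : ℕ) (e : NExpr)
  | add (r s : RExpr)
  | sub (r s : RExpr)
  | mul (r s : RExpr)
  | div (r s : RExpr)
  | sqrt (r : RExpr)

/-- Programs. `loop v e c` executes `c` for `v = 0, 1, …, e - 1`, with `e` evaluated once. -/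
inductive Cmd where
  | skip
  | setVar (v : ℕ) (e : NExpr)
  | write (a : ℕ) (e : NExpr) (r : RExpr)
  | seq (c₁ c₂ : Cmd)
  | ifLe (r s : RExpr) (c₁ c₂ : Cmd)
  | loop (v : ℕ) (e : NExpr) (c : Cmd)

/-- The memory: natural number variables and arrays of exact real numbers. -/
structure Memory where
  nat : ℕ → ℕ
  real : ℕ → ℕ → ℝ

/-- Set one natural number variable. -/
def Memory.setNat (s : Memory) (v n : ℕ) : Memory :=
  { s with nat := Function.update s.nat v n }

/-- Set one array entry. -/
def Memory.setReal (s : Memory) (a k : ℕ) (r : ℝ) : Memory :=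
  { s with real := Function.update s.real a (Function.update (s.real a) k r) }

/-- The value of a natural number expression (subtraction is truncated). -/
def NExpr.eval (s : Memory) : NExpr → ℕ
  | .const n => n
  | .var v => s.nat v
  | .add a b => a.eval s + b.eval s
  | .sub a b => a.eval s - b.eval s
  | .mul a b => a.eval s * b.eval s

/-- The value of a real expression (division by `0` gives `0`, as does the root of a negative
number). -/
def RExpr.eval (s : Memory) : RExpr → ℝ
  | .ofNat e => (e.eval s : ℝ)
  | .read a e => s.real a (e.eval s)
  | .add q r => q.eval s + r.eval s
  | .sub q r => q.eval s - r.eval s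
  | .mul q r => q.eval s * r.eval s
  | .div q r => q.eval s / r.eval s
  | .sqrt r => Real.sqrt (r.eval s)

/-- The number of steps to evaluate an expression: one for each constant, variable, operation. -/
def NExpr.cost : NExpr → ℕ
  | .const _ => 1
  | .var _ => 1
  | .add a b => a.cost + b.cost + 1
  | .sub a b => a.cost + b.cost + 1
  | .mul a b => a.cost + b.cost + 1

/-- The number of steps to evaluate an expression: one for each conversion, access, operation. -/
def RExpr.cost : RExpr → ℕ
  | .ofNat e => e.cost + 1
  | .read _ e => e.cost + 1
  | .add q r => q.cost + r.cost + 1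
  | .sub q r => q.cost + r.cost + 1
  | .mul q r => q.cost + r.cost + 1
  | .div q r => q.cost + r.cost + 1
  | .sqrt r => r.cost + 1

open Classical in
/-- The memory after the execution of a program. -/
def Cmd.exec : Cmd → Memory → Memory
  | .skip, s => s
  | .setVar v e, s => s.setNat v (e.eval s)
  | .write a e r, s => s.setReal a (e.eval s) (r.eval s)
  | .seq c₁ c₂, s => c₂.exec (c₁.exec s)
  | .ifLe q r c₁ c₂, s => if q.eval s ≤ r.eval s then c₁.exec s else c₂.exec s
  | .loop v e c, s => Nat.rec s (fun k s' => c.exec (s'.setNat v k)) (e.eval s)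

open Classical in
/-- The number of steps in the execution of a program. -/
def Cmd.cost : Cmd → Memory → ℕ
  | .skip, _ => 1
  | .setVar _ e, _ => e.cost + 1
  | .write _ e r, _ => e.cost + r.cost + 1
  | .seq c₁ c₂, s => c₁.cost s + c₂.cost (c₁.exec s)
  | .ifLe q r c₁ c₂, s =>
      q.cost + r.cost + 1 + if q.eval s ≤ r.eval s then c₁.cost s else c₂.cost s
  | .loop v e c, s =>
      e.cost + 1 + ∑ k ∈ Finset.range (e.eval s),
        (1 + c.cost
          (((Nat.rec s (fun i s' => c.exec (s'.setNat v i)) k : Memory)).setNat v k))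

/-- An online forecasting program: it is initialized once; in each round it receives the context,
executes `predict` to output a distribution over the grid, receives the label, and executes
`update`. It consists of fixed finite programs that contain no real constants. -/
structure OnlineProgram where
  init : Cmd
  predict : Cmd
  update : Cmd

namespace OnlineProgram

/-- The initial memory: the variables `0, 1, 2` hold `d, N, T`, everything else is zero. -/
def start (d N T : ℕ) : Memory where
  nat v := if v = 0 then d else if v = 1 then N else if v = 2 then T else 0
  real _ _ := 0

/-- The context is delivered in the entries `0, …, d - 1` of array `0`. -/
def giveContext {d : ℕ} (s : Memory) (x : Context d) : Memory :=
  { s with real := fun a k => if h : a = 0 ∧ k < d then x.1 ⟨k, h.2⟩ else s.real a k }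

/-- The label is delivered in entry `0` of array `1`. -/
def giveLabel (s : Memory) (y : ℝ) : Memory := s.setReal 1 0 y

variable (A : OnlineProgram) (d N T : ℕ) (x : ℕ → Context d) (y : ℕ → ℝ)

/-- The memory before round `t`. -/
def before : ℕ → Memory
  | 0 => A.init.exec (start d N T)
  | t + 1 =>
      A.update.exec (giveLabel (A.predict.exec (giveContext (before t) (x t))) (y t))

/-- The memory in round `t` once the distribution has been output. -/
def predicted (t : ℕ) : Memory :=
  A.predict.exec (giveContext (before A d N T x y t) (x t))

/-- The distribution output in round `t`: the entries `0, …, N` of array `2`. -/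
def forecast (t : ℕ) (j : Fin (N + 1)) : ℝ := (predicted A d N T x y t).real 2 j

/-- The total number of steps in the initialization and in the rounds `0, …, T - 1`. -/
def steps : ℕ :=
  A.init.cost (start d N T) + ∑ t ∈ Finset.range T,
    (A.predict.cost (giveContext (before A d N T x y t) (x t))
      + A.update.cost (giveLabel (predicted A d N T x y t) (y t)))

end OnlineProgram

end SwapMultical

end

open SwapMultical

open scoped BigOperators

noncomputable section

namespace SwapMultical

/-! ### The quadratic forms of the Online Newton Step -/

/-! Swap multicalibration is reduced to swap regret for the squared loss. On the rounds that predict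
`z_j`, with `r` the value of `rho` at the comparator `f`, the term `n r^2` equals `2 r (n r) - r^2
n`. As `f^2 ≤ 1`, this is at most the sum of `(z_j - y)^2 - (z_j + r f(x) - y)^2` over these rounds
(`hits_mul_rho_sq_le`). The comparator `z_j + r f` is again linear, because the fixed coordinate
`1/2` makes constants linear, and it has bounded norm (`norm_le_two_of_linClass`). A finite net
makes the comparators finite in number at a total cost of `5`.

Pseudo swap regret, with indicators of predictions replaced by their probabilities, is controlled
deterministically. If `P` is nearly stationary for the rounding matrix, its loss is, up to the
stationarity error, the `P`-average of the losses of the rounded learners; unbiased rounding adds at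
most `1 / (4 N^2)` per round (`sum_sq_le_of_near_stationary`). Each learner has regret of order `d
log (T + d)` by the exp-concavity and log-determinant arguments of the Online Newton Step
(`ons_regret`). Hence the pseudo swap regret is of order `T / N^2 + N d log (T + d)`
(`IsBMRun.sum_regret_le`).

The passage to realized predictions loses only constants. In the exponential moment of a loss gap
the second-order term is at most a multiple of the squared comparator shift, and halving the shift
releases exactly such a term (`integral_exp_hitGap_le`). A union bound over the net and Jensen's
inequality over the grid points give one exponential moment for the whole error
(`integral_exp_SMCal_le`), which yields both the tail and the mean. With `r = (T / (d log T))^(1/3)`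
and `D = d log T` one has `T = r^3 D`, and for `r ≥ 1` all terms balance at `r D`, the leading rate;
for `r < 1` the trivial bound `T` suffices (`IsBMRun.achievesBounds`).

The program approximates the two implicit steps. Averages of `M` power iterates have stationarity
defect at most `2 / M` by telescoping, without a spectral gap. The Newton projection minimizes a
well-conditioned quadratic over a ball, so projected gradient descent converges geometrically
without inverting a matrix (`norm_descentStep_sub_sq_le`). A loop-invariant rule identifies the
memory with these recursions, and the cost is polynomial because all loop bounds depend only on `d,
N, T`, which are never changed. -/

/-- The bilinear form of the matrix `onsMatrix g t`. -/
def newtonForm {d : ℕ} (g : ℕ → Vec d) (t : ℕ) (v w : Vec d) : ℝ :=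
  ∑ τ ∈ Finset.range (t + 1), inner ℝ (g τ) v * inner ℝ (g τ) w + 102400 * inner ℝ v w

lemma inner_eq_dotProduct {d : ℕ} (v w : Vec d) : inner ℝ v w = v.ofLp ⬝ᵥ w.ofLp := by
  rw [EuclideanSpace.inner_eq_star_dotProduct, dotProduct_comm]; simp

lemma dotProduct_onsMatrix {d : ℕ} (g : ℕ → Vec d) (t : ℕ) (v w : Vec d) :
    v.ofLp ⬝ᵥ (onsMatrix g t).mulVec w.ofLp = newtonForm g t v w := by
  unfold onsMatrix newtonForm
  rw [Matrix.add_mulVec, Matrix.sum_mulVec, dotProduct_add, dotProduct_sum]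
  congr 1
  · refine Finset.sum_congr rfl fun τ _ => ?_
    rw [Matrix.vecMulVec_mulVec, inner_eq_dotProduct, inner_eq_dotProduct]
    simp [dotProduct_comm, mul_comm]
  · rw [Matrix.smul_mulVec, Matrix.one_mulVec, dotProduct_smul, inner_eq_dotProduct]
    norm_num [onsBeta]

section newtonForm

variable {d : ℕ} (g : ℕ → Vec d) (t : ℕ)

lemma newtonForm_comm (v w : Vec d) : newtonForm g t v w = newtonForm g t w v := by
  simp only [newtonForm, mul_comm, real_inner_comm]

lemma newtonForm_add_left (u v w : Vec d) :
    newtonForm g t (u + v) w = newtonForm g t u w + newtonForm g t v w := by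
  simp only [newtonForm, inner_add_left, inner_add_right, add_mul, mul_add, Finset.sum_add_distrib]
  ring

lemma newtonForm_smul_left (c : ℝ) (v w : Vec d) :
    newtonForm g t (c • v) w = c * newtonForm g t v w := by
  simp only [newtonForm, real_inner_smul_left, real_inner_smul_right, mul_add, Finset.mul_sum]
  congr 1
  · exact Finset.sum_congr rfl fun _ _ => by ring
  · ring

lemma newtonForm_add_right (u v w : Vec d) :
    newtonForm g t u (v + w) = newtonForm g t u v + newtonForm g t u w := by
  rw [newtonForm_comm, newtonForm_add_left, newtonForm_comm g t v, newtonForm_comm g t w]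

lemma newtonForm_smul_right (c : ℝ) (v w : Vec d) :
    newtonForm g t v (c • w) = c * newtonForm g t v w := by
  rw [newtonForm_comm, newtonForm_smul_left, newtonForm_comm]

lemma newtonForm_sub_left (u v w : Vec d) :
    newtonForm g t (u - v) w = newtonForm g t u w - newtonForm g t v w := by
  have := newtonForm_add_left g t (u - v) v w
  rw [sub_add_cancel] at this
  linarith

lemma newtonForm_sub_right (u v w : Vec d) :
    newtonForm g t u (v - w) = newtonForm g t u v - newtonForm g t u w := by
  rw [newtonForm_comm, newtonForm_sub_left, newtonForm_comm g t v, newtonForm_comm g t w]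

lemma newtonForm_self_ge (v : Vec d) : 102400 * ‖v‖ ^ 2 ≤ newtonForm g t v v := by
  unfold newtonForm
  rw [real_inner_self_eq_norm_sq]
  have : 0 ≤ ∑ τ ∈ Finset.range (t + 1), inner ℝ (g τ) v * inner ℝ (g τ) v :=
    Finset.sum_nonneg fun _ _ => mul_self_nonneg _
  linarith

lemma newtonForm_self_nonneg (v : Vec d) : 0 ≤ newtonForm g t v v :=
  (by positivity : (0 : ℝ) ≤ 102400 * ‖v‖ ^ 2).trans (newtonForm_self_ge g t v)

lemma newtonForm_succ (v w : Vec d) :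
    newtonForm g (t + 1) v w =
      newtonForm g t v w + inner ℝ (g (t + 1)) v * inner ℝ (g (t + 1)) w := by
  unfold newtonForm
  rw [Finset.sum_range_succ _ (t + 1)]
  ring

variable {g t}

lemma abs_newtonForm_le {G : ℝ} (hg : ∀ τ ≤ t, ‖g τ‖ ≤ G) (v w : Vec d) :
    |newtonForm g t v w| ≤ (G ^ 2 * (t + 1) + 102400) * (‖v‖ * ‖w‖) := by
  have hG : 0 ≤ G := (norm_nonneg _).trans (hg 0 (Nat.zero_le _))
  unfold newtonForm
  refine (abs_add_le _ _).trans ?_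
  rw [add_mul]
  refine add_le_add ?_ ?_
  · refine (Finset.abs_sum_le_sum_abs _ _).trans ?_
    have h : ∀ τ ∈ Finset.range (t + 1), |inner ℝ (g τ) v * inner ℝ (g τ) w|
        ≤ G ^ 2 * (‖v‖ * ‖w‖) := by
      intro τ hτ
      have hτ' := hg τ (Nat.lt_succ_iff.mp (Finset.mem_range.mp hτ))
      rw [abs_mul]
      calc |inner ℝ (g τ) v| * |inner ℝ (g τ) w| ≤ (G * ‖v‖) * (G * ‖w‖) := by
            gcongr
            · exact (abs_real_inner_le_norm _ _).trans (by gcongr)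
            · exact (abs_real_inner_le_norm _ _).trans (by gcongr)
        _ = _ := by ring
    refine (Finset.sum_le_sum h).trans (le_of_eq ?_)
    simp only [Finset.sum_const, Finset.card_range, nsmul_eq_mul]
    push_cast
    ring
  · rw [abs_mul, abs_of_pos (by norm_num : (0:ℝ) < 102400)]
    gcongr
    exact abs_real_inner_le_norm _ _

end newtonForm

lemma isHermitian_onsMatrix {d : ℕ} (g : ℕ → Vec d) (t : ℕ) : (onsMatrix g t).IsHermitian := by
  unfold onsMatrix
  refine Matrix.IsHermitian.add ?_ ?_
  · rw [Matrix.IsHermitian, Matrix.conjTranspose_sum]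
    refine Finset.sum_congr rfl fun τ _ => ?_
    ext i j
    simp [Matrix.vecMulVec_apply, mul_comm]
  · ext i j
    by_cases h : i = j
    · simp [h]
    · simp [h, Ne.symm h]

lemma posDef_onsMatrix {d : ℕ} (g : ℕ → Vec d) (t : ℕ) : (onsMatrix g t).PosDef := by
  refine Matrix.PosDef.of_dotProduct_mulVec_pos (isHermitian_onsMatrix g t) fun v hv => ?_
  have h := dotProduct_onsMatrix g t (WithLp.toLp 2 v) (WithLp.toLp 2 v)
  simp only [star_trivial]
  rw [h]
  refine lt_of_lt_of_le ?_ (newtonForm_self_ge g t _)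
  have : (WithLp.toLp 2 v : Vec d) ≠ 0 := fun h0 => hv (by simpa using h0)
  have := norm_pos_iff.mpr this
  positivity

/-- The Newton direction `A⁻¹ v`. -/
def newtonDir {d : ℕ} (g : ℕ → Vec d) (t : ℕ) (v : Vec d) : Vec d :=
  WithLp.toLp 2 ((onsMatrix g t)⁻¹.mulVec v.ofLp)

lemma newtonForm_newtonDir {d : ℕ} (g : ℕ → Vec d) (t : ℕ) (v w : Vec d) :
    newtonForm g t w (newtonDir g t v) = inner ℝ w v := by
  rw [← dotProduct_onsMatrix]
  simp only [newtonDir]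
  rw [Matrix.mulVec_mulVec, Matrix.mul_nonsing_inv, Matrix.one_mulVec, inner_eq_dotProduct]
  exact (posDef_onsMatrix g t).det_pos.ne'.isUnit

/-! ### The log-determinant potential. -/

lemma det_sub_vecMulVec {d : ℕ} (A : Matrix (Fin d) (Fin d) ℝ) (hA : IsUnit A.det)
    (v : Fin d → ℝ) :
    (A - Matrix.vecMulVec v v).det = A.det * (1 - v ⬝ᵥ A⁻¹.mulVec v) := by
  have h := Matrix.det_add_replicateCol_mul_replicateRow (ι := Unit) hA (-v) v
  have e : A - Matrix.vecMulVec v v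
      = A + Matrix.replicateCol Unit (-v) * Matrix.replicateRow Unit v := by
    rw [← Matrix.vecMulVec_eq, Matrix.neg_vecMulVec, sub_eq_add_neg]
  rw [e, h]
  congr 1
  rw [Matrix.det_unique]
  simp [Matrix.mul_apply, Matrix.mulVec, dotProduct, Finset.sum_mul, Finset.mul_sum,
    Matrix.replicateRow_apply]
  ring_nf
  rw [Finset.sum_comm]

lemma onsMatrix_succ {d : ℕ} (g : ℕ → Vec d) (t : ℕ) :
    onsMatrix g (t + 1)
      = onsMatrix g t + Matrix.vecMulVec (g (t + 1)).ofLp (g (t + 1)).ofLp := by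
  unfold onsMatrix
  rw [Finset.sum_range_succ _ (t + 1)]
  abel

/-- Removing the last rank-one term multiplies the determinant by `1 - s`, where `s` is the inner
product on the left, and `log (1 - s) ≤ -s`. Leaving `D` free covers both the first round, where the
scalar matrix remains, and later rounds, where the previous matrix remains. -/
lemma inner_newtonDir_le_of_det {d : ℕ} (g : ℕ → Vec d) (t : ℕ) {D : ℝ} (hD : 0 < D)
    (h : (onsMatrix g t - Matrix.vecMulVec (g t).ofLp (g t).ofLp).det = D) :
    inner ℝ (newtonDir g t (g t)) (g t) ≤ Real.log (onsMatrix g t).det - Real.log D := by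
  have hpos := (posDef_onsMatrix g t).det_pos
  rw [det_sub_vecMulVec _ hpos.ne'.isUnit] at h
  have e : (g t).ofLp ⬝ᵥ (onsMatrix g t)⁻¹.mulVec (g t).ofLp
      = inner ℝ (newtonDir g t (g t)) (g t) := by
    rw [inner_eq_dotProduct, dotProduct_comm]; rfl
  rw [e] at h
  have h1 : 0 < 1 - inner ℝ (newtonDir g t (g t)) (g t) := by
    by_contra hc
    nlinarith
  rw [← h, Real.log_mul hpos.ne' h1.ne']
  have := Real.log_le_sub_one_of_pos h1
  linarith

/-- The potential argument of the Online Newton Step. -/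
lemma sum_inner_newtonDir_le_log_det {d : ℕ} (g : ℕ → Vec d) (t : ℕ) :
    ∑ τ ∈ Finset.range (t + 1), inner ℝ (newtonDir g τ (g τ)) (g τ)
      ≤ Real.log (onsMatrix g t).det - d * Real.log 102400 := by
  induction t with
  | zero =>
    rw [Finset.sum_range_one]
    refine (inner_newtonDir_le_of_det g 0 (D := 102400 ^ d) (by positivity) ?_).trans_eq ?_
    · simp [onsMatrix, onsBeta]
      norm_num
    · rw [Real.log_pow]
  | succ t ih =>
    rw [Finset.sum_range_succ]
    have := inner_newtonDir_le_of_det g (t + 1) (posDef_onsMatrix g t).det_pos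
      (by rw [onsMatrix_succ, add_sub_cancel_right])
    linarith

/-- Each eigenvalue is at most their sum. This is cruder than the arithmetic-geometric mean
inequality, but costs only a constant inside the logarithm. -/
lemma det_le_trace_pow {d : ℕ} {A : Matrix (Fin d) (Fin d) ℝ} (hA : A.PosDef) :
    A.det ≤ A.trace ^ d := by
  rw [hA.isHermitian.det_eq_prod_eigenvalues, hA.isHermitian.trace_eq_sum_eigenvalues]
  have h0 : ∀ i, 0 ≤ hA.isHermitian.eigenvalues i := fun i => (hA.eigenvalues_pos i).le
  calc ∏ i, ((hA.isHermitian.eigenvalues i : ℝ))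
      ≤ ∏ _i : Fin d, ∑ j, hA.isHermitian.eigenvalues j :=
        Finset.prod_le_prod (fun i _ => h0 i) fun i _ =>
          Finset.single_le_sum (fun j _ => h0 j) (Finset.mem_univ i)
    _ = _ := by simp

lemma trace_onsMatrix_le {d : ℕ} {g : ℕ → Vec d} {t : ℕ} {G : ℝ} (hg : ∀ τ ≤ t, ‖g τ‖ ≤ G) :
    (onsMatrix g t).trace ≤ G ^ 2 * (t + 1) + 102400 * d := by
  unfold onsMatrix
  rw [Matrix.trace_add, Matrix.trace_sum, Matrix.trace_smul, Matrix.trace_one]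
  refine add_le_add ?_ ?_
  · have h : ∀ τ ∈ Finset.range (t + 1),
        (Matrix.vecMulVec (g τ).ofLp (g τ).ofLp).trace ≤ G ^ 2 := by
      intro τ hτ
      rw [Matrix.trace_vecMulVec, ← inner_eq_dotProduct, real_inner_self_eq_norm_sq]
      have := hg τ (Nat.lt_succ_iff.mp (Finset.mem_range.mp hτ))
      gcongr
    refine (Finset.sum_le_sum h).trans (le_of_eq ?_)
    simp only [Finset.sum_const, Finset.card_range, nsmul_eq_mul]
    push_cast
    ring
  · norm_num [onsBeta]

lemma sum_inner_newtonDir_le {d : ℕ} (hd : 1 ≤ d) {g : ℕ → Vec d} {t : ℕ}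
    (hg : ∀ τ ≤ t, ‖g τ‖ ≤ 10) :
    ∑ τ ∈ Finset.range (t + 1), inner ℝ (newtonDir g τ (g τ)) (g τ)
      ≤ d * Real.log (t + 1 + d) := by
  refine (sum_inner_newtonDir_le_log_det g t).trans ?_
  have hp := posDef_onsMatrix g t
  have hd' : (1 : ℝ) ≤ d := by exact_mod_cast hd
  -- Extracting the factor `102400` lets its logarithm cancel the initial value `d log 102400` of
  -- the potential.
  have ht : (onsMatrix g t).trace ≤ 102400 * (t + 1 + d) :=
    (trace_onsMatrix_le hg).trans (by nlinarith [(Nat.cast_nonneg t : (0 : ℝ) ≤ t)])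
  have h1 : Real.log (onsMatrix g t).det ≤ Real.log ((102400 * (t + 1 + d : ℝ)) ^ d) := by
    refine Real.log_le_log hp.det_pos ((det_le_trace_pow hp).trans ?_)
    refine pow_le_pow_left₀ ?_ ht d
    exact hp.posSemidef.trace_nonneg
  rw [Real.log_pow, Real.log_mul (by norm_num) (by positivity)] at h1
  linarith

/-! ### Projections to the ball -/

lemma isProjBall_iff {d : ℕ} {g : ℕ → Vec d} {t : ℕ} {v u : Vec d} :
    IsProjBall (onsMatrix g t) v u ↔ ‖u‖ ≤ 4 ∧ ∀ w : Vec d, ‖w‖ ≤ 4 →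
      newtonForm g t (v - u) (v - u) ≤ newtonForm g t (v - w) (v - w) := by
  simp only [IsProjBall, dotProduct_onsMatrix]

lemma exists_isProjBall {d : ℕ} (g : ℕ → Vec d) (t : ℕ) (v : Vec d) :
    ∃ u, IsProjBall (onsMatrix g t) v u := by
  simp only [isProjBall_iff]
  have hc : ContinuousOn (fun w : Vec d => newtonForm g t (v - w) (v - w))
      (Metric.closedBall 0 4) := by
    unfold newtonForm
    fun_prop
  obtain ⟨u, hu, h⟩ := (isCompact_closedBall (0 : Vec d) 4).exists_isMinOn
    ⟨0, by simp⟩ hc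
  exact ⟨u, by simpa using hu, fun w hw => h (by simpa using hw)⟩

/-- The variational inequality of the projection. -/
lemma IsProjBall.newtonForm_nonpos {d : ℕ} {g : ℕ → Vec d} {t : ℕ} {v u : Vec d}
    (h : IsProjBall (onsMatrix g t) v u) {w : Vec d} (hw : ‖w‖ ≤ 4) :
    newtonForm g t (v - u) (w - u) ≤ 0 := by
  rw [isProjBall_iff] at h
  obtain ⟨hu, hmin⟩ := h
  set b := newtonForm g t (v - u) (w - u) with hb
  set q := newtonForm g t (w - u) (w - u) with hq
  -- Compare `u` with the point `u + s (w - u)` of the ball and expand the quadratic.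
  have key : ∀ s : ℝ, 0 ≤ s → s ≤ 1 → 2 * s * b ≤ s ^ 2 * q := by
    intro s h0 h1
    have hn : ‖u + s • (w - u)‖ ≤ 4 := by
      have e : u + s • (w - u) = (1 - s) • u + s • w := by
        rw [smul_sub, sub_smul, one_smul]; abel
      rw [e]
      refine (norm_add_le _ _).trans ?_
      rw [norm_smul, norm_smul, Real.norm_of_nonneg h0, Real.norm_of_nonneg (sub_nonneg.mpr h1)]
      nlinarith [norm_nonneg u, norm_nonneg w]
    have h2 := hmin _ hn
    have e : v - (u + s • (w - u)) = (v - u) - s • (w - u) := by abel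
    rw [e] at h2
    simp only [newtonForm_sub_left _ _ (v - u), newtonForm_sub_right _ _ _ (v - u),
      newtonForm_smul_left, newtonForm_smul_right] at h2
    rw [newtonForm_comm g t (w - u) (v - u)] at h2
    nlinarith
  have hq0 : 0 ≤ q := newtonForm_self_nonneg _ _ _
  by_contra hc
  push Not at hc
  -- If `b > 0`, the step `s = min (1, b / q)` contradicts minimality.
  rcases le_or_gt q b with h3 | h3
  · have := key 1 zero_le_one le_rfl
    linarith
  · have hqp : 0 < q := hc.trans h3
    have := key (b / q) (by positivity) (by rw [div_le_one hqp]; exact h3.le)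
    have e1 : 2 * (b / q) * b = 2 * (b ^ 2 / q) := by ring
    have e2 : (b / q) ^ 2 * q = b ^ 2 / q := by field_simp
    rw [e1, e2] at this
    have : 0 < b ^ 2 / q := by positivity
    linarith

/-- The Pythagorean inequality: in the expansion around `u` the cross term has the right sign by the
variational inequality. -/
lemma IsProjBall.newtonForm_sub_le {d : ℕ} {g : ℕ → Vec d} {t : ℕ} {v u : Vec d}
    (h : IsProjBall (onsMatrix g t) v u) {w : Vec d} (hw : ‖w‖ ≤ 4) :
    newtonForm g t (u - w) (u - w) ≤ newtonForm g t (v - w) (v - w) := by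
  have h1 := h.newtonForm_nonpos hw
  have e : v - w = (v - u) - (w - u) := by abel
  have e' : u - w = -1 • (w - u) := by simp
  have h2 := newtonForm_self_nonneg g t (v - u)
  have h3 : newtonForm g t (u - w) (u - w) = newtonForm g t (w - u) (w - u) := by
    rw [← neg_sub w u, ← neg_one_smul ℝ, newtonForm_smul_left, newtonForm_smul_right]
    ring
  rw [e, newtonForm_sub_left g t (v - u), newtonForm_sub_right g t (v - u),
    newtonForm_sub_right g t (w - u), newtonForm_comm g t (w - u) (v - u), h3]
  linarith

/-! ### The regret of the Online Newton Step -/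

lemma newtonStep_onsMatrix {d : ℕ} (g : ℕ → Vec d) (t : ℕ) (θ v : Vec d) :
    newtonStep (onsMatrix g t) θ v = θ - (640 : ℝ) • newtonDir g t v := by
  simp [newtonStep, newtonDir, onsBeta]

/-- The cross term is an ordinary inner product since `A (A⁻¹ g) = g`. The constants are `2 / β =
1280` and `1 / β^2 = 409600`. -/
lemma newtonForm_newtonStep_sub {d : ℕ} (g : ℕ → Vec d) (t : ℕ) (θ w : Vec d) :
    newtonForm g t (newtonStep (onsMatrix g t) θ (g t) - w)
        (newtonStep (onsMatrix g t) θ (g t) - w)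
      = newtonForm g t (θ - w) (θ - w) - 1280 * inner ℝ (g t) (θ - w)
        + 409600 * inner ℝ (newtonDir g t (g t)) (g t) := by
  rw [newtonStep_onsMatrix]
  have e : θ - (640 : ℝ) • newtonDir g t (g t) - w
      = (θ - w) - (640 : ℝ) • newtonDir g t (g t) := by abel
  rw [e]
  generalize θ - w = v
  rw [newtonForm_sub_left, newtonForm_sub_right, newtonForm_sub_right, newtonForm_smul_left,
    newtonForm_smul_right, newtonForm_smul_left, newtonForm_smul_right,
    newtonForm_comm g t (newtonDir g t (g t)) v, newtonForm_newtonDir, newtonForm_newtonDir,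
    real_inner_comm (g t) v]
  ring

/-- The price of an inexact projection: moving by `ε` a point at distance at most `8` from `w`
changes the form by at most its operator bound times `2 · 8 ε + ε^2 ≤ 17 ε`. -/
lemma newtonForm_sub_le_of_near {d : ℕ} {g : ℕ → Vec d} {t : ℕ} {v u z w : Vec d} {ε : ℝ}
    (hg : ∀ τ ≤ t, ‖g τ‖ ≤ 10) (h : IsProjBall (onsMatrix g t) v u) (hε : ε ≤ 1)
    (hz : ‖z - u‖ ≤ ε) (hw : ‖w‖ ≤ 4) :
    newtonForm g t (z - w) (z - w) ≤ newtonForm g t (v - w) (v - w)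
      + (100 * (t + 1) + 102400) * (17 * ε) := by
  have hu := h.1
  have huw : ‖u - w‖ ≤ 8 := (norm_sub_le _ _).trans (by linarith)
  refine le_trans ?_ (add_le_add_left (h.newtonForm_sub_le hw) _)
  have e : z - w = (u - w) + (z - u) := by abel
  rw [e, newtonForm_add_left, newtonForm_add_right, newtonForm_add_right,
    newtonForm_comm g t (z - u) (u - w)]
  have h1 := le_of_abs_le (abs_newtonForm_le hg (u - w) (z - u))
  have h2 := le_of_abs_le (abs_newtonForm_le hg (z - u) (z - u))
  set L : ℝ := (10 : ℝ) ^ 2 * (t + 1) + 102400 with hL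
  have hL0 : 0 ≤ L := by positivity
  have e1 : ‖u - w‖ * ‖z - u‖ ≤ 8 * ε := by
    gcongr
  have e2 : ‖z - u‖ * ‖z - u‖ ≤ 1 * ε := by
    gcongr
    exact hz.trans hε
  have h1' := h1.trans (mul_le_mul_of_nonneg_left e1 hL0)
  have h2' := h2.trans (mul_le_mul_of_nonneg_left e2 hL0)
  have e3 : (100 * (t + 1) + 102400 : ℝ) = L := by rw [hL]; norm_num
  rw [e3]
  linarith

lemma norm_onsGrad_le {d : ℕ} {x θ : Vec d} {y α : ℝ} (hx : ‖x‖ ≤ 1) (hθ : ‖θ‖ ≤ 4)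
    (hy : 0 ≤ y ∧ y ≤ 1) (hα : 0 ≤ α ∧ α ≤ 1) : ‖onsGrad α x y θ‖ ≤ 10 := by
  have h1 : |inner ℝ θ x| ≤ 4 := by
    refine (abs_real_inner_le_norm _ _).trans ?_
    nlinarith [norm_nonneg x, norm_nonneg θ]
  have h2 : |inner ℝ θ x - y| ≤ 5 := by
    rw [abs_le] at h1 ⊢
    constructor <;> linarith
  rw [onsGrad, norm_smul, Real.norm_eq_abs, abs_mul, abs_mul, abs_of_nonneg hα.1, abs_two]
  calc 2 * α * |inner ℝ θ x - y| * ‖x‖ ≤ 2 * 1 * 5 * 1 := by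
        gcongr
        exact hα.2
    _ = 10 := by norm_num

/-- Exp-concavity of the scaled squared loss. -/
lemma scaled_loss_sub_le {d : ℕ} {x θ : Vec d} {y α : ℝ} (w : Vec d) (hx : ‖x‖ ≤ 1)
    (hθ : ‖θ‖ ≤ 4) (hy : 0 ≤ y ∧ y ≤ 1) (hα : 0 ≤ α ∧ α ≤ 1) :
    α * ((inner ℝ θ x - y) ^ 2 - (inner ℝ w x - y) ^ 2)
      ≤ inner ℝ (onsGrad α x y θ) (θ - w)
        - 1 / 1280 * inner ℝ (onsGrad α x y θ) (θ - w) ^ 2 := by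
  have h1 : |inner ℝ θ x| ≤ 4 := by
    refine (abs_real_inner_le_norm _ _).trans ?_
    nlinarith [norm_nonneg x, norm_nonneg θ]
  have h2 : (inner ℝ θ x - y) ^ 2 ≤ 25 := by
    rw [abs_le] at h1
    nlinarith
  have e : inner ℝ (onsGrad α x y θ) (θ - w)
      = 2 * α * (inner ℝ θ x - y) * (inner ℝ θ x - inner ℝ w x) := by
    rw [onsGrad, real_inner_smul_left, inner_sub_right, real_inner_comm θ, real_inner_comm w]
  rw [e]
  set a := inner ℝ θ x - y
  set b : ℝ := inner ℝ θ x - inner ℝ w x with hb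
  have e2 : inner ℝ w x - y = a - b := by simp [a, b]
  rw [e2]
  -- The squared directional derivative is `4 α^2 a^2 b^2 ≤ 100 α b^2`, so `1 / 1280` of it is
  -- covered by the curvature term `α b^2`.
  have h3 : α * α * (a ^ 2 * b ^ 2) ≤ α * (25 * b ^ 2) := by
    rw [mul_assoc]
    refine mul_le_mul_of_nonneg_left ?_ hα.1
    calc α * (a ^ 2 * b ^ 2) ≤ 1 * (25 * b ^ 2) := by gcongr; exact hα.2
      _ = _ := one_mul _
  have h4 : 0 ≤ α * b ^ 2 := mul_nonneg hα.1 (sq_nonneg _)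
  nlinarith

/-- The subtracted last term is the potential: the squared Newton distance to `w` after the
unprojected step. It is kept so that the next round can spend it. Projection does not increase it
beyond the inexactness error, and passing to the next matrix adds `⟪g, θ - w⟫^2`, which the
quadratic gain from exp-concavity pays for. Here `1 / 1280 = β / 2`. -/
lemma ons_potential {d : ℕ} {g θ : ℕ → Vec d} {w : Vec d} {ε : ℝ} (hε : ε ≤ 1) (hw : ‖w‖ ≤ 4)
    (n : ℕ) (hg : ∀ t ≤ n, ‖g t‖ ≤ 10) (h0 : ‖θ 0‖ ≤ 4)
    (hθ : ∀ t < n, ∃ u, IsProjBall (onsMatrix g t) (newtonStep (onsMatrix g t) (θ t) (g t)) u ∧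
        ‖θ (t + 1) - u‖ ≤ ε) :
    ∑ t ∈ Finset.range (n + 1), (inner ℝ (g t) (θ t - w) - 1 / 1280 * inner ℝ (g t) (θ t - w) ^ 2)
      ≤ 5120 + 320 * ∑ t ∈ Finset.range (n + 1), inner ℝ (newtonDir g t (g t)) (g t)
        + 1 / 1280 * (n * ((100 * n + 102400) * (17 * ε)))
        - 1 / 1280 * newtonForm g n (newtonStep (onsMatrix g n) (θ n) (g n) - w)
          (newtonStep (onsMatrix g n) (θ n) (g n) - w) := by
  induction n with
  | zero =>
    rw [newtonForm_newtonStep_sub]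
    -- The regularizer contributes `64 · 102400 / 1280 = 5120`.
    have h1 : ‖θ 0 - w‖ ≤ 8 := (norm_sub_le _ _).trans (by linarith)
    have h2 : newtonForm g 0 (θ 0 - w) (θ 0 - w)
        = inner ℝ (g 0) (θ 0 - w) ^ 2 + 102400 * ‖θ 0 - w‖ ^ 2 := by
      simp [newtonForm, sq]
    have h3 : ‖θ 0 - w‖ ^ 2 ≤ 64 := by nlinarith [norm_nonneg (θ 0 - w)]
    rw [h2]
    simp only [zero_add, Finset.range_one, Finset.sum_singleton, Nat.cast_zero, zero_mul, mul_zero]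
    linarith
  | succ n ih =>
    have ih := ih (fun t ht => hg t (ht.trans n.le_succ)) fun t ht => hθ t (ht.trans n.lt_succ_self)
    obtain ⟨u, hu, hz⟩ := hθ n n.lt_succ_self
    have hε0 : 0 ≤ ε := (norm_nonneg _).trans hz
    have h1 := newtonForm_sub_le_of_near (fun τ hτ => hg τ (hτ.trans n.le_succ)) hu hε hz hw
    rw [newtonForm_newtonStep_sub, newtonForm_succ, Finset.sum_range_succ,
      Finset.sum_range_succ _ (n + 1)]
    push_cast
    have h2 : (n : ℝ) * ((100 * n + 102400) * (17 * ε)) + (100 * (n + 1) + 102400) * (17 * ε)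
        ≤ (n + 1) * ((100 * (n + 1) + 102400) * (17 * ε)) := by
      have : (0 : ℝ) ≤ n * (100 * (17 * ε)) := by positivity
      nlinarith
    linarith

theorem ons_regret {d T : ℕ} (hd : 1 ≤ d) (hT : 1 ≤ T) {x θ : ℕ → Vec d} {y α : ℕ → ℝ}
    {ε : ℝ} (hε : ε ≤ 1 / (T : ℝ) ^ 2) (hx : ∀ t, ‖x t‖ ≤ 1) (hy : ∀ t, 0 ≤ y t ∧ y t ≤ 1)
    (hα : ∀ t < T, 0 ≤ α t ∧ α t ≤ 1) (hθ4 : ∀ t < T, ‖θ t‖ ≤ 4)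
    (hθ : ∀ t, t + 1 < T →
      let g : ℕ → Vec d := fun τ => onsGrad (α τ) (x τ) (y τ) (θ τ)
      ∃ u, IsProjBall (onsMatrix g t) (newtonStep (onsMatrix g t) (θ t) (g t)) u ∧
        ‖θ (t + 1) - u‖ ≤ ε)
    {w : Vec d} (hw : ‖w‖ ≤ 4) :
    ∑ t ∈ Finset.range T, α t * ((inner ℝ (θ t) (x t) - y t) ^ 2 - (inner ℝ w (x t) - y t) ^ 2)
      ≤ 6500 + 320 * (d * Real.log (T + d)) := by
  obtain ⟨n, rfl⟩ : ∃ n, T = n + 1 := ⟨T - 1, by omega⟩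
  set g : ℕ → Vec d := fun τ => onsGrad (α τ) (x τ) (y τ) (θ τ) with hgdef
  have hg : ∀ t ≤ n, ‖g t‖ ≤ 10 := fun t ht =>
    norm_onsGrad_le (hx t) (hθ4 t (by omega)) (hy t) (hα t (by omega))
  have hn1 : (1 : ℝ) ≤ ((n + 1 : ℕ) : ℝ) := by exact_mod_cast hT
  have hε1 : ε ≤ 1 := hε.trans (by rw [div_le_one (by positivity)]; nlinarith)
  refine (Finset.sum_le_sum fun t ht => scaled_loss_sub_le w (hx t)
    (hθ4 t (Finset.mem_range.mp ht)) (hy t) (hα t (Finset.mem_range.mp ht))).trans ?_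
  refine (ons_potential hε1 hw n hg (hθ4 0 (by omega)) fun t ht => hθ t (by omega)).trans ?_
  have h1 := newtonForm_self_nonneg g n (newtonStep (onsMatrix g n) (θ n) (g n) - w)
  have h2 := sum_inner_newtonDir_le hd hg
  -- The accumulated inexactness is bounded: `1742500 / 1280 < 6500 - 5120`.
  have h3 : (n : ℝ) * ((100 * n + 102400) * (17 * ε)) ≤ 1742500 := by
    have hnn : (0 : ℝ) ≤ n := Nat.cast_nonneg n
    rcases le_or_gt ε 0 with h | h
    · have : (0 : ℝ) ≤ n * ((100 * n + 102400) * (17 * (-ε))) := by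
        have : 0 ≤ -ε := by linarith
        positivity
      linarith
    · have e1 : ε * ((n + 1 : ℕ) : ℝ) ^ 2 ≤ 1 := by
        rwa [le_div_iff₀ (by positivity)] at hε
      have e2 : (n : ℝ) * (100 * n + 102400) ≤ 102500 * ((n + 1 : ℕ) : ℝ) ^ 2 := by
        push_cast
        nlinarith
      calc (n : ℝ) * ((100 * n + 102400) * (17 * ε)) = n * (100 * n + 102400) * (17 * ε) := by ring
        _ ≤ 102500 * ((n + 1 : ℕ) : ℝ) ^ 2 * (17 * ε) := by gcongr
        _ ≤ 1742500 := by linarith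
  push_cast
  linarith

/-! ### Randomized rounding -/

lemma gridPoint_mem {N : ℕ} (j : Fin (N + 1)) : 0 ≤ gridPoint N j ∧ gridPoint N j ≤ 1 := by
  have hj : ((j : ℕ) : ℝ) ≤ N := by exact_mod_cast Nat.lt_succ_iff.mp j.2
  exact ⟨div_nonneg (Nat.cast_nonneg _) (Nat.cast_nonneg _),
    div_le_one_of_le₀ hj (Nat.cast_nonneg _)⟩

lemma clip_mem (w : ℝ) : 0 ≤ clip w ∧ clip w ≤ 1 :=
  ⟨le_max_left _ _, max_le zero_le_one (min_le_right _ _)⟩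

lemma sq_clip_sub_le {y : ℝ} (hy : 0 ≤ y ∧ y ≤ 1) (w : ℝ) : (clip w - y) ^ 2 ≤ (w - y) ^ 2 := by
  unfold clip
  rcases le_total w 1 with h | h
  · rw [min_eq_left h]
    rcases le_total 0 w with h' | h'
    · rw [max_eq_right h']
    · rw [max_eq_left h']
      nlinarith
  · rw [min_eq_right h, max_eq_right zero_le_one]
    nlinarith

/-- The function `f` lives on all of `ℕ` so that the upper neighbour may lie off the grid. That
happens only for `w = 1`, where its weight is zero. -/
lemma sum_rround_mul {N : ℕ} {w : ℝ} (hw : 0 ≤ w ∧ w ≤ 1) (f : ℕ → ℝ) :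
    ∑ j : Fin (N + 1), rround N w j * f j
      = (⌊N * w⌋₊ + 1 - N * w) * f ⌊N * w⌋₊ + (N * w - ⌊N * w⌋₊) * f (⌊N * w⌋₊ + 1) := by
  have h0 : 0 ≤ N * w := mul_nonneg (Nat.cast_nonneg _) hw.1
  have hle : N * w ≤ N := mul_le_of_le_one_right (Nat.cast_nonneg _) hw.2
  have h2 := Nat.floor_le h0
  set m := ⌊N * w⌋₊ with hm
  have hmN : m ≤ N := Nat.floor_le_of_le hle
  have e : ∀ j : Fin (N + 1), rround N w j * f j
      = (fun k : ℕ => (if k = m then (m + 1 - N * w) * f m else 0)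
        + (if k = m + 1 then (N * w - m) * f (m + 1) else 0)) j := by
    intro j
    simp only [rround, ← hm]
    by_cases h : (j : ℕ) = m
    · simp [h]
    · by_cases h' : (j : ℕ) = m + 1
      · simp [h']
      · simp [h, h']
  rw [Finset.sum_congr rfl fun j _ => e j, Fin.sum_univ_eq_sum_range
    (fun k : ℕ => (if k = m then (m + 1 - N * w) * f m else 0)
        + (if k = m + 1 then (N * w - m) * f (m + 1) else 0)) (N + 1),
    Finset.sum_add_distrib, Finset.sum_ite_eq', Finset.sum_ite_eq',
    if_pos (Finset.mem_range.mpr (by omega))]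
  congr 1
  rcases hmN.lt_or_eq with h | h
  · rw [if_pos (Finset.mem_range.mpr (by omega))]
  · have : N * w - m = 0 := by
      rw [h] at h2 ⊢
      linarith
    rw [this]
    simp

lemma sum_rround {N : ℕ} {w : ℝ} (hw : 0 ≤ w ∧ w ≤ 1) : ∑ j, rround N w j = 1 := by
  have := sum_rround_mul (N := N) hw fun _ => 1
  simp only [mul_one] at this
  rw [this]
  ring

/-- Rounding is unbiased, so the excess is its variance `s (1 - s) / N^2`, with `s` the fractional
part of `N w`. -/
lemma sum_rround_mul_sq_le {N : ℕ} (hN : 1 ≤ N) {w : ℝ} (hw : 0 ≤ w ∧ w ≤ 1) (y : ℝ) :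
    ∑ j, rround N w j * (gridPoint N j - y) ^ 2 ≤ (w - y) ^ 2 + 1 / (4 * (N : ℝ) ^ 2) := by
  have h := sum_rround_mul (N := N) hw fun k => ((k : ℝ) / N - y) ^ 2
  have hN' : (0 : ℝ) < N := by exact_mod_cast hN
  simp only [gridPoint]
  rw [h]
  set m := ⌊N * w⌋₊
  obtain ⟨s, hs⟩ : ∃ s, s = N * w - m := ⟨_, rfl⟩
  have hw' : w = (m + s) / N := by rw [hs]; field_simp; ring
  have e1 : (m : ℝ) + 1 - N * w = 1 - s := by rw [hs]; ring
  rw [e1, ← hs, hw']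
  have e2 : (1 - s) * ((m : ℝ) / N - y) ^ 2 + s * (((m + 1 : ℕ) : ℝ) / N - y) ^ 2
      = ((m + s) / N - y) ^ 2 + s * (1 - s) / (N : ℝ) ^ 2 := by
    push_cast
    field_simp
    ring
  rw [e2, show 1 / (4 * (N : ℝ) ^ 2) = (1 / 4) / (N : ℝ) ^ 2 by field_simp]
  gcongr
  nlinarith [sq_nonneg (s - 1 / 2)]

/-! ### Pseudo swap regret of the Blum–Mansour reduction -/

/-- By near stationarity, drawing from `P` is nearly drawing a learner from `P` and rounding its
clipped value. The losses lie in `[0, 1]`, so the defect costs at most `ε`; clipping does not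
increase the loss as `y` lies in `[0, 1]`. -/
lemma sum_sq_le_of_near_stationary {N : ℕ} (hN : 1 ≤ N) {P v : Fin (N + 1) → ℝ} {y ε : ℝ}
    (hy : 0 ≤ y ∧ y ≤ 1) (hP : P ∈ stdSimplex ℝ (Fin (N + 1)))
    (h : ∑ j, |(∑ i, rround N (clip (v i)) j * P i) - P j| ≤ ε) :
    ∑ j, P j * (gridPoint N j - y) ^ 2 ≤ ∑ i, P i * (v i - y) ^ 2 + 1 / (4 * (N : ℝ) ^ 2) + ε := by
  have h1 : ∑ j, (P j - ∑ i, rround N (clip (v i)) j * P i) * (gridPoint N j - y) ^ 2 ≤ ε := by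
    refine (Finset.sum_le_sum fun j _ => ?_).trans h
    have hg := gridPoint_mem j
    rw [abs_sub_comm]
    have : (gridPoint N j - y) ^ 2 ≤ 1 := by nlinarith
    calc _ ≤ |P j - ∑ i, rround N (clip (v i)) j * P i| * (gridPoint N j - y) ^ 2 := by
          gcongr; exact le_abs_self _
      _ ≤ |P j - ∑ i, rround N (clip (v i)) j * P i| * 1 := by gcongr
      _ = _ := mul_one _
  have h2 : ∑ j, (∑ i, rround N (clip (v i)) j * P i) * (gridPoint N j - y) ^ 2
      ≤ ∑ i, P i * (v i - y) ^ 2 + 1 / (4 * (N : ℝ) ^ 2) := by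
    calc ∑ j, (∑ i, rround N (clip (v i)) j * P i) * (gridPoint N j - y) ^ 2
        = ∑ i, P i * ∑ j, rround N (clip (v i)) j * (gridPoint N j - y) ^ 2 := by
          simp only [Finset.sum_mul, Finset.mul_sum]
          rw [Finset.sum_comm]
          exact Finset.sum_congr rfl fun _ _ => Finset.sum_congr rfl fun _ _ => by ring
      _ ≤ ∑ i, P i * ((v i - y) ^ 2 + 1 / (4 * (N : ℝ) ^ 2)) := by
          refine Finset.sum_le_sum fun i _ => mul_le_mul_of_nonneg_left ?_ (hP.1 i)
          refine (sum_rround_mul_sq_le hN (clip_mem _) y).trans ?_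
          gcongr ?_ + _
          exact sq_clip_sub_le hy _
      _ = _ := by
          simp only [mul_add, Finset.sum_add_distrib]
          rw [← Finset.sum_mul, hP.2, one_mul]
  simp only [sub_mul, Finset.sum_sub_distrib] at h1
  linarith

/-- Learner `j` sees the losses weighted by `P t j`, so the sum of the learners' regrets against
separate comparators is a swap regret, up to rounding. The summand `1` pays for `T` stationarity
defects of size `1 / T^2`. -/
theorem IsBMRun.sum_regret_le {ε : ℝ} {N d T : ℕ} {x : ℕ → Context d} {y : ℕ → ℝ}
    {P : ℕ → Fin (N + 1) → ℝ} (h : IsBMRun ε d T x y P) (hε : ε ≤ 1 / (T : ℝ) ^ 2)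
    (hN : 1 ≤ N) (hd : 1 ≤ d) (hT : 1 ≤ T) (hy : ∀ t, 0 ≤ y t ∧ y t ≤ 1)
    {u : Fin (N + 1) → Vec d} (hu : ∀ j, ‖u j‖ ≤ 4) :
    ∑ j, ∑ t ∈ Finset.range T,
        P t j * ((gridPoint N j - y t) ^ 2 - (inner ℝ (u j) (x t).1 - y t) ^ 2)
      ≤ T / (4 * (N : ℝ) ^ 2) + 1 + (N + 1) * (6500 + 320 * (d * Real.log (T + d))) := by
  obtain ⟨θ, h0, hstat, hons⟩ := h
  have hT' : (1 : ℝ) ≤ T := by exact_mod_cast hT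
  have h4 : ∀ t < T, ∀ i, ‖θ t i‖ ≤ 4 := by
    intro t ht i
    cases t with
    | zero => exact h0 i
    | succ t => exact (hons t ht i).1
  have hP1 : ∀ t < T, ∀ i, 0 ≤ P t i ∧ P t i ≤ 1 := fun t ht i =>
    ⟨(hstat t ht).1.1 i, by
      rw [← (hstat t ht).1.2]
      exact Finset.single_le_sum (fun j _ => (hstat t ht).1.1 j) (Finset.mem_univ i)⟩
  have hreg : ∀ i, ∑ t ∈ Finset.range T, P t i * ((inner ℝ (θ t i) (x t).1 - y t) ^ 2
      - (inner ℝ (u i) (x t).1 - y t) ^ 2) ≤ 6500 + 320 * (d * Real.log (T + d)) := fun i =>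
    ons_regret hd hT hε (x := fun t => (x t).1) (θ := fun t => θ t i) (α := fun t => P t i)
      (fun t => (x t).2.1) hy (fun t ht => hP1 t ht i) (fun t ht => h4 t ht i)
      (fun t ht => (hons t ht i).2) (hu i)
  have hround : ∀ t ∈ Finset.range T, ∑ j, P t j * (gridPoint N j - y t) ^ 2
      ≤ ∑ i, P t i * (inner ℝ (θ t i) (x t).1 - y t) ^ 2
        + (1 / (4 * (N : ℝ) ^ 2) + 1 / (T : ℝ) ^ 2) := by
    intro t ht
    obtain ⟨hP, hs⟩ := hstat t (Finset.mem_range.mp ht)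
    have := sum_sq_le_of_near_stationary hN (hy t) hP hs
    linarith
  have hA := Finset.sum_le_sum hround
  have hB := Finset.sum_le_sum fun i (_ : i ∈ Finset.univ) => hreg i
  rw [Finset.sum_add_distrib] at hA
  simp only [mul_sub, Finset.sum_sub_distrib, Finset.sum_const, Finset.card_univ,
    Fintype.card_fin, Finset.card_range, nsmul_eq_mul] at hA hB ⊢
  rw [Finset.sum_comm] at hA
  rw [Finset.sum_comm (s := Finset.range T)
    (f := fun t i => P t i * (inner ℝ (θ t i) (x t).1 - y t) ^ 2)] at hA
  push_cast at hB
  have e : (T : ℝ) * (1 / (4 * (N : ℝ) ^ 2) + 1 / (T : ℝ) ^ 2) ≤ T / (4 * (N : ℝ) ^ 2) + 1 := by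
    have : (T : ℝ) * (1 / (T : ℝ) ^ 2) ≤ 1 := by
      rw [mul_one_div, div_le_one (by positivity)]
      nlinarith
    rw [mul_add, mul_one_div]
    linarith
  linarith

/-! ### The law of the predictions -/

section law

open MeasureTheory

/-- The law of one prediction. -/
def gridLaw {N : ℕ} (q : Fin (N + 1) → ℝ) : Measure (Fin (N + 1)) :=
  ∑ j, ENNReal.ofReal (q j) • Measure.dirac j

lemma isProbabilityMeasure_gridLaw {N : ℕ} {q : Fin (N + 1) → ℝ}
    (hq : q ∈ stdSimplex ℝ (Fin (N + 1))) : IsProbabilityMeasure (gridLaw q) := by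
  constructor
  simp only [gridLaw, Measure.finsetSum_apply, Measure.smul_apply, measure_univ, smul_eq_mul,
    mul_one]
  rw [← ENNReal.ofReal_sum_of_nonneg fun i _ => hq.1 i, hq.2, ENNReal.ofReal_one]

lemma integral_gridLaw {N : ℕ} {q : Fin (N + 1) → ℝ}
    (hq : q ∈ stdSimplex ℝ (Fin (N + 1))) (f : Fin (N + 1) → ℝ) :
    ∫ k, f k ∂(gridLaw q) = ∑ k, q k * f k := by
  have hfin : ∀ k, IsFiniteMeasure (ENNReal.ofReal (q k) • Measure.dirac k) := fun k =>
    Measure.smul_finite _ ENNReal.ofReal_ne_top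
  rw [gridLaw, integral_finsetSum_measure fun _ _ => Integrable.of_finite]
  refine Finset.sum_congr rfl fun k _ => ?_
  rw [integral_smul_measure, integral_dirac, ENNReal.toReal_ofReal (hq.1 k), smul_eq_mul]

lemma isProbabilityMeasure_predictionLaw {N T : ℕ} {P : ℕ → Fin (N + 1) → ℝ}
    (hP : ∀ t < T, P t ∈ stdSimplex ℝ (Fin (N + 1))) :
    IsProbabilityMeasure (predictionLaw T P) := by
  have : ∀ t : Fin T, IsProbabilityMeasure (gridLaw (P t)) := fun t =>
    isProbabilityMeasure_gridLaw (hP t t.2)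
  exact inferInstanceAs (IsProbabilityMeasure (Measure.pi fun t : Fin T => gridLaw (P t)))

/-- Combines `e^z ≤ 1 + z + z^2` for `|z| ≤ 1` with `1 + u ≤ e^u`. The factor `q j` also multiplies
the quadratic term, so the exponent stays a weighted sum of losses. -/
lemma integral_exp_gridLaw_le {N : ℕ} {q : Fin (N + 1) → ℝ}
    (hq : q ∈ stdSimplex ℝ (Fin (N + 1))) (j : Fin (N + 1)) {z : ℝ} (hz : |z| ≤ 1) :
    ∫ k, Real.exp (if k = j then z else 0) ∂(gridLaw q) ≤ Real.exp (q j * (z + z ^ 2)) := by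
  have e : ∀ k, q k * Real.exp (if k = j then z else 0)
      = q k + if k = j then q j * (Real.exp z - 1) else 0 := by
    intro k
    split_ifs with h
    · rw [h]; ring
    · simp
  rw [integral_gridLaw hq, Finset.sum_congr rfl fun k _ => e k, Finset.sum_add_distrib, hq.2,
    Finset.sum_ite_eq', if_pos (Finset.mem_univ j)]
  have h1 := (abs_le.mp (Real.abs_exp_sub_one_sub_id_le hz)).2
  have h2 := Real.add_one_le_exp (q j * (z + z ^ 2))
  have h3 := mul_le_mul_of_nonneg_left (sub_nonneg.mpr h1) (hq.1 j)
  nlinarith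

lemma integral_exp_predictionLaw_le {N T : ℕ} {P : ℕ → Fin (N + 1) → ℝ}
    (hP : ∀ t < T, P t ∈ stdSimplex ℝ (Fin (N + 1))) (j : Fin (N + 1)) {z : ℕ → ℝ}
    (hz : ∀ t, |z t| ≤ 1) :
    ∫ p, Real.exp (∑ t : Fin T, if p t = j then z t else 0) ∂(predictionLaw T P)
      ≤ Real.exp (∑ t ∈ Finset.range T, P t j * (z t + z t ^ 2)) := by
  have : ∀ t : Fin T, IsProbabilityMeasure (gridLaw (P t)) := fun t =>
    isProbabilityMeasure_gridLaw (hP t t.2)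
  have e := integral_fintype_prod_eq_prod (𝕜 := ℝ) (μ := fun t : Fin T => gridLaw (P t))
    (fun (t : Fin T) k => Real.exp (if k = j then z t else 0))
  simp only [Real.exp_sum]
  refine (le_of_eq e).trans ?_
  rw [← Fin.prod_univ_eq_prod_range (fun t => Real.exp (P t j * (z t + z t ^ 2)))]
  exact Finset.prod_le_prod (fun t _ => integral_nonneg fun _ => (Real.exp_pos _).le)
    fun t _ => integral_exp_gridLaw_le (hP t t.2) j (hz t)

/-- A bounded exponential moment gives a tail bound and a bound of the expectation. -/
lemma tail_and_mean_of_exp_moment {Ω : Type*} [MeasurableSpace Ω] [Finite Ω]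
    [MeasurableSingletonClass Ω] {μ : Measure Ω} [IsProbabilityMeasure μ] {X : Ω → ℝ} {b K : ℝ}
    (hK : 0 < K) (h : ∫ p, Real.exp ((X p - b) / K) ∂μ ≤ 1) :
    (∀ δ : ℝ, 0 < δ → 1 - δ ≤ μ.real {p | X p ≤ b + K * Real.log (1 / δ)}) ∧ ∫ p, X p ∂μ ≤ b := by
  constructor
  · intro δ hδ
    -- Markov's inequality at level `1 / δ`.
    have h1 := mul_meas_ge_le_integral_of_nonneg (μ := μ)
      (f := fun p => Real.exp ((X p - b) / K))
      (Filter.Eventually.of_forall fun _ => (Real.exp_pos _).le) Integrable.of_finite (1 / δ)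
    have h2 : μ.real {p | 1 / δ ≤ Real.exp ((X p - b) / K)} ≤ δ := by
      have := h1.trans h
      rwa [one_div_mul_eq_div, div_le_one hδ] at this
    have h3 : μ.real {p | X p ≤ b + K * Real.log (1 / δ)}ᶜ ≤ δ := by
      refine (measureReal_mono ?_).trans h2
      intro p hp
      simp only [Set.mem_compl_iff, Set.mem_ofPred_eq, not_le] at hp ⊢
      rw [← Real.log_le_iff_le_exp (by positivity), le_div_iff₀ hK]
      linarith
    rw [probReal_compl_eq_one_sub (Set.toFinite _).measurableSet] at h3
    linarith
  -- The mean follows from the same moment by `u + 1 ≤ e^u`, without integrating the tail.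
  · have h1 : ∫ p, ((X p - b) / K + 1) ∂μ ≤ 1 :=
      (integral_mono Integrable.of_finite Integrable.of_finite
        fun p => Real.add_one_le_exp _).trans h
    rw [integral_add Integrable.of_finite Integrable.of_finite, integral_div,
      integral_sub Integrable.of_finite Integrable.of_finite] at h1
    simp only [integral_const, probReal_univ, smul_eq_mul, one_mul] at h1
    have h2 : (∫ p, X p ∂μ - b) / K ≤ 0 := by linarith
    rw [div_le_iff₀ hK] at h2
    linarith

end law

/-! ### Comparators -/

/-- The difference of squared losses of `z` and `z + h` for the label `y`. -/
def lossGap (z y h : ℝ) : ℝ := 2 * h * (y - z) - h ^ 2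

/-- Split `θ` into its first coordinate and the orthogonal part `v`. The points `e / 2 ± w / 2`,
with `w` the direction of `v`, are contexts, and testing both signs bounds `|θ_0| + ‖v‖` by `2`. -/
lemma norm_le_two_of_linClass {d : ℕ} (hd : 1 ≤ d) {θ : Vec d}
    (h : ∀ x : Context d, inner ℝ θ x.1 ^ 2 ≤ 1) : ‖θ‖ ≤ 2 := by
  set i0 : Fin d := ⟨0, hd⟩
  set e : Vec d := EuclideanSpace.single i0 1 with he
  set v : Vec d := θ - θ i0 • e with hv
  have hee : ‖e‖ = 1 := by simp [he]
  have hv0 : v i0 = 0 := by simp [hv, he]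
  have hev : inner ℝ e v = 0 := by simp [he, EuclideanSpace.inner_single_left, hv0]
  have hθ : θ = θ i0 • e + v := by simp [hv]
  obtain ⟨w, hw1, hw0, hwv, hew⟩ : ∃ w : Vec d, ‖w‖ ≤ 1 ∧ w i0 = 0 ∧ inner ℝ v w = ‖v‖ ∧
      inner ℝ e w = 0 := by
    by_cases h0 : v = 0
    · exact ⟨0, by simp, by simp, by simp [h0], by simp⟩
    · have hp : 0 < ‖v‖ := norm_pos_iff.mpr h0
      refine ⟨(1 / ‖v‖) • v, ?_, by simp [hv0], ?_, ?_⟩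
      · rw [norm_smul, Real.norm_of_nonneg (by positivity), one_div, inv_mul_cancel₀ hp.ne']
      · rw [real_inner_smul_right, real_inner_self_eq_norm_sq]
        field_simp
      · rw [real_inner_smul_right, hev, mul_zero]
  have hx : ∀ s : ℝ, |s| = 1 → |θ i0 / 2 + s * ‖v‖ / 2| ≤ 1 := by
    intro s hs
    have hmem : ‖(1 / 2 : ℝ) • e + (s / 2) • w‖ ≤ 1 ∧ ∀ i : Fin d, (i : ℕ) = 0 →
        ((1 / 2 : ℝ) • e + (s / 2) • w) i = 1 / 2 := by
      constructor
      · refine (norm_add_le _ _).trans ?_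
        rw [norm_smul, norm_smul, hee, Real.norm_eq_abs, Real.norm_eq_abs, abs_div, abs_div, hs]
        norm_num
        linarith
      · intro i hi
        have : i = i0 := Fin.ext hi
        subst this
        simp [he, hw0]
    have h1 := h ⟨_, hmem⟩
    rw [sq_le_one_iff_abs_le_one] at h1
    have key : inner ℝ θ ((1 / 2 : ℝ) • e + (s / 2) • w) = θ i0 / 2 + s * ‖v‖ / 2 := by
      conv_lhs => rw [hθ]
      rw [inner_add_left, real_inner_smul_left, inner_add_right, inner_add_right,
        real_inner_smul_right, real_inner_smul_right, real_inner_smul_right,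
        real_inner_smul_right, real_inner_self_eq_norm_sq, hee, hew, hwv, real_inner_comm, hev]
      ring
    rwa [key] at h1
  have h1 := abs_le.mp (hx 1 (by simp))
  have h2 := abs_le.mp (hx (-1) (by simp))
  rw [hθ]
  refine (norm_add_le _ _).trans ?_
  rw [norm_smul, hee, Real.norm_eq_abs, mul_one]
  rcases abs_cases (θ i0) with h3 | h3 <;> rw [h3.1] <;> linarith

/-- A coordinate grid of mesh `1 / (T d)` suffices, since the Euclidean error is at most `√d / (T
d)`. Points of norm above `3` can be discarded because `2 + 1 / T ≤ 3`. -/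
lemma exists_net {d T : ℕ} (hd : 1 ≤ d) (hT : 1 ≤ T) :
    ∃ G : Finset (Vec d), G.card ≤ (4 * T * d + 1) ^ d ∧ (∀ g ∈ G, ‖g‖ ≤ 3) ∧
      ∀ v : Vec d, ‖v‖ ≤ 2 → ∃ g ∈ G, ‖v - g‖ ≤ 1 / (T : ℝ) := by
  classical
  have hT' : (1 : ℝ) ≤ T := by exact_mod_cast hT
  have hd' : (1 : ℝ) ≤ d := by exact_mod_cast hd
  set M : ℕ := T * d with hM
  have hMr : (M : ℝ) = T * d := by simp [hM]
  have hM0 : (0 : ℝ) < M := by rw [hMr]; positivity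
  let F : (Fin d → ℤ) → Vec d := fun k => WithLp.toLp 2 fun i => (k i : ℝ) / M
  let S : Finset (Fin d → ℤ) := Fintype.piFinset fun _ => Finset.Icc (-(2 * M : ℤ)) (2 * M)
  refine ⟨(S.image F).filter fun g => ‖g‖ ≤ 3, ?_, fun g hg => (Finset.mem_filter.mp hg).2, ?_⟩
  · refine (Finset.card_filter_le _ _).trans (Finset.card_image_le.trans ?_)
    simp only [S, Fintype.card_piFinset, Int.card_Icc, Finset.prod_const, Finset.card_univ,
      Fintype.card_fin]
    refine Nat.pow_le_pow_left ?_ d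
    rw [Int.toNat_le]
    push_cast [hM]
    linarith
  · intro v hv
    have hi : ∀ i, |v i| ≤ 2 := fun i => (PiLp.norm_apply_le v i).trans hv
    set k : Fin d → ℤ := fun i => ⌊v i * M⌋ with hk
    have hdist : ‖v - F k‖ ≤ 1 / (T : ℝ) := by
      rw [EuclideanSpace.norm_eq]
      have h1 : ∀ i, ‖(v - F k) i‖ ^ 2 ≤ (1 / (M : ℝ)) ^ 2 := by
        intro i
        have e : (v - F k) i = Int.fract (v i * M) / M := by
          simp only [F, hk, PiLp.sub_apply, Int.fract]
          field_simp
        rw [e, Real.norm_of_nonneg (div_nonneg (Int.fract_nonneg _) hM0.le)]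
        refine pow_le_pow_left₀ (div_nonneg (Int.fract_nonneg _) hM0.le) ?_ 2
        gcongr
        exact (Int.fract_lt_one _).le
      refine Real.sqrt_le_iff.mpr ⟨by positivity, (Finset.sum_le_sum fun i _ => h1 i).trans ?_⟩
      simp only [Finset.sum_const, Finset.card_univ, Fintype.card_fin, nsmul_eq_mul]
      rw [hMr]
      field_simp
      exact hd'
    refine ⟨F k, Finset.mem_filter.mpr ⟨Finset.mem_image.mpr ⟨k, ?_, rfl⟩, ?_⟩, hdist⟩
    · refine Fintype.mem_piFinset.mpr fun i => Finset.mem_Icc.mpr ?_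
      have := abs_le.mp (hi i)
      constructor
      · refine Int.le_floor.mpr ?_
        push_cast
        nlinarith
      · have : ⌊v i * M⌋ ≤ ⌊(2 * M : ℝ)⌋ := Int.floor_le_floor (by nlinarith)
        refine this.trans (le_of_eq ?_)
        have := Int.floor_intCast (R := ℝ) (2 * M)
        push_cast at this
        exact this
    · have e : F k = v - (v - F k) := by abel
      rw [e]
      refine (norm_sub_le _ _).trans ?_
      have : 1 / (T : ℝ) ≤ 1 := by rw [div_le_one (by positivity)]; exact hT'
      linarith

/-! ### From swap multicalibration to swap regret -/

/-- The accumulated loss gap, against the comparator `z_j + ⟪g, ·⟫`, of the rounds in which the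
prediction is `z_j`. -/
def hitGap {d N T : ℕ} (x : ℕ → Context d) (y : ℕ → ℝ) (j : Fin (N + 1)) (g : Vec d)
    (p : Fin T → Fin (N + 1)) : ℝ :=
  ∑ t : Fin T, if p t = j then lossGap (gridPoint N j) (y t) (inner ℝ g (x t).1) else 0

lemma sum_hits {N T : ℕ} (p : Fin T → Fin (N + 1)) : ∑ j, hits p j = T := by
  simp only [hits]
  rw [Finset.sum_comm]
  simp

lemma hits_nonneg {N T : ℕ} (p : Fin T → Fin (N + 1)) (j : Fin (N + 1)) : 0 ≤ hits p j :=
  Finset.sum_nonneg fun t _ => by split_ifs <;> norm_num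

section rho

variable {d N T : ℕ} {x : ℕ → Context d} {y : ℕ → ℝ}

lemma abs_rho_le_one (hy : ∀ t, 0 ≤ y t ∧ y t ≤ 1) (p : Fin T → Fin (N + 1)) (j : Fin (N + 1))
    {f : Context d → ℝ} (hf : ∀ c, f c ^ 2 ≤ 1) : |rho x y p j f| ≤ 1 := by
  rw [rho, abs_div, abs_of_nonneg (hits_nonneg p j)]
  refine div_le_one_of_le₀ ((Finset.abs_sum_le_sum_abs _ _).trans ?_) (hits_nonneg p j)
  refine Finset.sum_le_sum fun t _ => ?_
  split_ifs
  · have h1 := sq_le_one_iff_abs_le_one _ |>.mp (hf (x t))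
    have hg := gridPoint_mem j
    have h2 : |y t - gridPoint N j| ≤ 1 := abs_le.mpr
      ⟨by linarith [(hy t).1], by linarith [(hy t).2]⟩
    rw [abs_mul]
    exact mul_le_one₀ h1 (abs_nonneg _) h2
  · simp

lemma hits_mul_rho (p : Fin T → Fin (N + 1)) (j : Fin (N + 1)) (f : Context d → ℝ) :
    hits p j * rho x y p j f
      = ∑ t : Fin T, if p t = j then f (x t) * (y t - gridPoint N j) else 0 := by
  rw [rho]
  by_cases h : hits p j = 0
  · rw [h, zero_mul]
    symm
    have h' : ∀ t, p t ≠ j := by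
      intro t ht
      have h1 := Finset.single_le_sum (f := fun t => if p t = j then (1 : ℝ) else 0)
        (fun t _ => by split_ifs <;> norm_num) (Finset.mem_univ t)
      rw [hits] at h
      simp only [ht, if_true] at h1
      linarith
    exact Finset.sum_eq_zero fun t _ => if_neg (h' t)
  · field_simp

/-- Squaring the average selects the scale `r` of the comparator: `n r^2` is the value of `2 s (n r)
- s^2 n` at `s = r`. The net point depends on the realized predictions through `r`, which is why a
bound uniform over the net is needed later. -/
lemma hits_mul_rho_sq_le (hy : ∀ t, 0 ≤ y t ∧ y t ≤ 1) (p : Fin T → Fin (N + 1))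
    (j : Fin (N + 1)) {f : Context d → ℝ} (hf : f ∈ linClass d 1) (hd : 1 ≤ d) (hT : 1 ≤ T)
    {G : Finset (Vec d)} (hG : ∀ v : Vec d, ‖v‖ ≤ 2 → ∃ g ∈ G, ‖v - g‖ ≤ 1 / (T : ℝ)) :
    ∃ g ∈ G, hits p j * |rho x y p j f| ^ 2 ≤ hitGap x y j g p + hits p j * (5 / T) := by
  obtain ⟨⟨θ, hθ⟩, hf1⟩ := hf
  set r := rho x y p j f with hr
  have hr1 : |r| ≤ 1 := abs_rho_le_one hy p j hf1
  have hθ2 : ‖θ‖ ≤ 2 := norm_le_two_of_linClass hd fun c => by rw [← hθ]; exact hf1 c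
  obtain ⟨g, hgG, hg⟩ := hG (r • θ) (by
    rw [norm_smul, Real.norm_eq_abs]
    nlinarith [norm_nonneg θ])
  refine ⟨g, hgG, ?_⟩
  have hT' : (1 : ℝ) ≤ T := by exact_mod_cast hT
  set η : ℝ := 1 / T with hη
  have hη0 : 0 ≤ η := by positivity
  have hη1 : η ≤ 1 := by rw [hη, div_le_one (by positivity)]; exact hT'
  have e1 : hits p j * |r| ^ 2
      ≤ ∑ t : Fin T, if p t = j then lossGap (gridPoint N j) (y t) (r * f (x t)) else 0 := by
    have h1 : hits p j * |r| ^ 2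
        = 2 * r * (∑ t : Fin T, if p t = j then f (x t) * (y t - gridPoint N j) else 0)
          - r ^ 2 * hits p j := by
      rw [← hits_mul_rho, sq_abs, ← hr]
      ring
    rw [h1, hits, Finset.mul_sum, Finset.mul_sum, ← Finset.sum_sub_distrib]
    refine Finset.sum_le_sum fun t _ => ?_
    split_ifs
    · simp only [lossGap]
      -- The bound `f^2 ≤ 1` replaces `r^2` by the smaller `(r f)^2`.
      nlinarith [mul_le_mul_of_nonneg_left (hf1 (x t)) (sq_nonneg r)]
    · simp
  refine e1.trans ?_
  rw [hitGap, hits, Finset.sum_mul, ← Finset.sum_add_distrib]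
  refine Finset.sum_le_sum fun t _ => ?_
  split_ifs
  · have h2 : |r * f (x t) - inner ℝ g (x t).1| ≤ η := by
      rw [hθ, ← real_inner_smul_left, ← inner_sub_left]
      refine (abs_real_inner_le_norm _ _).trans ?_
      calc ‖r • θ - g‖ * ‖(x t).1‖ ≤ η * 1 := by
            gcongr
            exact (x t).2.1
        _ = η := mul_one _
    have h3 : |r * f (x t)| ≤ 1 := by
      rw [abs_mul]
      exact mul_le_one₀ hr1 (abs_nonneg _) (sq_le_one_iff_abs_le_one _ |>.mp (hf1 (x t)))
    have e5 : (1 : ℝ) * (5 / T) = 5 * η := by rw [hη]; ring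
    rw [e5]
    have hz := gridPoint_mem j
    generalize gridPoint N j = z at hz ⊢
    generalize r * f (x t) = a at h2 h3 ⊢
    generalize inner ℝ g (x t).1 = b at h2 ⊢
    -- The Lipschitz constant of the gap on the relevant range: `2 + 1 + 2`, as `|b| ≤ 1 + η ≤ 2`.
    have h4 : |2 * (y t - z) - (a + b)| ≤ 5 := by
      rw [abs_le] at h2 h3 ⊢
      constructor <;> linarith [(hy t).1, (hy t).2, hz.1, hz.2]
    have h5 : lossGap z (y t) a - lossGap z (y t) b = (a - b) * (2 * (y t - z) - (a + b)) := by
      simp only [lossGap]; ring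
    have h6 := le_abs_self ((a - b) * (2 * (y t - z) - (a + b)))
    rw [abs_mul] at h6
    have h7 : |a - b| * |2 * (y t - z) - (a + b)| ≤ η * 5 := by gcongr
    linarith
  · simp

end rho

instance {d : ℕ} : Nonempty (linClass d 1) :=
  ⟨⟨fun _ => 0, ⟨0, fun _ => by simp⟩, fun _ => by norm_num⟩⟩

lemma SMCal_le_sum {d N T : ℕ} {x : ℕ → Context d} {y : ℕ → ℝ} (hy : ∀ t, 0 ≤ y t ∧ y t ≤ 1)
    (hd : 1 ≤ d) (hT : 1 ≤ T) (p : Fin T → Fin (N + 1)) {G : Finset (Vec d)}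
    (hG : ∀ v : Vec d, ‖v‖ ≤ 2 → ∃ g ∈ G, ‖v - g‖ ≤ 1 / (T : ℝ)) {M : Fin (N + 1) → ℝ}
    (hM : ∀ j, ∀ g ∈ G, hitGap x y j g p ≤ M j) :
    SMCal (linClass d 1) 2 x y p ≤ ∑ j, M j + 5 := by
  have hT' : (1 : ℝ) ≤ T := by exact_mod_cast hT
  refine ciSup_le fun f => ?_
  have h1 : ∀ j, hits p j * |rho x y p j (f j).1| ^ 2 ≤ M j + hits p j * (5 / T) := by
    intro j
    obtain ⟨g, hg, h⟩ := hits_mul_rho_sq_le (x := x) hy p j (f j).2 hd hT hG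
    exact h.trans (by gcongr; exact hM j g hg)
  refine (Finset.sum_le_sum fun j _ => h1 j).trans ?_
  rw [Finset.sum_add_distrib, ← Finset.sum_mul, sum_hits]
  have : (T : ℝ) * (5 / T) = 5 := by field_simp
  rw [this]

lemma SMCal_le_card {d N T : ℕ} {x : ℕ → Context d} {y : ℕ → ℝ} (hy : ∀ t, 0 ≤ y t ∧ y t ≤ 1)
    (p : Fin T → Fin (N + 1)) : SMCal (linClass d 1) 2 x y p ≤ T := by
  refine ciSup_le fun f => ?_
  rw [← sum_hits p]
  refine Finset.sum_le_sum fun j _ => mul_le_of_le_one_right (hits_nonneg p j) ?_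
  exact pow_le_one₀ (abs_nonneg _) (abs_rho_le_one hy p j (f j).2.2)

/-! ### The exponential moment of the swap multicalibration error -/

section moment

open MeasureTheory

variable {d N T : ℕ} {x : ℕ → Context d} {y : ℕ → ℝ} {P : ℕ → Fin (N + 1) → ℝ}

/-- The comparator `z_j + ⟪g, ·⟫ / 2` on the context space as a linear function. -/
def shiftedComparator (hd : 1 ≤ d) (j : Fin (N + 1)) (g : Vec d) : Vec d :=
  (2 * gridPoint N j) • EuclideanSpace.single (⟨0, hd⟩ : Fin d) (1 : ℝ) + (1 / 2 : ℝ) • g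

lemma norm_shiftedComparator_le (hd : 1 ≤ d) (j : Fin (N + 1)) {g : Vec d} (hg : ‖g‖ ≤ 3) :
    ‖shiftedComparator hd j g‖ ≤ 4 := by
  have hz := gridPoint_mem j
  refine (norm_add_le _ _).trans ?_
  rw [norm_smul, norm_smul, PiLp.norm_single, Real.norm_of_nonneg (by linarith)]
  norm_num
  linarith

/-- The first coordinate of a context is `1/2`, so the coefficient `2 z_j` produces the constant
`z_j`. -/
lemma inner_shiftedComparator (hd : 1 ≤ d) (j : Fin (N + 1)) (g : Vec d) (c : Context d) :
    inner ℝ (shiftedComparator hd j g) c.1 = gridPoint N j + inner ℝ g c.1 / 2 := by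
  rw [shiftedComparator, inner_add_left, real_inner_smul_left, real_inner_smul_left,
    EuclideanSpace.inner_single_left, c.2.2 ⟨0, hd⟩ rfl]
  simp
  ring

/-- The realized gap for the shift `g` is compared with the pseudo regret for the shift `g / 2`.
This removes the variance term that would otherwise appear. The scale `50` exceeds the bound `3 · 5`
on a single gap. -/
lemma integral_exp_hitGap_le (hd : 1 ≤ d) (hy : ∀ t, 0 ≤ y t ∧ y t ≤ 1)
    (hP : ∀ t < T, P t ∈ stdSimplex ℝ (Fin (N + 1))) (j : Fin (N + 1)) {g : Vec d}
    (hg : ‖g‖ ≤ 3) :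
    ∫ p : Fin T → Fin (N + 1), Real.exp (hitGap x y j g p / 50) ∂(predictionLaw T P)
      ≤ Real.exp (1 / 25 * ∑ t ∈ Finset.range T, P t j * ((gridPoint N j - y t) ^ 2
        - (inner ℝ (shiftedComparator hd j g) (x t).1 - y t) ^ 2)) := by
  have hz := gridPoint_mem j
  have hh : ∀ t, |inner ℝ g (x t).1| ≤ 3 := fun t => by
    refine (abs_real_inner_le_norm _ _).trans ?_
    nlinarith [norm_nonneg g, norm_nonneg (x t).1, (x t).2.1]
  set z : ℕ → ℝ := fun t => lossGap (gridPoint N j) (y t) (inner ℝ g (x t).1) / 50 with hzdef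
  have hgap : ∀ t, lossGap (gridPoint N j) (y t) (inner ℝ g (x t).1)
      = inner ℝ g (x t).1 * (2 * (y t - gridPoint N j) - inner ℝ g (x t).1) := fun t => by
    rw [lossGap]; ring
  have hfac : ∀ t, |2 * (y t - gridPoint N j) - inner ℝ g (x t).1| ≤ 5 := fun t => by
    have := abs_le.mp (hh t)
    rw [abs_le]
    constructor <;> linarith [(hy t).1, (hy t).2, hz.1, hz.2]
  have hz1 : ∀ t, |z t| ≤ 1 := fun t => by
    simp only [hzdef]
    rw [hgap, abs_div, abs_mul, abs_of_pos (by norm_num : (0 : ℝ) < 50), div_le_one (by norm_num)]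
    calc _ ≤ (3 : ℝ) * 5 := by
          gcongr
          · exact hh t
          · exact hfac t
      _ ≤ 50 := by norm_num
  have e : ∀ p : Fin T → Fin (N + 1),
      hitGap x y j g p / 50 = ∑ t : Fin T, if p t = j then z t else 0 := fun p => by
    rw [hitGap, Finset.sum_div]
    exact Finset.sum_congr rfl fun t _ => by split_ifs <;> simp [hzdef]
  simp only [e]
  refine (integral_exp_predictionLaw_le hP j hz1).trans (Real.exp_le_exp.mpr ?_)
  rw [Finset.mul_sum]
  refine Finset.sum_le_sum fun t ht => ?_
  have h0 := (hP t (Finset.mem_range.mp ht)).1 j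
  rw [inner_shiftedComparator]
  -- With `a` the shift, the squared gap is at most `25 a^2`, so `z^2 ≤ a^2 / 100`. Then `(2 a (y -
  -- z_j) - a^2) / 50 + a^2 / 100` is exactly `1 / 25` of the gap for `a / 2`.
  have h1 : z t + z t ^ 2 ≤ 1 / 25 * ((gridPoint N j - y t) ^ 2
      - (gridPoint N j + inner ℝ g (x t).1 / 2 - y t) ^ 2) := by
    have h2 := sq_le_sq' (abs_le.mp (hfac t)).1 (abs_le.mp (hfac t)).2
    simp only [hzdef]
    rw [hgap]
    generalize inner ℝ g (x t).1 = a at *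
    have h3 := mul_le_mul_of_nonneg_left h2 (sq_nonneg a)
    nlinarith
  calc P t j * (z t + z t ^ 2) ≤ P t j * _ := mul_le_mul_of_nonneg_left h1 h0
    _ = _ := by ring

/-- For each grid point a union bound over the net costs `d log (4 T d + 1)` in the exponent; the
factor `2 R` is `50 / 25` times the pseudo regret. The grid points are coupled by the predictions,
so their moments are combined by convexity instead of independence, at scale `50 (N + 1)`. -/
theorem integral_exp_SMCal_le (hd : 1 ≤ d) (hT : 1 ≤ T) (hy : ∀ t, 0 ≤ y t ∧ y t ≤ 1)
    (hP : ∀ t < T, P t ∈ stdSimplex ℝ (Fin (N + 1))) {R : ℝ}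
    (hR : ∀ u : Fin (N + 1) → Vec d, (∀ j, ‖u j‖ ≤ 4) → ∑ j, ∑ t ∈ Finset.range T,
        P t j * ((gridPoint N j - y t) ^ 2 - (inner ℝ (u j) (x t).1 - y t) ^ 2) ≤ R) :
    ∫ p, Real.exp ((SMCal (linClass d 1) 2 x y p
        - (5 + 2 * R + 50 * (N + 1) * (d * Real.log (4 * T * d + 1)))) / (50 * (N + 1)))
          ∂(predictionLaw T P) ≤ 1 := by
  have := isProbabilityMeasure_predictionLaw hP
  obtain ⟨G, hcard, hG3, hG⟩ := exists_net hd hT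
  have hGne : G.Nonempty := by
    obtain ⟨g, hg, -⟩ := hG 0 (by simp)
    exact ⟨g, hg⟩
  set reg : Fin (N + 1) → Vec d → ℝ := fun j g => ∑ t ∈ Finset.range T, P t j *
    ((gridPoint N j - y t) ^ 2 - (inner ℝ (shiftedComparator hd j g) (x t).1 - y t) ^ 2) with hreg
  -- The worst net point at each grid point is fixed before the predictions are drawn, and the
  -- regret hypothesis is applied once, to this whole profile.
  choose b hbG hb using fun j => G.exists_max_image (reg j) hGne
  have hbR : ∑ j, reg j (b j) ≤ R :=
    hR (fun j => shiftedComparator hd j (b j)) fun j =>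
      norm_shiftedComparator_le hd j (hG3 _ (hbG j))
  set M : Fin (N + 1) → (Fin T → Fin (N + 1)) → ℝ :=
    fun j p => G.sup' hGne fun g => hitGap x y j g p with hM
  set Λ : ℝ := d * Real.log (4 * T * d + 1) with hΛ
  have hcardΛ : (G.card : ℝ) ≤ Real.exp Λ := by
    rw [hΛ, ← Real.log_pow, Real.exp_log (by positivity)]
    exact_mod_cast hcard
  have hexp : ∀ j, ∫ p, Real.exp (M j p / 50 - 1 / 25 * reg j (b j) - Λ) ∂(predictionLaw T P)
      ≤ 1 := by
    intro j
    have h1 : ∀ p, Real.exp (M j p / 50) ≤ ∑ g ∈ G, Real.exp (hitGap x y j g p / 50) := by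
      intro p
      obtain ⟨g, hg, he⟩ := G.exists_mem_eq_sup' hGne fun g => hitGap x y j g p
      simp only [hM]
      rw [he]
      exact Finset.single_le_sum (f := fun g => Real.exp (hitGap x y j g p / 50))
        (fun _ _ => (Real.exp_pos _).le) hg
    have h2 : ∫ p, Real.exp (M j p / 50) ∂(predictionLaw T P)
        ≤ Real.exp (1 / 25 * reg j (b j) + Λ) := by
      calc ∫ p, Real.exp (M j p / 50) ∂(predictionLaw T P)
          ≤ ∫ p, ∑ g ∈ G, Real.exp (hitGap x y j g p / 50) ∂(predictionLaw T P) :=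
            integral_mono Integrable.of_finite Integrable.of_finite h1
        _ = ∑ g ∈ G, ∫ p, Real.exp (hitGap x y j g p / 50) ∂(predictionLaw T P) :=
            integral_finsetSum _ fun _ _ => Integrable.of_finite
        _ ≤ ∑ _g ∈ G, Real.exp (1 / 25 * reg j (b j)) := by
            refine Finset.sum_le_sum fun g hg =>
              (integral_exp_hitGap_le hd hy hP j (hG3 g hg)).trans (Real.exp_le_exp.mpr ?_)
            exact mul_le_mul_of_nonneg_left (hb j g hg) (by norm_num)
        _ = G.card * Real.exp (1 / 25 * reg j (b j)) := by simp
        _ ≤ Real.exp Λ * Real.exp (1 / 25 * reg j (b j)) := by gcongr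
        _ = _ := by rw [← Real.exp_add, add_comm]
    have e : ∀ p, Real.exp (M j p / 50 - 1 / 25 * reg j (b j) - Λ)
        = Real.exp (M j p / 50) * Real.exp (-(1 / 25 * reg j (b j) + Λ)) := fun p => by
      rw [← Real.exp_add]; ring_nf
    simp only [e]
    rw [integral_mul_const, Real.exp_neg, mul_inv_le_iff₀ (Real.exp_pos _), one_mul]
    exact h2
  have hN : (0 : ℝ) < N + 1 := by positivity
  have hpt : ∀ p, Real.exp ((SMCal (linClass d 1) 2 x y p - (5 + 2 * R + 50 * (N + 1) * Λ))
        / (50 * (N + 1)))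
      ≤ ∑ j, (1 / (N + 1 : ℝ)) * Real.exp (M j p / 50 - 1 / 25 * reg j (b j) - Λ) := by
    intro p
    -- Jensen for the uniform average over grid points: each of the averaged exponentials has
    -- integral at most `1`.
    have hJ := convexOn_exp.map_sum_le (t := (Finset.univ : Finset (Fin (N + 1))))
      (w := fun _ => 1 / (N + 1 : ℝ)) (p := fun j => M j p / 50 - 1 / 25 * reg j (b j) - Λ)
      (fun _ _ => by positivity) (by simp; field_simp) (fun _ _ => Set.mem_univ _)
    simp only [smul_eq_mul] at hJ
    refine (Real.exp_le_exp.mpr ?_).trans hJ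
    have hS : SMCal (linClass d 1) 2 x y p ≤ ∑ j, M j p + 5 :=
      SMCal_le_sum hy hd hT p hG fun j g hg =>
        Finset.le_sup' (fun g => hitGap x y j g p) hg
    rw [← Finset.mul_sum, Finset.sum_sub_distrib, Finset.sum_sub_distrib, ← Finset.sum_div,
      ← Finset.mul_sum, div_le_iff₀ (by positivity)]
    simp only [Finset.sum_const, Finset.card_univ, Fintype.card_fin, nsmul_eq_mul]
    push_cast
    have e : 1 / (N + 1 : ℝ) * ((∑ j, M j p) / 50 - 1 / 25 * ∑ j, reg j (b j) - (N + 1) * Λ)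
        * (50 * (N + 1)) = ∑ j, M j p - 2 * ∑ j, reg j (b j) - 50 * (N + 1) * Λ := by
      field_simp
      ring
    rw [e]
    linarith
  calc _ ≤ ∫ p, ∑ j, (1 / (N + 1 : ℝ)) * Real.exp (M j p / 50 - 1 / 25 * reg j (b j) - Λ)
        ∂(predictionLaw T P) := integral_mono Integrable.of_finite Integrable.of_finite hpt
    _ = ∑ j, (1 / (N + 1 : ℝ)) * ∫ p, Real.exp (M j p / 50 - 1 / 25 * reg j (b j) - Λ)
        ∂(predictionLaw T P) := by
      rw [integral_finsetSum _ fun _ _ => Integrable.of_finite]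
      exact Finset.sum_congr rfl fun j _ => integral_const_mul _ _
    _ ≤ ∑ _j : Fin (N + 1), (1 / (N + 1 : ℝ)) * 1 := by
      gcongr with j
      exact hexp j
    _ = 1 := by
      simp
      field_simp

end moment

/-! ### The error bounds -/

open MeasureTheory

/-- The quantity `(T / (d log T))^(1/3)`. -/
def gridScale (d T : ℕ) : ℝ := ((T : ℝ) / (d * Real.log T)) ^ (1 / 3 : ℝ)

/-! ### Rates expressed through the scale `gridScale`. -/

section rates

variable {d T : ℕ}

lemma half_le_log (hT : 2 ≤ T) : (1 / 2 : ℝ) ≤ Real.log T := by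
  have h := Real.log_two_gt_d9
  have h2 : Real.log 2 ≤ Real.log T := Real.log_le_log (by norm_num) (by exact_mod_cast hT)
  linarith

lemma half_le_mul_log (hd : 1 ≤ d) (hT : 2 ≤ T) : (1 / 2 : ℝ) ≤ d * Real.log T := by
  have h := half_le_log hT
  have hd' : (1 : ℝ) ≤ d := by exact_mod_cast hd
  nlinarith

lemma gridScale_pos (hd : 1 ≤ d) (hT : 2 ≤ T) : 0 < gridScale d T := by
  have h := half_le_mul_log hd hT
  have hT' : (0 : ℝ) < T := by exact_mod_cast (by omega : 0 < T)
  have : (0 : ℝ) < d * Real.log T := by linarith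
  unfold gridScale
  positivity

lemma gridScale_pow (hd : 1 ≤ d) (hT : 2 ≤ T) :
    (T : ℝ) = gridScale d T ^ 3 * (d * Real.log T) := by
  have h := half_le_mul_log hd hT
  have h0 : (0 : ℝ) < d * Real.log T := by linarith
  have h1 : (0 : ℝ) ≤ T / (d * Real.log T) := by positivity
  rw [gridScale, ← Real.rpow_natCast, ← Real.rpow_mul h1]
  norm_num
  exact (div_mul_cancel₀ _ h0.ne').symm

lemma leadingRate_eq (hd : 1 ≤ d) (hT : 2 ≤ T) :
    leadingRate d T = gridScale d T * (d * Real.log T) := by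
  have h := half_le_mul_log hd hT
  have hl := half_le_log hT
  have h0 : (0 : ℝ) < d * Real.log T := by linarith
  have hr := gridScale_pos hd hT
  have e1 : (T : ℝ) ^ (1 / 3 : ℝ) = gridScale d T * (d * Real.log T) ^ (1 / 3 : ℝ) := by
    conv_lhs => rw [gridScale_pow hd hT]
    rw [Real.mul_rpow (by positivity) h0.le, ← Real.rpow_natCast, ← Real.rpow_mul hr.le]
    norm_num
  rw [leadingRate, e1, mul_assoc, ← Real.mul_rpow (Nat.cast_nonneg d) (by linarith), mul_assoc,
    ← Real.rpow_add h0]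
  norm_num

lemma one_le_gridSize (hd : 1 ≤ d) (hT : 2 ≤ T) : 1 ≤ gridSize d T :=
  Nat.ceil_pos.mpr (gridScale_pos hd hT)

lemma gridScale_le_gridSize : gridScale d T ≤ gridSize d T := Nat.le_ceil _

lemma gridSize_le (hd : 1 ≤ d) (hT : 2 ≤ T) : (gridSize d T : ℝ) ≤ gridScale d T + 1 :=
  (Nat.ceil_lt_add_one (gridScale_pos hd hT).le).le

lemma log_le_mul_log {n : ℕ} {a : ℝ} (ha : 0 < a) (h : a ≤ (T : ℝ) ^ n) :
    Real.log a ≤ n * Real.log T := by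
  rw [← Real.log_pow]
  exact Real.log_le_log ha h

end rates

lemma AchievesBounds.of_exp_moment {d T N : ℕ} {x : ℕ → Context d} {y : ℕ → ℝ}
    {P : ℕ → Fin (N + 1) → ℝ} {C b K : ℝ}
    (hP : ∀ t < T, P t ∈ stdSimplex ℝ (Fin (N + 1))) (hK : 0 < K)
    (h : ∫ p, Real.exp ((SMCal (linClass d 1) 2 x y p - b) / K) ∂(predictionLaw T P) ≤ 1)
    (hb : b ≤ C * leadingRate d T) (hKC : K ≤ C * gridScale d T) :
    AchievesBounds C d T x y P := by
  have := isProbabilityMeasure_predictionLaw hP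
  obtain ⟨h1, h2⟩ := tail_and_mean_of_exp_moment hK h
  refine ⟨fun δ hδ hδ1 => (h1 δ hδ).trans (measureReal_mono fun p hp => ?_), h2.trans hb⟩
  simp only [Set.mem_ofPred_eq] at hp ⊢
  have hl : 0 ≤ Real.log (1 / δ) := Real.log_nonneg (by rwa [le_div_iff₀ hδ, one_mul])
  have := mul_le_mul_of_nonneg_right hKC hl
  rw [gridScale] at this
  linarith

lemma AchievesBounds.of_le {d T N : ℕ} {x : ℕ → Context d} {y : ℕ → ℝ}
    {P : ℕ → Fin (N + 1) → ℝ} {C : ℝ} (hd : 1 ≤ d) (hT : 2 ≤ T) (hC : 0 ≤ C)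
    (hP : ∀ t < T, P t ∈ stdSimplex ℝ (Fin (N + 1)))
    (h : ∀ p : Fin T → Fin (N + 1), SMCal (linClass d 1) 2 x y p ≤ C * leadingRate d T) :
    AchievesBounds C d T x y P := by
  have := isProbabilityMeasure_predictionLaw hP
  constructor
  · intro δ hδ hδ1
    have hl : 0 ≤ Real.log (1 / δ) := Real.log_nonneg (by rwa [le_div_iff₀ hδ, one_mul])
    have huniv : {p : Fin T → Fin (N + 1) | SMCal (linClass d 1) 2 x y p ≤
        C * (leadingRate d T + ((T : ℝ) / (d * Real.log T)) ^ (1 / 3 : ℝ) * Real.log (1 / δ))}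
        = Set.univ := by
      refine Set.eq_univ_of_forall fun p => ?_
      simp only [Set.mem_ofPred_eq]
      have h1 := h p
      have h2 := mul_nonneg hC (mul_nonneg (gridScale_pos hd hT).le hl)
      rw [gridScale] at h2
      linarith
    rw [huniv, probReal_univ]
    linarith
  · refine (integral_mono Integrable.of_finite (integrable_const _) h).trans ?_
    simp

theorem IsBMRun.achievesBounds {d T : ℕ} (hd : 1 ≤ d) (hT : 2 ≤ T) {x : ℕ → Context d}
    {y : ℕ → ℝ} (hy : ∀ t, 0 ≤ y t ∧ y t ≤ 1) {ε : ℝ} (hε : ε ≤ 1 / (T : ℝ) ^ 2)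
    {P : ℕ → Fin (gridSize d T + 1) → ℝ} (h : IsBMRun ε d T x y P) :
    AchievesBounds 90000 d T x y P := by
  have hP : ∀ t < T, P t ∈ stdSimplex ℝ (Fin (gridSize d T + 1)) := by
    obtain ⟨θ, -, h2, -⟩ := h
    exact fun t ht => (h2 t ht).1
  have hT2 : (2 : ℝ) ≤ T := by exact_mod_cast hT
  have hd1 : (1 : ℝ) ≤ d := by exact_mod_cast hd
  have hlead := leadingRate_eq hd hT
  have hrT := gridScale_pow hd hT
  have hr0 := gridScale_pos hd hT
  have hD := half_le_mul_log hd hT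
  have hl := half_le_log hT
  have hrN := gridScale_le_gridSize (d := d) (T := T)
  have hNr := gridSize_le hd hT
  have hN1 := one_le_gridSize hd hT
  -- Write `r` for the scale and `D = d log T`. If `r < 1`, the trivial bound `T = r^3 D` is already
  -- below the rate `r D`.
  rcases lt_or_ge (gridScale d T) 1 with hr | hr
  · refine AchievesBounds.of_le hd hT (by norm_num) hP fun p => (SMCal_le_card hy p).trans ?_
    have h3 : gridScale d T ^ 3 ≤ gridScale d T := by
      nlinarith [mul_nonneg hr0.le hr0.le]
    have h4 := mul_le_mul_of_nonneg_right h3 (by linarith : (0 : ℝ) ≤ d * Real.log T)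
    have h5 : 0 ≤ gridScale d T * (d * Real.log T) := mul_nonneg hr0.le (by linarith)
    rw [hlead]
    linarith
  · have hreg := fun u hu => h.sum_regret_le hε hN1 hd (by omega) hy (u := u) hu
    refine AchievesBounds.of_exp_moment hP (by positivity)
      (integral_exp_SMCal_le hd (by omega) hy hP hreg) ?_ ?_
    · have hDT : d * Real.log T ≤ T := by
        calc d * Real.log T ≤ gridScale d T ^ 3 * (d * Real.log T) :=
              le_mul_of_one_le_left (by linarith) (one_le_pow₀ hr)
          _ = T := hrT.symm
      have hdT : (d : ℝ) ≤ 2 * T := by nlinarith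
      have hlog1 : Real.log (T + d) ≤ 3 * Real.log T := by
        refine log_le_mul_log (n := 3) (by linarith) ?_
        nlinarith [mul_le_mul hT2 hT2 (by norm_num) (by linarith)]
      have hlog2 : Real.log (4 * T * d + 1) ≤ 6 * Real.log T := by
        refine log_le_mul_log (n := 6) (by positivity) ?_
        have h1 : (4 : ℝ) ≤ T ^ 2 := by nlinarith
        have h2 : (16 : ℝ) ≤ T ^ 4 := by nlinarith [mul_le_mul h1 h1 (by norm_num) (by positivity)]
        have h3 : 16 * (T : ℝ) ^ 2 ≤ T ^ 6 := by
          calc 16 * (T : ℝ) ^ 2 ≤ T ^ 4 * T ^ 2 := by gcongr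
            _ = _ := by ring
        nlinarith
      set r := gridScale d T
      set D := d * Real.log T with hDdef
      set N : ℝ := (gridSize d T : ℝ) with hNdef
      have hN3 : N + 1 ≤ 3 * r := by linarith
      have hround : (T : ℝ) / (4 * N ^ 2) ≤ r * D := by
        rw [div_le_iff₀ (by positivity), hrT]
        have : r ^ 2 ≤ N ^ 2 := by gcongr
        nlinarith [mul_le_mul_of_nonneg_left this (mul_nonneg hr0.le (by linarith : 0 ≤ D)),
          mul_nonneg (mul_nonneg hr0.le (by linarith : 0 ≤ D)) (sq_nonneg N)]
      have hrD : 1 / 2 ≤ r * D := by nlinarith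
      have e1 : d * Real.log (T + d) ≤ 3 * D := by
        rw [hDdef]; nlinarith
      have e2 : d * Real.log (4 * T * d + 1) ≤ 6 * D := by
        rw [hDdef]; nlinarith
      -- Since `D ≥ 1 / 2`, the bracket is at most `13000 D + 960 D`. Twice the resulting `42000 r
      -- D` dominates the final constant `90000`.
      have e3 : (N + 1) * (6500 + 320 * (d * Real.log (T + d))) ≤ 3 * r * (14000 * D) := by
        have : 0 ≤ d * Real.log (T + d) := mul_nonneg (by linarith) (Real.log_nonneg (by linarith))
        gcongr
        linarith
      have e4 : (N + 1) * (d * Real.log (4 * T * d + 1)) ≤ 3 * r * (6 * D) := by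
        have : 0 ≤ d * Real.log (4 * T * d + 1) :=
          mul_nonneg (by linarith) (Real.log_nonneg (by
            nlinarith [mul_nonneg (by linarith : (0 : ℝ) ≤ T) (by linarith : (0 : ℝ) ≤ d)]))
        gcongr
      rw [hlead]
      linarith
    · linarith

/-! ### Programming constructs -/

/-- All variables of the expression are below `k`. -/
def NExpr.VarsBelow (k : ℕ) : NExpr → Prop
  | .const _ => True
  | .var v => v < k
  | .add a b => a.VarsBelow k ∧ b.VarsBelow k
  | .sub a b => a.VarsBelow k ∧ b.VarsBelow k
  | .mul a b => a.VarsBelow k ∧ b.VarsBelow k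

lemma NExpr.VarsBelow.eval_congr {k : ℕ} {e : NExpr} (he : e.VarsBelow k) {s s' : Memory}
    (h : ∀ v < k, s'.nat v = s.nat v) : e.eval s' = e.eval s := by
  induction e with
  | const n => rfl
  | var v => exact h v he
  | add a b iha ihb => simp only [NExpr.eval, iha he.1, ihb he.2]
  | sub a b iha ihb => simp only [NExpr.eval, iha he.1, ihb he.2]
  | mul a b iha ihb => simp only [NExpr.eval, iha he.1, ihb he.2]

/-- The absolute value of an expression. -/
def RExpr.abs (r : RExpr) : RExpr := .sqrt (.mul r r)

/-- The maximum of two expressions. -/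
def RExpr.max (q r : RExpr) : RExpr :=
  .div (.add (.add q r) (RExpr.abs (.sub q r))) (.ofNat (.const 2))

/-- The minimum of two expressions. -/
def RExpr.min (q r : RExpr) : RExpr :=
  .div (.sub (.add q r) (RExpr.abs (.sub q r))) (.ofNat (.const 2))

/-- A natural number as a real expression. -/
def RExpr.num (n : ℕ) : RExpr := .ofNat (.const n)

@[simp] lemma RExpr.eval_num (s : Memory) (n : ℕ) : (RExpr.num n).eval s = n := rfl

@[simp] lemma RExpr.eval_abs (s : Memory) (r : RExpr) : r.abs.eval s = |r.eval s| :=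
  Real.sqrt_mul_self_eq_abs _

@[simp] lemma RExpr.eval_max (s : Memory) (q r : RExpr) :
    (q.max r).eval s = Max.max (q.eval s) (r.eval s) := by
  simp only [RExpr.max, RExpr.eval, RExpr.eval_abs, NExpr.eval]
  push_cast
  rcases le_total (q.eval s) (r.eval s) with h | h
  · rw [max_eq_right h, abs_of_nonpos (by linarith)]
    ring
  · rw [max_eq_left h, abs_of_nonneg (by linarith)]
    ring

@[simp] lemma RExpr.eval_min (s : Memory) (q r : RExpr) :
    (q.min r).eval s = Min.min (q.eval s) (r.eval s) := by
  simp only [RExpr.min, RExpr.eval, RExpr.eval_abs, NExpr.eval]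
  push_cast
  rcases le_total (q.eval s) (r.eval s) with h | h
  · rw [min_eq_left h, abs_of_nonpos (by linarith)]
    ring
  · rw [min_eq_right h, abs_of_nonneg (by linarith)]
    ring

@[simp] lemma Memory.setNat_nat (s : Memory) (v n u : ℕ) :
    (s.setNat v n).nat u = if u = v then n else s.nat u := by
  simp [Memory.setNat, Function.update_apply]

@[simp] lemma Memory.setNat_real (s : Memory) (v n : ℕ) : (s.setNat v n).real = s.real := rfl

@[simp] lemma Memory.setReal_nat (s : Memory) (a k : ℕ) (r : ℝ) :
    (s.setReal a k r).nat = s.nat := rfl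

lemma Memory.setReal_real_of_ne (s : Memory) {a b : ℕ} (k : ℕ) (r : ℝ) (h : b ≠ a) :
    (s.setReal a k r).real b = s.real b := by
  simp [Memory.setReal, Function.update_of_ne h]

lemma Memory.setReal_real_same (s : Memory) (a k : ℕ) (r : ℝ) (l : ℕ) :
    (s.setReal a k r).real a l = if l = k then r else s.real a l := by
  simp [Memory.setReal, Function.update_apply]

/-- The rule for loops with an invariant. -/
lemma Cmd.exec_loop_induction {v : ℕ} {e : NExpr} {c : Cmd} {s : Memory}
    (I : ℕ → Memory → Prop) (h0 : I 0 s)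
    (hs : ∀ k < e.eval s, ∀ s', I k s' → I (k + 1) (c.exec (s'.setNat v k))) :
    I (e.eval s) ((Cmd.loop v e c).exec s) := by
  have h : ∀ k ≤ e.eval s,
      I k (Nat.rec s (fun k s' => c.exec (s'.setNat v k)) k : Memory) := by
    intro k hk
    induction k with
    | zero => exact h0
    | succ k ih => exact hs k hk _ (ih (Nat.le_of_succ_le hk))
  exact h _ le_rfl

/-- Store in entry `0` of array `20` the sum of the values of `r` for the values of variable `6`
below `e`. -/
def Cmd.accumulate (e : NExpr) (r : RExpr) : Cmd :=
  .seq (.write 20 (.const 0) (RExpr.num 0))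
    (.loop 6 e (.write 20 (.const 0) (.add (.read 20 (.const 0)) r)))

/-- For all values `i` below `e₁` of variable `4` and all values `a` below `e₂` of variable `5`,
store in entry `(b + i) e₂ + a` of array `A` the sum of the values of `r` for the values of
variable `6` below `e₃`. -/
def Cmd.assign (A : ℕ) (b e₁ e₂ e₃ : NExpr) (r : RExpr) : Cmd :=
  .loop 4 e₁ (.loop 5 e₂ (.seq (.accumulate e₃ r)
    (.write A (.add (.mul (.add b (.var 4)) e₂) (.var 5)) (.read 20 (.const 0)))))

/-- The memory `s'` agrees with `s` except for the loop variables of assignments and the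
arrays `A` and `20`. -/
structure Memory.AgreesOff (A : ℕ) (s s' : Memory) : Prop where
  nat : ∀ v, v ≠ 4 → v ≠ 5 → v ≠ 6 → s'.nat v = s.nat v
  real : ∀ b, b ≠ A → b ≠ 20 → s'.real b = s.real b

lemma Cmd.exec_accumulate {e : NExpr} {r : RExpr} {s : Memory} {n : ℕ} {F : ℕ → ℝ}
    (hn : e.eval s = n)
    (he : e.VarsBelow 4)
    (hr : ∀ τ < n, ∀ s' : Memory, (∀ v, v ≠ 6 → s'.nat v = s.nat v) →
      (∀ b, b ≠ 20 → s'.real b = s.real b) → s'.nat 6 = τ → r.eval s' = F τ) :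
    (∀ v, v ≠ 6 → ((Cmd.accumulate e r).exec s).nat v = s.nat v) ∧
    (∀ b, b ≠ 20 → ((Cmd.accumulate e r).exec s).real b = s.real b) ∧
    ((Cmd.accumulate e r).exec s).real 20 0 = ∑ τ ∈ Finset.range n, F τ := by
  set s₀ := (Cmd.write 20 (.const 0) (RExpr.num 0)).exec s with hs₀
  have hn' : e.eval s₀ = n := by
    rw [← hn]
    exact he.eval_congr fun v _ => rfl
  have key := Cmd.exec_loop_induction (v := 6) (e := e)
    (c := .write 20 (.const 0) (.add (.read 20 (.const 0)) r)) (s := s₀)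
    (I := fun k s' => (∀ v, v ≠ 6 → s'.nat v = s.nat v) ∧
      (∀ b, b ≠ 20 → s'.real b = s.real b) ∧ s'.real 20 0 = ∑ τ ∈ Finset.range k, F τ)
    ⟨fun _ _ => rfl, fun b hb => Memory.setReal_real_of_ne _ _ _ hb, by
      simp [hs₀, Cmd.exec, Memory.setReal_real_same, NExpr.eval]⟩ ?_
  · rw [hn'] at key
    exact key
  · rintro k hk s' ⟨h1, h2, h3⟩
    rw [hn'] at hk
    refine ⟨fun v hv => by simp [Cmd.exec, hv, h1 v hv], fun b hb => ?_, ?_⟩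
    · simp only [Cmd.exec]
      rw [Memory.setReal_real_of_ne _ _ _ hb, Memory.setNat_real, h2 b hb]
    · simp only [Cmd.exec, Memory.setReal_real_same, NExpr.eval, if_true, RExpr.eval,
        Memory.setNat_real, h3, Finset.sum_range_succ]
      rw [hr k hk (s'.setNat 6 k) (fun v hv => by simp [hv, h1 v hv]) h2 (by simp)]

/-- The hypothesis on `r` ranges over every memory that may occur during the loops. It leaves the
arrays `A` and `20` unconstrained, so the rule serves expressions that do not read their target. -/
lemma Cmd.exec_assign {A : ℕ} {b e₁ e₂ e₃ : NExpr} {r : RExpr} {s : Memory} (n₀ n₁ n₂ n₃ : ℕ)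
    (F : ℕ → ℕ → ℕ → ℝ) (hA : A ≠ 20)
    (hn : b.eval s = n₀ ∧ e₁.eval s = n₁ ∧ e₂.eval s = n₂ ∧ e₃.eval s = n₃)
    (he : b.VarsBelow 4 ∧ e₁.VarsBelow 4 ∧ e₂.VarsBelow 4 ∧ e₃.VarsBelow 4)
    (hr : ∀ i < n₁, ∀ a < n₂, ∀ τ < n₃, ∀ s' : Memory, s.AgreesOff A s' → s'.nat 4 = i →
      s'.nat 5 = a → s'.nat 6 = τ → r.eval s' = F i a τ) :
    s.AgreesOff A ((Cmd.assign A b e₁ e₂ e₃ r).exec s) ∧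
    (∀ i < n₁, ∀ a < n₂, ((Cmd.assign A b e₁ e₂ e₃ r).exec s).real A ((n₀ + i) * n₂ + a)
      = ∑ τ ∈ Finset.range n₃, F i a τ) ∧
    (∀ q, q < n₀ * n₂ ∨ (n₀ + n₁) * n₂ ≤ q →
      ((Cmd.assign A b e₁ e₂ e₃ r).exec s).real A q = s.real A q) := by
  obtain ⟨hn₀, hn₁, hn₂, hn₃⟩ := hn
  obtain ⟨he₀, he₁, he₂, he₃⟩ := he
  have hev : ∀ s' : Memory, s.AgreesOff A s' →
      b.eval s' = n₀ ∧ e₂.eval s' = n₂ ∧ e₃.eval s' = n₃ := by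
    intro s' h
    have h' : ∀ v < 4, s'.nat v = s.nat v := fun v hv => h.nat v (by omega) (by omega) (by omega)
    exact ⟨(he₀.eval_congr h').trans hn₀, (he₂.eval_congr h').trans hn₂,
      (he₃.eval_congr h').trans hn₃⟩
  have key := Cmd.exec_loop_induction (v := 4) (e := e₁)
    (c := .loop 5 e₂ (.seq (.accumulate e₃ r)
      (.write A (.add (.mul (.add b (.var 4)) e₂) (.var 5)) (.read 20 (.const 0))))) (s := s)
    (I := fun k s' => s.AgreesOff A s' ∧
      (∀ i < k, ∀ a < n₂, s'.real A ((n₀ + i) * n₂ + a) = ∑ τ ∈ Finset.range n₃, F i a τ) ∧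
      (∀ q, q < n₀ * n₂ ∨ (n₀ + k) * n₂ ≤ q → s'.real A q = s.real A q))
    ⟨⟨fun _ _ _ _ => rfl, fun _ _ _ => rfl⟩, fun i hi => absurd hi (Nat.not_lt_zero i),
      fun _ _ => rfl⟩ ?_
  · rw [hn₁] at key
    exact key
  rintro i hi s₁ ⟨h1, h2, h3⟩
  rw [hn₁] at hi
  have h1' : s.AgreesOff A (s₁.setNat 4 i) :=
    ⟨fun v h4 h5 h6 => by simp [h4, h1.nat v h4 h5 h6], h1.real⟩
  have key := Cmd.exec_loop_induction (v := 5) (e := e₂)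
    (c := .seq (.accumulate e₃ r)
      (.write A (.add (.mul (.add b (.var 4)) e₂) (.var 5)) (.read 20 (.const 0))))
    (s := s₁.setNat 4 i)
    (I := fun k s' => s.AgreesOff A s' ∧ s'.nat 4 = i ∧
      (∀ a < k, s'.real A ((n₀ + i) * n₂ + a) = ∑ τ ∈ Finset.range n₃, F i a τ) ∧
      (∀ q, q < (n₀ + i) * n₂ ∨ (n₀ + i) * n₂ + k ≤ q → s'.real A q = s₁.real A q))
    ⟨h1', by simp, fun a ha => absurd ha (Nat.not_lt_zero a), fun _ _ => rfl⟩ ?_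
  · rw [(hev _ h1').2.1] at key
    obtain ⟨k1, -, k3, k4⟩ := key
    have hmul : (n₀ + (i + 1)) * n₂ = (n₀ + i) * n₂ + n₂ := by ring
    refine ⟨k1, fun i' hi' a ha => ?_, fun q hq => ?_⟩
    · rcases Nat.lt_succ_iff_lt_or_eq.mp hi' with h | h
      · rw [k4 _ (Or.inl ?_), h2 i' h a ha]
        calc (n₀ + i') * n₂ + a < (n₀ + i') * n₂ + n₂ := by omega
          _ = (n₀ + i' + 1) * n₂ := by ring
          _ ≤ (n₀ + i) * n₂ := Nat.mul_le_mul_right _ (by omega)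
      · rw [h]
        exact k3 a ha
    · have hle : n₀ * n₂ ≤ (n₀ + i) * n₂ := Nat.mul_le_mul_right _ (by omega)
      rw [hmul] at hq
      rw [k4 q (by omega), h3 q (by omega)]
  rintro a ha s₂ ⟨g1, g4, g2, g3⟩
  rw [(hev _ h1').2.1] at ha
  have g1' : s.AgreesOff A (s₂.setNat 5 a) :=
    ⟨fun v h4 h5 h6 => by simp [h5, g1.nat v h4 h5 h6], g1.real⟩
  obtain ⟨f1, f2, f3⟩ := Cmd.exec_accumulate (F := F i a) (hev _ g1').2.2 he₃
    (fun τ hτ s' hv hb h6 => hr i hi a ha τ hτ s'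
      ⟨fun v h4 h5 h6 => (hv v h6).trans (g1'.nat v h4 h5 h6),
        fun b' hA' h20 => (hb b' h20).trans (g1'.real b' hA' h20)⟩
      (by rw [hv 4 (by norm_num)]; simpa using g4) (by rw [hv 5 (by norm_num)]; simp) h6)
  simp only [Cmd.exec]
  set s₃ := (Cmd.accumulate e₃ r).exec (s₂.setNat 5 a) with hs₃
  have f0 : s.AgreesOff A s₃ :=
    ⟨fun v h4 h5 h6 => (f1 v h6).trans (g1'.nat v h4 h5 h6),
      fun b' hA' h20 => (f2 b' h20).trans (g1'.real b' hA' h20)⟩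
  have f4 : s₃.nat 4 = i := by rw [f1 4 (by norm_num)]; simpa using g4
  have f5 : s₃.nat 5 = a := by rw [f1 5 (by norm_num)]; simp
  have fA : s₃.real A = s₂.real A := f2 A hA
  have hidx : (NExpr.add (.mul (.add b (.var 4)) e₂) (.var 5)).eval s₃ = (n₀ + i) * n₂ + a := by
    simp only [NExpr.eval, (hev _ f0).1, (hev _ f0).2.1, f4, f5]
  rw [hidx]
  refine ⟨⟨fun v h4 h5 h6 => f0.nat v h4 h5 h6, fun b' hA' h20 => ?_⟩, f4, ?_, ?_⟩
  · rw [Memory.setReal_real_of_ne _ _ _ hA', f0.real b' hA' h20]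
  · intro a' ha'
    rw [Memory.setReal_real_same]
    split_ifs with h
    · have : a' = a := by omega
      rw [this]
      exact f3
    · rw [fA]
      exact g2 a' (by omega)
  · intro q hq
    rw [Memory.setReal_real_same, if_neg (by omega), fA]
    exact g3 q (by omega)

/-! ### Polynomial cost -/

/-- The program leaves the variables `0, 1, 2` alone, and its loop bounds depend only on these. -/
def Cmd.Tame : Cmd → Prop
  | .skip => True
  | .setVar v _ => 3 ≤ v
  | .write _ _ _ => True
  | .seq c₁ c₂ => c₁.Tame ∧ c₂.Tame
  | .ifLe _ _ c₁ c₂ => c₁.Tame ∧ c₂.Tame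
  | .loop v e c => 3 ≤ v ∧ e.VarsBelow 3 ∧ c.Tame

lemma Cmd.Tame.nat_exec {c : Cmd} (hc : c.Tame) (s : Memory) {v : ℕ} (hv : v < 3) :
    (c.exec s).nat v = s.nat v := by
  induction c generalizing s with
  | skip => rfl
  | setVar u e =>
    have hu : 3 ≤ u := hc
    have hne : v ≠ u := by omega
    simp [Cmd.exec, hne]
  | write a e r => rfl
  | seq c₁ c₂ ih₁ ih₂ => simp only [Cmd.exec, ih₂ hc.2, ih₁ hc.1]
  | ifLe q r c₁ c₂ ih₁ ih₂ =>
    simp only [Cmd.exec]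
    split_ifs
    · exact ih₁ hc.1 s
    · exact ih₂ hc.2 s
  | loop u e c ih =>
    refine Cmd.exec_loop_induction (I := fun _ s' => s'.nat v = s.nat v) rfl fun k _ s' h => ?_
    have hu : 3 ≤ u := hc.1
    have hne : v ≠ u := by omega
    rw [ih hc.2.2]
    simp [hne, h]

lemma add_le_mul_pow_of_le {a b m n k l B : ℕ} (hB : 1 ≤ B) (hm : m ≤ a * B ^ k)
    (hn : n ≤ b * B ^ l) : m + n ≤ (a + b) * B ^ (k + l) := by
  have h1 : B ^ k ≤ B ^ (k + l) := Nat.pow_le_pow_right hB (by omega)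
  have h2 : B ^ l ≤ B ^ (k + l) := Nat.pow_le_pow_right hB (by omega)
  calc m + n ≤ a * B ^ (k + l) + b * B ^ (k + l) :=
        add_le_add (hm.trans (Nat.mul_le_mul_left _ h1)) (hn.trans (Nat.mul_le_mul_left _ h2))
    _ = _ := by ring

lemma NExpr.VarsBelow.exists_eval_le {e : NExpr} (he : e.VarsBelow 3) :
    ∃ a k : ℕ, ∀ (s : Memory) (B : ℕ), 1 ≤ B → (∀ v < 3, s.nat v ≤ B) → e.eval s ≤ a * B ^ k := by
  induction e with
  | const n => exact ⟨n, 0, fun s B _ _ => by simp [NExpr.eval]⟩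
  | var v => exact ⟨1, 1, fun s B _ h => by simpa [NExpr.eval] using h v he⟩
  | add p q ihp ihq =>
    obtain ⟨a, k, h1⟩ := ihp he.1
    obtain ⟨b, l, h2⟩ := ihq he.2
    exact ⟨a + b, k + l, fun s B hB h => add_le_mul_pow_of_le hB (h1 s B hB h) (h2 s B hB h)⟩
  | sub p q ihp ihq =>
    obtain ⟨a, k, h1⟩ := ihp he.1
    exact ⟨a, k, fun s B hB h => (Nat.sub_le _ _).trans (h1 s B hB h)⟩
  | mul p q ihp ihq =>
    obtain ⟨a, k, h1⟩ := ihp he.1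
    obtain ⟨b, l, h2⟩ := ihq he.2
    refine ⟨a * b, k + l, fun s B hB h => ?_⟩
    calc p.eval s * q.eval s ≤ (a * B ^ k) * (b * B ^ l) :=
          Nat.mul_le_mul (h1 s B hB h) (h2 s B hB h)
      _ = _ := by ring

/-- A tame program never alters the variables `0, 1, 2`, so each loop bound has the same value at
every execution and is polynomial in `B`. Nested loops multiply such polynomials. -/
lemma Cmd.Tame.exists_cost_le {c : Cmd} (hc : c.Tame) :
    ∃ a k : ℕ, ∀ (s : Memory) (B : ℕ), 1 ≤ B → (∀ v < 3, s.nat v ≤ B) → c.cost s ≤ a * B ^ k := by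
  induction c with
  | skip => exact ⟨1, 0, fun s B _ _ => by simp [Cmd.cost]⟩
  | setVar u e => exact ⟨e.cost + 1, 0, fun s B _ _ => by simp [Cmd.cost]⟩
  | write a e r => exact ⟨e.cost + r.cost + 1, 0, fun s B _ _ => by simp [Cmd.cost]⟩
  | seq c₁ c₂ ih₁ ih₂ =>
    obtain ⟨a, k, h1⟩ := ih₁ hc.1
    obtain ⟨b, l, h2⟩ := ih₂ hc.2
    exact ⟨a + b, k + l, fun s B hB h => add_le_mul_pow_of_le hB (h1 s B hB h)
      (h2 _ B hB fun v hv => by rw [hc.1.nat_exec s hv]; exact h v hv)⟩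
  | ifLe q r c₁ c₂ ih₁ ih₂ =>
    obtain ⟨a, k, h1⟩ := ih₁ hc.1
    obtain ⟨b, l, h2⟩ := ih₂ hc.2
    refine ⟨(q.cost + r.cost + 1) + (a + b), 0 + (k + l), fun s B hB h => ?_⟩
    refine add_le_mul_pow_of_le hB (by simp) ?_
    have := add_le_mul_pow_of_le hB (h1 s B hB h) (h2 s B hB h)
    split_ifs <;> omega
  | loop u e c ih =>
    obtain ⟨a, k, h1⟩ := ih hc.2.2
    obtain ⟨b, l, h2⟩ := hc.2.1.exists_eval_le
    refine ⟨(e.cost + 1) + b * (1 + a), 0 + (l + (0 + k)), fun s B hB h => ?_⟩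
    refine add_le_mul_pow_of_le hB (by simp) ?_
    have hu : 3 ≤ u := hc.1
    have hinv : ∀ i v, v < 3 →
        (Nat.rec s (fun i s' => c.exec (s'.setNat u i)) i : Memory).nat v = s.nat v := by
      intro i v hv
      induction i with
      | zero => rfl
      | succ i ihi =>
        refine (hc.2.2.nat_exec _ hv).trans ?_
        have hne : v ≠ u := by omega
        rw [Memory.setNat_nat, if_neg hne]
        exact ihi
    calc _ ≤ ∑ _i ∈ Finset.range (e.eval s), (1 + a) * B ^ (0 + k) := by
          refine Finset.sum_le_sum fun i _ => add_le_mul_pow_of_le hB (by simp)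
            (h1 _ B hB fun v hv => ?_)
          have hne : v ≠ u := by omega
          rw [Memory.setNat_nat, if_neg hne, hinv i v hv]
          exact h v hv
      _ = e.eval s * ((1 + a) * B ^ (0 + k)) := by simp
      _ ≤ (b * B ^ l) * ((1 + a) * B ^ (0 + k)) := Nat.mul_le_mul_right _ (h2 s B hB h)
      _ = _ := by ring

/-! ### The program -/

/-- Position `i * e + a` for loop variables. -/
def NExpr.pos (i : ℕ) (e : NExpr) (a : ℕ) : NExpr := .add (.mul (.var i) e) (.var a)

/-- The number of grid points. -/
def NExpr.size : NExpr := .add (.var 1) (.const 1)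

/-- The number of power iterations. -/
def NExpr.powerRounds : NExpr := .mul (.const 2) (.mul (.var 2) (.var 2))

/-- The number of gradient steps of one projection. -/
def NExpr.gradRounds : NExpr := .mul (.const 10) (.mul (.var 2) (.add (.var 2) (.const 1)))

/-- The weight `max (0, 1 - |N clip (w) - a|)` of the rounding of entry `6` of array `6` to the
grid point with index `5`. -/
def RExpr.roundWeight : RExpr :=
  RExpr.max (.num 0) (.sub (.num 1) (RExpr.abs (.sub
    (.mul (.ofNat (.var 1)) (RExpr.max (.num 0) (RExpr.min (.read 6 (.var 6)) (.num 1))))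
    (.ofNat (.var 5)))))

/-- One power iteration: array `9` holds the current distribution, array `2` the average. -/
def powerStep : Cmd :=
  .seq (.assign 8 (.const 0) (.const 1) .size (.const 1)
    (.add (.read 2 (.var 5)) (.div (.read 9 (.var 5)) (.ofNat .powerRounds))))
  (.seq (.assign 10 (.const 0) (.const 1) .size .size
    (.mul .roundWeight (.read 9 (.var 6))))
  (.seq (.assign 9 (.const 0) (.const 1) .size (.const 1) (.read 10 (.var 5)))
    (.assign 2 (.const 0) (.const 1) .size (.const 1) (.read 8 (.var 5)))))

/-- The prediction: the values of the learners (array `6`) are computed from the iterates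
(array `3`), and the rounding matrix is iterated, starting from the uniform distribution. -/
def predictCmd : Cmd :=
  .seq (.assign 6 (.const 0) (.const 1) .size (.var 0)
    (.mul (.read 3 (.pos 5 (.var 0) 6)) (.read 0 (.var 6))))
  (.seq (.assign 9 (.const 0) (.const 1) .size (.const 1) (.div (.num 1) (.ofNat .size)))
  (.seq (.assign 2 (.const 0) (.const 1) .size (.const 1) (.num 0))
    (.loop 7 .powerRounds powerStep)))

/-- One step of projected gradient descent for all learners: array `11` holds the points. -/
def gradStep : Cmd :=
  .seq (.assign 12 (.const 0) .size (.var 2) (.var 0)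
    (.mul (.read 4 (.pos 5 (.var 0) 6))
      (.sub (.read 11 (.pos 4 (.var 0) 6)) (.read 3 (.pos 4 (.var 0) 6)))))
  (.seq (.assign 13 (.const 0) .size (.var 0) (.var 2)
    (.mul (.mul (.mul (.read 5 (.pos 6 .size 4)) (.read 5 (.pos 6 .size 4)))
      (.read 12 (.pos 4 (.var 2) 6))) (.read 4 (.pos 6 (.var 0) 5))))
  (.seq (.assign 14 (.const 0) .size (.var 0) (.const 1)
    (.sub (.read 11 (.pos 4 (.var 0) 5))
      (.div (.add (.add (.read 13 (.pos 4 (.var 0) 5))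
          (.mul (.num 102400) (.sub (.read 11 (.pos 4 (.var 0) 5)) (.read 3 (.pos 4 (.var 0) 5)))))
        (.mul (.num 640) (.mul (.read 5 (.pos 3 .size 4)) (.read 4 (.pos 3 (.var 0) 5)))))
        (.ofNat (.add (.mul (.const 100) (.var 2)) (.const 102400))))))
  (.seq (.assign 15 (.const 0) (.const 1) .size (.var 0)
    (.mul (.read 14 (.pos 5 (.var 0) 6)) (.read 14 (.pos 5 (.var 0) 6))))
    (.assign 11 (.const 0) .size (.var 0) (.const 1)
      (.mul (.div (.num 4) (RExpr.max (.num 4) (.sqrt (.read 15 (.var 4)))))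
        (.read 14 (.pos 4 (.var 0) 5)))))))

/-- The update: the gradient coefficients (array `5`) and the context (array `4`) are recorded, and
the new iterates are computed by projected gradient descent. -/
def updateCmd : Cmd :=
  .seq (.assign 5 (.var 3) (.const 1) .size (.const 1)
    (.mul (.mul (.num 2) (.read 2 (.var 5))) (.sub (.read 6 (.var 5)) (.read 1 (.const 0)))))
  (.seq (.assign 4 (.var 3) (.const 1) (.var 0) (.const 1) (.read 0 (.var 5)))
  (.seq (.assign 11 (.const 0) .size (.var 0) (.const 1) (.read 3 (.pos 4 (.var 0) 5)))
  (.seq (.loop 7 .gradRounds gradStep)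
  (.seq (.assign 3 (.const 0) .size (.var 0) (.const 1) (.read 11 (.pos 4 (.var 0) 5)))
    (.setVar 3 (.add (.var 3) (.const 1)))))))

/-- The forecasting program. -/
def forecaster : OnlineProgram where
  init := .skip
  predict := predictCmd
  update := updateCmd

lemma tame_predictCmd : predictCmd.Tame := by
  simp [predictCmd, powerStep, Cmd.Tame, Cmd.assign, Cmd.accumulate, NExpr.VarsBelow, NExpr.size,
    NExpr.powerRounds]

lemma tame_updateCmd : updateCmd.Tame := by
  simp [updateCmd, gradStep, Cmd.Tame, Cmd.assign, Cmd.accumulate, NExpr.VarsBelow, NExpr.size,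
    NExpr.gradRounds]

/-- The hat function form of randomized rounding. -/
def hatWeight (N : ℕ) (w : ℝ) (j : ℕ) : ℝ := max 0 (1 - |N * clip w - j|)

/-- The distributions of the power iteration for the learner values `v`. -/
def powerIter (N : ℕ) (v : ℕ → ℝ) : ℕ → ℕ → ℝ
  | 0, _ => 1 / ((N : ℝ) + 1)
  | k + 1, j => ∑ i ∈ Finset.range (N + 1), hatWeight N (v i) j * powerIter N v k i

lemma Memory.AgreesOff.eval_pos {A : ℕ} {s s' : Memory} {i a : ℕ} {e : NExpr} {n k l : ℕ}
    (h : s.AgreesOff A s') (he : e.VarsBelow 4) (hn : e.eval s = n) (hi : s'.nat i = k)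
    (ha : s'.nat a = l) : (NExpr.pos i e a).eval s' = k * n + l := by
  simp only [NExpr.pos, NExpr.eval, hi, ha]
  rw [he.eval_congr fun v hv => h.nat v (by omega) (by omega) (by omega), hn]

/-- The memory after an assignment of a single row. -/
lemma Cmd.exec_assign_row {A : ℕ} {e₂ e₃ : NExpr} {r : RExpr} {s : Memory} (n₂ n₃ : ℕ)
    (F : ℕ → ℕ → ℝ) (hA : A ≠ 20)
    (hn : e₂.eval s = n₂ ∧ e₃.eval s = n₃) (he : e₂.VarsBelow 4 ∧ e₃.VarsBelow 4)
    (hr : ∀ a < n₂, ∀ τ < n₃, ∀ s' : Memory, s.AgreesOff A s' →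
      s'.nat 5 = a → s'.nat 6 = τ → r.eval s' = F a τ) :
    s.AgreesOff A ((Cmd.assign A (.const 0) (.const 1) e₂ e₃ r).exec s) ∧
    (∀ a < n₂, ((Cmd.assign A (.const 0) (.const 1) e₂ e₃ r).exec s).real A a
      = ∑ τ ∈ Finset.range n₃, F a τ) := by
  obtain ⟨h1, h2, -⟩ := Cmd.exec_assign (A := A) (b := .const 0) (e₁ := .const 1) (e₂ := e₂)
    (e₃ := e₃) (r := r) (s := s) 0 1 n₂ n₃ (fun _ => F) hA ⟨rfl, rfl, hn⟩
    ⟨trivial, trivial, he⟩ fun i _ a ha τ hτ s' hs _ h5 h6 => hr a ha τ hτ s' hs h5 h6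
  exact ⟨h1, fun a ha => by simpa using h2 0 one_pos a ha⟩

lemma eval_roundWeight {s : Memory} {N i j : ℕ} (hN : s.nat 1 = N) (hi : s.nat 6 = i)
    (hj : s.nat 5 = j) : RExpr.roundWeight.eval s = hatWeight N (s.real 6 i) j := by
  simp [RExpr.roundWeight, RExpr.eval, NExpr.eval, hN, hi, hj, hatWeight, clip]

/-- New values pass through the arrays `8` and `10`, so that no assignment reads its own target. The
current distribution enters the average before it is multiplied, so the average starts with the
initial iterate. -/
lemma exec_powerStep {s : Memory} {N T : ℕ} (h1 : s.nat 1 = N) (h2 : s.nat 2 = T) :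
    (∀ v < 4, (powerStep.exec s).nat v = s.nat v) ∧
    (∀ b, b ≠ 2 → b ≠ 8 → b ≠ 9 → b ≠ 10 → b ≠ 20 → (powerStep.exec s).real b = s.real b) ∧
    (∀ a < N + 1, (powerStep.exec s).real 2 a
      = s.real 2 a + s.real 9 a / ((2 * (T * T) : ℕ) : ℝ)) ∧
    (∀ a < N + 1, (powerStep.exec s).real 9 a
      = ∑ i ∈ Finset.range (N + 1), hatWeight N (s.real 6 i) a * s.real 9 i) := by
  have hsize : NExpr.size.VarsBelow 4 := by simp [NExpr.size, NExpr.VarsBelow]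
  have hesize : ∀ s' : Memory, s'.nat 1 = N → NExpr.size.eval s' = N + 1 := fun s' h => by
    simp [NExpr.size, NExpr.eval, h]
  obtain ⟨a1, b1⟩ := Cmd.exec_assign_row (A := 8) (e₂ := .size) (e₃ := .const 1) (s := s)
    (r := .add (.read 2 (.var 5)) (.div (.read 9 (.var 5)) (.ofNat .powerRounds))) (N + 1) 1
    (fun a _ => s.real 2 a + s.real 9 a / ((2 * (T * T) : ℕ) : ℝ)) (by norm_num)
    ⟨hesize s h1, rfl⟩ ⟨hsize, trivial⟩ (fun a _ τ _ s' hs h5 h6 => by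
      simp [RExpr.eval, NExpr.eval, NExpr.powerRounds, hs.nat, hs.real, h5, h2])
  obtain ⟨s₁, hs₁⟩ : ∃ s', s' = (Cmd.assign 8 (.const 0) (.const 1) .size (.const 1)
    (.add (.read 2 (.var 5)) (.div (.read 9 (.var 5)) (.ofNat .powerRounds)))).exec s := ⟨_, rfl⟩
  rw [← hs₁] at a1 b1
  obtain ⟨a2, b2⟩ := Cmd.exec_assign_row (A := 10) (e₂ := .size) (e₃ := .size) (s := s₁)
    (r := .mul .roundWeight (.read 9 (.var 6))) (N + 1) (N + 1)
    (fun a i => hatWeight N (s.real 6 i) a * s.real 9 i) (by norm_num)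
    ⟨hesize s₁ (by simp [a1.nat, h1]), hesize s₁ (by simp [a1.nat, h1])⟩ ⟨hsize, hsize⟩
    (fun a _ τ _ s' hs h5 h6 => by
      simp only [RExpr.eval, NExpr.eval, h6]
      rw [eval_roundWeight (N := N) (by simp [hs.nat, a1.nat, h1]) h6 h5]
      simp [hs.real, a1.real])
  obtain ⟨s₂, hs₂⟩ : ∃ s', s' = (Cmd.assign 10 (.const 0) (.const 1) .size .size
    (.mul .roundWeight (.read 9 (.var 6)))).exec s₁ := ⟨_, rfl⟩
  rw [← hs₂] at a2 b2
  obtain ⟨a3, b3⟩ := Cmd.exec_assign_row (A := 9) (e₂ := .size) (e₃ := .const 1) (s := s₂)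
    (r := .read 10 (.var 5)) (N + 1) 1 (fun a _ => s₂.real 10 a) (by norm_num)
    ⟨hesize s₂ (by simp [a2.nat, a1.nat, h1]), rfl⟩ ⟨hsize, trivial⟩
    (fun a _ τ _ s' hs h5 h6 => by simp [RExpr.eval, NExpr.eval, hs.real, h5])
  obtain ⟨s₃, hs₃⟩ : ∃ s', s' = (Cmd.assign 9 (.const 0) (.const 1) .size (.const 1)
    (.read 10 (.var 5))).exec s₂ := ⟨_, rfl⟩
  rw [← hs₃] at a3 b3
  obtain ⟨a4, b4⟩ := Cmd.exec_assign_row (A := 2) (e₂ := .size) (e₃ := .const 1) (s := s₃)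
    (r := .read 8 (.var 5)) (N + 1) 1 (fun a _ => s₃.real 8 a) (by norm_num)
    ⟨hesize s₃ (by simp [a3.nat, a2.nat, a1.nat, h1]), rfl⟩ ⟨hsize, trivial⟩
    (fun a _ τ _ s' hs h5 h6 => by simp [RExpr.eval, NExpr.eval, hs.real, h5])
  have e : powerStep.exec s = (Cmd.assign 2 (.const 0) (.const 1) .size (.const 1)
      (.read 8 (.var 5))).exec s₃ := by
    rw [hs₃, hs₂, hs₁]; rfl
  rw [← e] at a4 b4
  refine ⟨fun v hv => ?_, fun b hb2 hb8 hb9 hb10 hb20 => ?_, fun a ha => ?_, fun a ha => ?_⟩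
  · rw [a4.nat v (by omega) (by omega) (by omega), a3.nat v (by omega) (by omega) (by omega),
      a2.nat v (by omega) (by omega) (by omega), a1.nat v (by omega) (by omega) (by omega)]
  · rw [a4.real b hb2 hb20, a3.real b hb9 hb20, a2.real b hb10 hb20, a1.real b hb8 hb20]
  · rw [b4 a ha]
    simp [a3.real, a2.real, b1 a ha]
  · rw [a4.real 9 (by norm_num) (by norm_num), b3 a ha]
    simp [b2 a ha]

lemma exec_predictCmd {s : Memory} {d N T : ℕ} (h0 : s.nat 0 = d) (h1 : s.nat 1 = N)
    (h2 : s.nat 2 = T) :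
    (∀ v < 4, (predictCmd.exec s).nat v = s.nat v) ∧
    (∀ b, b ≠ 2 → b ≠ 6 → b ≠ 8 → b ≠ 9 → b ≠ 10 → b ≠ 20 →
      (predictCmd.exec s).real b = s.real b) ∧
    (∀ i < N + 1, (predictCmd.exec s).real 6 i
      = ∑ k ∈ Finset.range d, s.real 3 (i * d + k) * s.real 0 k) ∧
    (∀ j < N + 1, (predictCmd.exec s).real 2 j
      = ∑ k ∈ Finset.range (2 * (T * T)),
        powerIter N ((predictCmd.exec s).real 6) k j / ((2 * (T * T) : ℕ) : ℝ)) := by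
  have hsize : NExpr.size.VarsBelow 4 := by simp [NExpr.size, NExpr.VarsBelow]
  have hesize : ∀ s' : Memory, s'.nat 1 = N → NExpr.size.eval s' = N + 1 := fun s' h => by
    simp [NExpr.size, NExpr.eval, h]
  have hvar : ∀ v < 4, (NExpr.var v).VarsBelow 4 := fun v hv => hv
  obtain ⟨a1, b1⟩ := Cmd.exec_assign_row (A := 6) (e₂ := .size) (e₃ := .var 0) (s := s)
    (r := .mul (.read 3 (.pos 5 (.var 0) 6)) (.read 0 (.var 6))) (N + 1) d
    (fun i k => s.real 3 (i * d + k) * s.real 0 k) (by norm_num)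
    ⟨hesize s h1, h0⟩ ⟨hsize, hvar 0 (by norm_num)⟩ (fun a _ τ _ s' hs h5 h6 => by
      simp only [RExpr.eval, hs.eval_pos (hvar 0 (by norm_num)) h0 h5 h6]
      simp [NExpr.eval, hs.real, h6])
  obtain ⟨s₁, hs₁⟩ : ∃ s', s' = (Cmd.assign 6 (.const 0) (.const 1) .size (.var 0)
    (.mul (.read 3 (.pos 5 (.var 0) 6)) (.read 0 (.var 6)))).exec s := ⟨_, rfl⟩
  rw [← hs₁] at a1 b1
  obtain ⟨a2, b2⟩ := Cmd.exec_assign_row (A := 9) (e₂ := .size) (e₃ := .const 1) (s := s₁)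
    (r := .div (.num 1) (.ofNat .size)) (N + 1) 1
    (fun _ _ => 1 / ((N : ℝ) + 1)) (by norm_num)
    ⟨hesize s₁ (by simp [a1.nat, h1]), rfl⟩ ⟨hsize, trivial⟩
    (fun a _ τ _ s' hs h5 h6 => by
      simp only [RExpr.eval, RExpr.eval_num]
      rw [hesize s' (by simp [hs.nat, a1.nat, h1])]
      push_cast
      rfl)
  obtain ⟨s₂, hs₂⟩ : ∃ s', s' = (Cmd.assign 9 (.const 0) (.const 1) .size (.const 1)
    (.div (.num 1) (.ofNat .size))).exec s₁ := ⟨_, rfl⟩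
  rw [← hs₂] at a2 b2
  obtain ⟨a3, b3⟩ := Cmd.exec_assign_row (A := 2) (e₂ := .size) (e₃ := .const 1) (s := s₂)
    (r := .num 0) (N + 1) 1 (fun _ _ => 0) (by norm_num)
    ⟨hesize s₂ (by simp [a2.nat, a1.nat, h1]), rfl⟩ ⟨hsize, trivial⟩
    (fun a _ τ _ s' hs h5 h6 => by simp)
  obtain ⟨s₃, hs₃⟩ : ∃ s', s' = (Cmd.assign 2 (.const 0) (.const 1) .size (.const 1)
    (.num 0)).exec s₂ := ⟨_, rfl⟩
  rw [← hs₃] at a3 b3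
  have hM : NExpr.powerRounds.eval s₃ = 2 * (T * T) := by
    simp [NExpr.powerRounds, NExpr.eval, a3.nat, a2.nat, a1.nat, h2]
  have key := Cmd.exec_loop_induction (v := 7) (e := .powerRounds) (c := powerStep) (s := s₃)
    (I := fun k s' => (∀ v < 4, s'.nat v = s.nat v) ∧
      (∀ b, b ≠ 2 → b ≠ 6 → b ≠ 8 → b ≠ 9 → b ≠ 10 → b ≠ 20 → s'.real b = s.real b) ∧
      s'.real 6 = s₁.real 6 ∧
      (∀ a < N + 1, s'.real 9 a = powerIter N (s₁.real 6) k a) ∧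
      (∀ a < N + 1, s'.real 2 a = ∑ l ∈ Finset.range k,
        powerIter N (s₁.real 6) l a / ((2 * (T * T) : ℕ) : ℝ)))
    ⟨fun v hv => by
      rw [a3.nat v (by omega) (by omega) (by omega), a2.nat v (by omega) (by omega) (by omega),
        a1.nat v (by omega) (by omega) (by omega)],
      fun b hb2 hb6 hb8 hb9 hb10 hb20 => by
        rw [a3.real b hb2 hb20, a2.real b hb9 hb20, a1.real b hb6 hb20],
      by simp [a3.real, a2.real],
      fun a ha => by rw [a3.real 9 (by norm_num) (by norm_num), b2 a ha]; simp [powerIter],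
      fun a ha => by rw [b3 a ha]; simp⟩ ?_
  · rw [hM] at key
    have e : predictCmd.exec s = (Cmd.loop 7 .powerRounds powerStep).exec s₃ := by
      rw [hs₃, hs₂, hs₁]; rfl
    rw [← e] at key
    obtain ⟨k1, k2, k3, k4, k5⟩ := key
    exact ⟨k1, k2, fun i hi => by rw [k3]; exact b1 i hi, fun j hj => by rw [k3]; exact k5 j hj⟩
  · rintro k - s' ⟨k1, k2, k3, k4, k5⟩
    obtain ⟨p1, p2, p3, p4⟩ := exec_powerStep (s := s'.setNat 7 k) (N := N) (T := T)
      (by simp [k1, h1]) (by simp [k1, h2])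
    refine ⟨fun v hv => ?_, fun b hb2 hb6 hb8 hb9 hb10 hb20 => ?_, ?_, fun a ha => ?_,
      fun a ha => ?_⟩
    · rw [p1 v hv, Memory.setNat_nat, if_neg (by omega), k1 v hv]
    · rw [p2 b hb2 hb8 hb9 hb10 hb20]
      exact k2 b hb2 hb6 hb8 hb9 hb10 hb20
    · rw [p2 6 (by norm_num) (by norm_num) (by norm_num) (by norm_num) (by norm_num)]
      exact k3
    · rw [p4 a ha, powerIter]
      refine Finset.sum_congr rfl fun i hi => ?_
      rw [Memory.setNat_real, k3, k4 i (Finset.mem_range.mp hi)]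
    · rw [p3 a ha, Memory.setNat_real, k4 a ha, k5 a ha, Finset.sum_range_succ]

/-! ### Projected gradient descent -/

/-- The Euclidean projection to the ball of radius `4`. -/
def ballProj {d : ℕ} (z : Vec d) : Vec d := (4 / max 4 ‖z‖) • z

lemma norm_ballProj_le {d : ℕ} (z : Vec d) : ‖ballProj z‖ ≤ 4 := by
  have hm : (0 : ℝ) < max 4 ‖z‖ := lt_max_of_lt_left (by norm_num)
  rw [ballProj, norm_smul, Real.norm_of_nonneg (by positivity), div_mul_eq_mul_div, div_le_iff₀ hm]
  exact mul_le_mul_of_nonneg_left (le_max_right _ _) (by norm_num)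

lemma inner_sub_ballProj_nonpos {d : ℕ} (z : Vec d) {w : Vec d} (hw : ‖w‖ ≤ 4) :
    inner ℝ (z - ballProj z) (w - ballProj z) ≤ 0 := by
  rcases le_total ‖z‖ 4 with h | h
  · have : ballProj z = z := by simp [ballProj, max_eq_left h]
    rw [this, sub_self, inner_zero_left]
  · have hz : 0 < ‖z‖ := by linarith
    set c : ℝ := 4 / ‖z‖ with hc
    have hc1 : c ≤ 1 := by rw [hc, div_le_one hz]; exact h
    have hcz : c * ‖z‖ = 4 := by rw [hc]; field_simp
    have hc0 : 0 ≤ c := by positivity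
    have e : ballProj z = c • z := by rw [ballProj, max_eq_right h]
    have e1 : z - c • z = (1 - c) • z := by rw [sub_smul, one_smul]
    rw [e, e1, real_inner_smul_left, inner_sub_right, real_inner_smul_right,
      real_inner_self_eq_norm_sq]
    refine mul_nonpos_of_nonneg_of_nonpos (by linarith) ?_
    have h1 : inner ℝ z w ≤ ‖z‖ * 4 :=
      (real_inner_le_norm _ _).trans (mul_le_mul_of_nonneg_left hw hz.le)
    nlinarith

/-- The matrix `onsMatrix g t` as an operator. -/
def newtonOp {d : ℕ} (g : ℕ → Vec d) (t : ℕ) (w : Vec d) : Vec d :=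
  ∑ τ ∈ Finset.range (t + 1), inner ℝ (g τ) w • g τ + (102400 : ℝ) • w

lemma inner_newtonOp {d : ℕ} (g : ℕ → Vec d) (t : ℕ) (v w : Vec d) :
    inner ℝ (newtonOp g t v) w = newtonForm g t v w := by
  simp only [newtonOp, newtonForm, inner_add_left, sum_inner, real_inner_smul_left]

/-- One step of projected gradient descent for the Newton projection. -/
def descentStep {d : ℕ} (g : ℕ → Vec d) (t : ℕ) (L : ℝ) (θ u : Vec d) : Vec d :=
  ballProj (u - (1 / L) • (newtonOp g t (u - θ) + (640 : ℝ) • g t))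

/-- Adding the variational inequalities of the Euclidean projection and of the Newton projection `p`
gives, with `e = u - p`, `‖u' - p‖^2 ≤ ⟪e - A e / L, u' - p⟫`, hence `‖u' - p‖ ≤ ‖e - A e / L‖`. The
gradient `A (u - θ) + 640 g` involves no inverse of `A`. -/
lemma norm_descentStep_sub_sq_le {d : ℕ} {g : ℕ → Vec d} {t : ℕ} {L : ℝ} (hL : 0 < L)
    (hgL : ∀ w, newtonForm g t w w ≤ L * ‖w‖ ^ 2) {θ p : Vec d}
    (hp : IsProjBall (onsMatrix g t) (newtonStep (onsMatrix g t) θ (g t)) p) (u : Vec d) :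
    ‖descentStep g t L θ u - p‖ ^ 2 ≤ (1 - 102400 / L) * ‖u - p‖ ^ 2 := by
  set z := u - (1 / L) • (newtonOp g t (u - θ) + (640 : ℝ) • g t) with hz
  set u' := descentStep g t L θ u with hu'
  have h1 : inner ℝ (z - u') (p - u') ≤ 0 := inner_sub_ballProj_nonpos z hp.1
  have h2 := hp.newtonForm_nonpos (norm_ballProj_le z)
  change newtonForm g t (_ - p) (u' - p) ≤ 0 at h2
  obtain ⟨e, he⟩ : ∃ e, e = u - p := ⟨_, rfl⟩
  obtain ⟨a, ha⟩ : ∃ a, a = newtonOp g t e := ⟨_, rfl⟩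
  rw [← he]
  have haw : ∀ w, inner ℝ a w = newtonForm g t e w := fun w => ha ▸ inner_newtonOp g t e w
  have h3 : inner ℝ (z - p) (u' - p) + (1 / L) * newtonForm g t
      (newtonStep (onsMatrix g t) θ (g t) - p) (u' - p)
      = inner ℝ (e - (1 / L) • a) (u' - p) + 2 * (1 / L) * newtonForm g t
      (newtonStep (onsMatrix g t) θ (g t) - p) (u' - p) := by
    have h5 : ∀ w, inner ℝ (g t) w = newtonForm g t (newtonDir g t (g t)) w := fun w => by
      rw [newtonForm_comm, newtonForm_newtonDir, real_inner_comm]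
    have e1 : z - p = e - (1 / L) • (newtonOp g t (u - θ) + (640 : ℝ) • g t) := by
      rw [hz, he]; abel
    rw [e1, inner_sub_left, inner_sub_left, real_inner_smul_left, real_inner_smul_left a,
      inner_add_left, real_inner_smul_left, inner_newtonOp, h5, haw, newtonStep_onsMatrix,
      newtonForm_sub_left, newtonForm_sub_left, newtonForm_sub_left, newtonForm_smul_left, he,
      newtonForm_sub_left]
    ring
  have h4 : ‖u' - p‖ ^ 2 ≤ inner ℝ (e - (1 / L) • a) (u' - p) := by
    have e1 : z - u' = (z - p) - (u' - p) := by abel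
    have e2 : p - u' = -(u' - p) := by abel
    rw [e1, e2, inner_neg_right, inner_sub_left, real_inner_self_eq_norm_sq] at h1
    have : (1 / L) * newtonForm g t (newtonStep (onsMatrix g t) θ (g t) - p) (u' - p) ≤ 0 :=
      mul_nonpos_of_nonneg_of_nonpos (by positivity) h2
    linarith
  have h5 : ‖u' - p‖ ^ 2 ≤ ‖e - (1 / L) • a‖ ^ 2 := by
    have h6 := h4.trans (real_inner_le_norm _ _)
    by_contra hc
    push Not at hc
    have h7 := lt_of_pow_lt_pow_left₀ 2 (norm_nonneg _) hc
    nlinarith [norm_nonneg (e - (1 / L) • a)]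
  refine h5.trans ?_
  have h6 : ‖e - (1 / L) • a‖ ^ 2
      = ‖e‖ ^ 2 - 2 * (1 / L) * newtonForm g t e e + (1 / L) ^ 2 * ‖a‖ ^ 2 := by
    rw [norm_sub_sq_real, real_inner_smul_right, real_inner_comm, haw, norm_smul,
      Real.norm_of_nonneg (by positivity)]
    ring
  -- The bound `‖A e‖^2 ≤ L ⟪e, A e⟫` comes from nonnegativity of the form at `e - A e / L`, without
  -- eigenvalues.
  have h7 : (1 / L) * ‖a‖ ^ 2 ≤ newtonForm g t e e := by
    have h8 := newtonForm_self_nonneg g t (e - (1 / L) • a)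
    rw [newtonForm_sub_left, newtonForm_sub_right, newtonForm_sub_right, newtonForm_smul_left,
      newtonForm_smul_left, newtonForm_smul_right, newtonForm_smul_right,
      newtonForm_comm g t a e, ← haw a, real_inner_self_eq_norm_sq] at h8
    have h9 := mul_le_mul_of_nonneg_left (hgL a) (by positivity : (0 : ℝ) ≤ (1 / L) * (1 / L))
    have h10 : (1 / L) * (1 / L) * (L * ‖a‖ ^ 2) = (1 / L) * ‖a‖ ^ 2 := by field_simp
    rw [h10] at h9
    linarith
  have h8 := newtonForm_self_ge g t e
  have h9 : (1 / L) ^ 2 * ‖a‖ ^ 2 ≤ (1 / L) * newtonForm g t e e := by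
    have := mul_le_mul_of_nonneg_left h7 (by positivity : (0 : ℝ) ≤ 1 / L)
    linarith
  have h10 : (1 / L) * (102400 * ‖e‖ ^ 2) ≤ (1 / L) * newtonForm g t e e :=
    mul_le_mul_of_nonneg_left h8 (by positivity)
  have h11 : (1 - 102400 / L) * ‖e‖ ^ 2 = ‖e‖ ^ 2 - (1 / L) * (102400 * ‖e‖ ^ 2) := by ring
  rw [h6, h11]
  linarith

lemma norm_iterate_descentStep_le {d : ℕ} (g : ℕ → Vec d) (t : ℕ) (L : ℝ) {θ : Vec d}
    (hθ : ‖θ‖ ≤ 4) (k : ℕ) : ‖(descentStep g t L θ)^[k] θ‖ ≤ 4 := by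
  cases k with
  | zero => exact hθ
  | succ k => rw [Function.iterate_succ_apply']; exact norm_ballProj_le _

/-- The contraction factor is `T / (T + 1024) ≤ (1 + 1 / T)⁻¹`, and `T` steps at least halve the
squared distance. So the steps gain `2^(10 (T + 1))`, which beats `64 T^4`; here `64` is the squared
initial distance bound. -/
lemma contraction_pow_le {T : ℕ} (hT : 1 ≤ T) :
    64 * (1 - 102400 / (100 * (T : ℝ) + 102400)) ^ (10 * (T * (T + 1)))
      ≤ (1 / (T : ℝ) ^ 2) ^ 2 := by
  have hT' : (1 : ℝ) ≤ T := by exact_mod_cast hT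
  have h1 : 1 - 102400 / (100 * (T : ℝ) + 102400) ≤ (1 + 1 / (T : ℝ))⁻¹ := by
    have e1 : 1 - 102400 / (100 * (T : ℝ) + 102400) = T / (T + 1024) := by field_simp; ring
    have e2 : (1 + 1 / (T : ℝ))⁻¹ = T / (T + 1) := by field_simp
    rw [e1, e2]
    gcongr
    norm_num
  have h0 : 0 ≤ 1 - 102400 / (100 * (T : ℝ) + 102400) := by
    rw [sub_nonneg, div_le_one (by positivity)]
    linarith
  have h2 : (2 : ℝ) ≤ (1 + 1 / (T : ℝ)) ^ T := by
    have := one_add_mul_le_pow (a := 1 / (T : ℝ))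
      (by have : (0 : ℝ) ≤ 1 / T := by positivity
          linarith) T
    have e : (1 : ℝ) + T * (1 / T) = 2 := by field_simp; norm_num
    linarith
  have h3 : (1 - 102400 / (100 * (T : ℝ) + 102400)) ^ (10 * (T * (T + 1)))
      ≤ ((2 : ℝ) ^ (10 * (T + 1)))⁻¹ := by
    calc _ ≤ ((1 + 1 / (T : ℝ))⁻¹) ^ (10 * (T * (T + 1))) := pow_le_pow_left₀ h0 h1 _
      _ = (((1 + 1 / (T : ℝ)) ^ T) ^ (10 * (T + 1)))⁻¹ := by
        rw [inv_pow, ← pow_mul]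
        congr 2
        ring
      _ ≤ _ := by gcongr
  have h4 : 64 * (T : ℝ) ^ 4 ≤ 2 ^ (10 * (T + 1)) := by
    have h5 : (T : ℝ) ≤ 2 ^ T := by exact_mod_cast Nat.lt_two_pow_self.le
    calc 64 * (T : ℝ) ^ 4 ≤ 2 ^ 6 * (2 ^ T) ^ 4 := by
          norm_num
          gcongr
      _ = 2 ^ (6 + T * 4) := by rw [← pow_mul, ← pow_add]
      _ ≤ _ := pow_le_pow_right₀ (by norm_num) (by omega)
  have e : (1 / (T : ℝ) ^ 2) ^ 2 = ((T : ℝ) ^ 4)⁻¹ := by field_simp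
  rw [e]
  calc _ ≤ 64 * ((2 : ℝ) ^ (10 * (T + 1)))⁻¹ := by gcongr
    _ ≤ 64 * (64 * (T : ℝ) ^ 4)⁻¹ := by gcongr
    _ = _ := by field_simp

theorem norm_iterate_descentStep_sub_le {d : ℕ} {g : ℕ → Vec d} {t T : ℕ} (ht : t < T)
    (hg : ∀ τ ≤ t, ‖g τ‖ ≤ 10) {θ p : Vec d} (hθ : ‖θ‖ ≤ 4)
    (hp : IsProjBall (onsMatrix g t) (newtonStep (onsMatrix g t) θ (g t)) p) :
    ‖(descentStep g t (100 * T + 102400) θ)^[10 * (T * (T + 1))] θ - p‖ ≤ 1 / (T : ℝ) ^ 2 := by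
  have htT : (t : ℝ) + 1 ≤ T := by exact_mod_cast ht
  set L : ℝ := 100 * T + 102400 with hL
  have hL0 : 0 < L := by positivity
  have hgL : ∀ w, newtonForm g t w w ≤ L * ‖w‖ ^ 2 := by
    intro w
    refine (le_of_abs_le (abs_newtonForm_le hg w w)).trans ?_
    rw [← sq]
    gcongr
    rw [hL]
    linarith
  have h0 : 0 ≤ 1 - 102400 / L := by
    rw [sub_nonneg, div_le_one hL0, hL]
    linarith [(Nat.cast_nonneg T : (0 : ℝ) ≤ T)]
  have hit : ∀ k, ‖(descentStep g t L θ)^[k] θ - p‖ ^ 2 ≤ (1 - 102400 / L) ^ k * 64 := by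
    intro k
    induction k with
    | zero =>
      have : ‖θ - p‖ ≤ 8 := (norm_sub_le _ _).trans (by linarith [hp.1])
      rw [Function.iterate_zero, id, pow_zero]
      nlinarith [norm_nonneg (θ - p)]
    | succ k ih =>
      rw [Function.iterate_succ_apply']
      refine (norm_descentStep_sub_sq_le hL0 hgL hp _).trans ?_
      rw [pow_succ' (1 - 102400 / L), mul_assoc]
      exact mul_le_mul_of_nonneg_left ih h0
  have h1 := (hit (10 * (T * (T + 1)))).trans
    ((mul_comm _ _).trans_le (contraction_pow_le (T := T) (by omega)))
  exact (pow_le_pow_iff_left₀ (norm_nonneg _) (by positivity) two_ne_zero).mp h1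

/-! ### The update of the program -/

/-- Row `i` of length `d` of array `A`. -/
def Memory.row (s : Memory) (A d i : ℕ) : Vec d := WithLp.toLp 2 fun k => s.real A (i * d + k)

/-- The gradients of learner `i` recorded in the memory. -/
def Memory.grad (s : Memory) (d N i τ : ℕ) : Vec d := s.real 5 (τ * (N + 1) + i) • s.row 4 d τ

lemma Memory.inner_row (s : Memory) (A d i : ℕ) (w : Vec d) :
    inner ℝ (s.row A d i) w = ∑ k : Fin d, s.real A (i * d + k) * w k := by
  rw [inner_eq_dotProduct]; rfl

lemma Memory.row_congr {s s' : Memory} {A : ℕ} (h : s'.real A = s.real A) (d i : ℕ) :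
    s'.row A d i = s.row A d i := by
  simp only [Memory.row, h]

lemma Memory.grad_congr {s s' : Memory} (h4 : s'.real 4 = s.real 4) (h5 : s'.real 5 = s.real 5)
    (d N i : ℕ) : s'.grad d N i = s.grad d N i := by
  funext τ
  simp only [Memory.grad, Memory.row, h4, h5]

/-- The memory after an assignment of several rows. -/
lemma Cmd.exec_assign_rows {A : ℕ} {e₁ e₂ e₃ : NExpr} {r : RExpr} {s : Memory} (n₁ n₂ n₃ : ℕ)
    (F : ℕ → ℕ → ℕ → ℝ) (hA : A ≠ 20)
    (hn : e₁.eval s = n₁ ∧ e₂.eval s = n₂ ∧ e₃.eval s = n₃)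
    (he : e₁.VarsBelow 4 ∧ e₂.VarsBelow 4 ∧ e₃.VarsBelow 4)
    (hr : ∀ i < n₁, ∀ a < n₂, ∀ τ < n₃, ∀ s' : Memory, s.AgreesOff A s' → s'.nat 4 = i →
      s'.nat 5 = a → s'.nat 6 = τ → r.eval s' = F i a τ) :
    s.AgreesOff A ((Cmd.assign A (.const 0) e₁ e₂ e₃ r).exec s) ∧
    (∀ i < n₁, ∀ a < n₂, ((Cmd.assign A (.const 0) e₁ e₂ e₃ r).exec s).real A (i * n₂ + a)
      = ∑ τ ∈ Finset.range n₃, F i a τ) := by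
  obtain ⟨h1, h2, -⟩ := Cmd.exec_assign (A := A) (b := .const 0) (e₁ := e₁) (e₂ := e₂)
    (e₃ := e₃) (r := r) (s := s) 0 n₁ n₂ n₃ F hA ⟨rfl, hn⟩ ⟨trivial, he⟩ hr
  exact ⟨h1, fun i hi a ha => by simpa using h2 i hi a ha⟩

lemma varsBelow_size : NExpr.size.VarsBelow 4 := by simp [NExpr.size, NExpr.VarsBelow]

lemma eval_size {s : Memory} {N : ℕ} (h : s.nat 1 = N) : NExpr.size.eval s = N + 1 := by
  simp [NExpr.size, NExpr.eval, h]

/-- The sum over past gradients runs over all `T` rounds, which keeps the loop bounds independent of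
the round counter. Rounds after `t` contribute nothing because their coefficients are still zero. -/
lemma exec_gradStep {s : Memory} {d N T t : ℕ} (h0 : s.nat 0 = d) (h1 : s.nat 1 = N)
    (h2 : s.nat 2 = T) (h3 : s.nat 3 = t) (ht : t < T)
    (hc : ∀ τ, t < τ → τ < T → ∀ i < N + 1, s.real 5 (τ * (N + 1) + i) = 0) :
    (∀ v < 4, (gradStep.exec s).nat v = s.nat v) ∧
    (∀ b, b ≠ 11 → b ≠ 12 → b ≠ 13 → b ≠ 14 → b ≠ 15 → b ≠ 20 →
      (gradStep.exec s).real b = s.real b) ∧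
    (∀ i < N + 1, (gradStep.exec s).row 11 d i
      = descentStep (s.grad d N i) t (100 * T + 102400) (s.row 3 d i) (s.row 11 d i)) := by
  have hv : ∀ v < 4, (NExpr.var v).VarsBelow 4 := fun v hv => hv
  have v0 := hv 0 (by norm_num)
  have v2 := hv 2 (by norm_num)
  have vs := varsBelow_size
  have ez : ∀ {s' : Memory}, s'.nat 1 = N → NExpr.size.eval s' = N + 1 := eval_size
  obtain ⟨a1, b1⟩ := Cmd.exec_assign_rows (A := 12) (e₁ := .size) (e₂ := .var 2) (e₃ := .var 0)
    (s := s) (r := .mul (.read 4 (.pos 5 (.var 0) 6))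
      (.sub (.read 11 (.pos 4 (.var 0) 6)) (.read 3 (.pos 4 (.var 0) 6)))) (N + 1) T d
    (fun i a k => s.real 4 (a * d + k) * (s.real 11 (i * d + k) - s.real 3 (i * d + k)))
    (by norm_num) ⟨ez h1, h2, h0⟩ ⟨vs, v2, v0⟩ (fun i _ a _ k _ s' hs h4 h5 h6 => by
      simp only [RExpr.eval, hs.eval_pos v0 h0 h5 h6, hs.eval_pos v0 h0 h4 h6]
      simp [hs.real])
  obtain ⟨s₁, hs₁⟩ : ∃ s', s' = (Cmd.assign 12 (.const 0) .size (.var 2) (.var 0)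
    (.mul (.read 4 (.pos 5 (.var 0) 6))
      (.sub (.read 11 (.pos 4 (.var 0) 6)) (.read 3 (.pos 4 (.var 0) 6))))).exec s := ⟨_, rfl⟩
  rw [← hs₁] at a1 b1
  have n1 : ∀ v < 4, s₁.nat v = s.nat v := fun v hv =>
    a1.nat v (by omega) (by omega) (by omega)
  obtain ⟨a2, b2⟩ := Cmd.exec_assign_rows (A := 13) (e₁ := .size) (e₂ := .var 0) (e₃ := .var 2)
    (s := s₁) (r := .mul (.mul (.mul (.read 5 (.pos 6 .size 4)) (.read 5 (.pos 6 .size 4)))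
      (.read 12 (.pos 4 (.var 2) 6))) (.read 4 (.pos 6 (.var 0) 5))) (N + 1) d T
    (fun i a τ => s.real 5 (τ * (N + 1) + i) * s.real 5 (τ * (N + 1) + i)
      * s₁.real 12 (i * T + τ) * s.real 4 (τ * d + a))
    (by norm_num) ⟨ez (by simp [n1, h1]), by simp [NExpr.eval, n1, h0],
      by simp [NExpr.eval, n1, h2]⟩
    ⟨vs, v0, v2⟩ (fun i _ a _ τ _ s' hs h4 h5 h6 => by
      simp only [RExpr.eval, hs.eval_pos vs (ez (by simp [n1, h1])) h6 h4,
        hs.eval_pos v2 (n := T) (by simp [NExpr.eval, n1, h2]) h4 h6,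
        hs.eval_pos v0 (n := d) (by simp [NExpr.eval, n1, h0]) h6 h5]
      simp [hs.real, a1.real])
  obtain ⟨s₂, hs₂⟩ : ∃ s', s' = (Cmd.assign 13 (.const 0) .size (.var 0) (.var 2)
    (.mul (.mul (.mul (.read 5 (.pos 6 .size 4)) (.read 5 (.pos 6 .size 4)))
      (.read 12 (.pos 4 (.var 2) 6))) (.read 4 (.pos 6 (.var 0) 5)))).exec s₁ := ⟨_, rfl⟩
  rw [← hs₂] at a2 b2
  have n2 : ∀ v < 4, s₂.nat v = s.nat v := fun v hv =>
    (a2.nat v (by omega) (by omega) (by omega)).trans (n1 v hv)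
  obtain ⟨a3, b3⟩ := Cmd.exec_assign_rows (A := 14) (e₁ := .size) (e₂ := .var 0) (e₃ := .const 1)
    (s := s₂) (r := .sub (.read 11 (.pos 4 (.var 0) 5))
      (.div (.add (.add (.read 13 (.pos 4 (.var 0) 5))
          (.mul (.num 102400) (.sub (.read 11 (.pos 4 (.var 0) 5)) (.read 3 (.pos 4 (.var 0) 5)))))
        (.mul (.num 640) (.mul (.read 5 (.pos 3 .size 4)) (.read 4 (.pos 3 (.var 0) 5)))))
        (.ofNat (.add (.mul (.const 100) (.var 2)) (.const 102400))))) (N + 1) d 1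
    (fun i a _ => s.real 11 (i * d + a) - (s₂.real 13 (i * d + a)
      + 102400 * (s.real 11 (i * d + a) - s.real 3 (i * d + a))
      + 640 * (s.real 5 (t * (N + 1) + i) * s.real 4 (t * d + a))) / (100 * T + 102400))
    (by norm_num) ⟨ez (by simp [n2, h1]), by simp [NExpr.eval, n2, h0], rfl⟩
    ⟨vs, v0, trivial⟩ (fun i _ a _ τ _ s' hs h4 h5 h6 => by
      simp only [RExpr.eval, RExpr.eval_num,
        hs.eval_pos vs (ez (by simp [n2, h1])) (show s'.nat 3 = t by simp [hs.nat, n2, h3]) h4,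
        hs.eval_pos v0 (n := d) (by simp [NExpr.eval, n2, h0]) h4 h5,
        hs.eval_pos v0 (n := d) (by simp [NExpr.eval, n2, h0])
          (show s'.nat 3 = t by simp [hs.nat, n2, h3]) h5]
      simp [hs.real, hs.nat, n2, a2.real, a1.real, NExpr.eval, h2])
  obtain ⟨s₃, hs₃⟩ : ∃ s', s' = (Cmd.assign 14 (.const 0) .size (.var 0) (.const 1)
    (.sub (.read 11 (.pos 4 (.var 0) 5))
      (.div (.add (.add (.read 13 (.pos 4 (.var 0) 5))
          (.mul (.num 102400) (.sub (.read 11 (.pos 4 (.var 0) 5)) (.read 3 (.pos 4 (.var 0) 5)))))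
        (.mul (.num 640) (.mul (.read 5 (.pos 3 .size 4)) (.read 4 (.pos 3 (.var 0) 5)))))
        (.ofNat (.add (.mul (.const 100) (.var 2)) (.const 102400)))))).exec s₂ := ⟨_, rfl⟩
  rw [← hs₃] at a3 b3
  have n3 : ∀ v < 4, s₃.nat v = s.nat v := fun v hv =>
    (a3.nat v (by omega) (by omega) (by omega)).trans (n2 v hv)
  obtain ⟨a4, b4⟩ := Cmd.exec_assign_row (A := 15) (e₂ := .size) (e₃ := .var 0) (s := s₃)
    (r := .mul (.read 14 (.pos 5 (.var 0) 6)) (.read 14 (.pos 5 (.var 0) 6))) (N + 1) d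
    (fun i k => s₃.real 14 (i * d + k) * s₃.real 14 (i * d + k)) (by norm_num)
    ⟨ez (by simp [n3, h1]), by simp [NExpr.eval, n3, h0]⟩ ⟨vs, v0⟩
    (fun i _ k _ s' hs h5 h6 => by
      simp only [RExpr.eval, hs.eval_pos v0 (n := d) (by simp [NExpr.eval, n3, h0]) h5 h6]
      simp [hs.real])
  obtain ⟨s₄, hs₄⟩ : ∃ s', s' = (Cmd.assign 15 (.const 0) (.const 1) .size (.var 0)
    (.mul (.read 14 (.pos 5 (.var 0) 6)) (.read 14 (.pos 5 (.var 0) 6)))).exec s₃ := ⟨_, rfl⟩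
  rw [← hs₄] at a4 b4
  have n4 : ∀ v < 4, s₄.nat v = s.nat v := fun v hv =>
    (a4.nat v (by omega) (by omega) (by omega)).trans (n3 v hv)
  obtain ⟨a5, b5⟩ := Cmd.exec_assign_rows (A := 11) (e₁ := .size) (e₂ := .var 0) (e₃ := .const 1)
    (s := s₄) (r := .mul (.div (.num 4) (RExpr.max (.num 4) (.sqrt (.read 15 (.var 4)))))
        (.read 14 (.pos 4 (.var 0) 5))) (N + 1) d 1
    (fun i a _ => 4 / max 4 (Real.sqrt (s₄.real 15 i)) * s₃.real 14 (i * d + a))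
    (by norm_num) ⟨ez (by simp [n4, h1]), by simp [NExpr.eval, n4, h0], rfl⟩
    ⟨vs, v0, trivial⟩ (fun i _ a _ τ _ s' hs h4 h5 h6 => by
      simp only [RExpr.eval, RExpr.eval_num, RExpr.eval_max,
        hs.eval_pos v0 (n := d) (by simp [NExpr.eval, n4, h0]) h4 h5]
      simp [hs.real, a4.real, NExpr.eval, h4])
  have e : gradStep.exec s = (Cmd.assign 11 (.const 0) .size (.var 0) (.const 1)
      (.mul (.div (.num 4) (RExpr.max (.num 4) (.sqrt (.read 15 (.var 4)))))
        (.read 14 (.pos 4 (.var 0) 5)))).exec s₄ := by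
    rw [hs₄, hs₃, hs₂, hs₁]; rfl
  rw [← e] at a5 b5
  refine ⟨fun v hv => (a5.nat v (by omega) (by omega) (by omega)).trans (n4 v hv),
    fun b hb11 hb12 hb13 hb14 hb15 hb20 => ?_, fun i hi => ?_⟩
  · rw [a5.real b hb11 hb20, a4.real b hb15 hb20, a3.real b hb14 hb20, a2.real b hb13 hb20,
      a1.real b hb12 hb20]
  have r12 : ∀ τ < T, s₁.real 12 (i * T + τ)
      = inner ℝ (s.row 4 d τ) (s.row 11 d i - s.row 3 d i) := by
    intro τ hτ
    rw [b1 i hi τ hτ, Memory.inner_row, Finset.sum_range]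
    rfl
  have r13 : s₂.row 13 d i = ∑ τ ∈ Finset.range (t + 1),
      inner ℝ (s.grad d N i τ) (s.row 11 d i - s.row 3 d i) • s.grad d N i τ := by
    have hsub : Finset.range (t + 1) ⊆ Finset.range T := Finset.range_subset_range.mpr ht
    rw [Finset.sum_subset hsub]
    · ext a
      simp only [Memory.row]
      rw [b2 i hi a a.2, WithLp.ofLp_sum, Finset.sum_apply]
      refine Finset.sum_congr rfl fun τ hτ => ?_
      rw [r12 τ (Finset.mem_range.mp hτ)]
      simp only [Memory.grad, real_inner_smul_left, WithLp.ofLp_smul, Pi.smul_apply, smul_eq_mul,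
        Memory.row]
      ring
    · intro τ hτ hτ'
      rw [Finset.mem_range] at hτ hτ'
      rw [Memory.grad, hc τ (by omega) hτ i hi]
      simp
  have r14 : s₃.row 14 d i = s.row 11 d i - (1 / (100 * T + 102400 : ℝ)) •
      (newtonOp (s.grad d N i) t (s.row 11 d i - s.row 3 d i) + (640 : ℝ) • s.grad d N i t) := by
    rw [newtonOp, ← r13]
    ext a
    simp only [Memory.row, Memory.grad]
    rw [b3 i hi a a.2]
    simp only [Finset.sum_const, Finset.card_range, one_smul, WithLp.ofLp_sub, WithLp.ofLp_smul,
      WithLp.ofLp_add, Pi.sub_apply, Pi.smul_apply, Pi.add_apply, smul_eq_mul]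
    ring
  have r15 : Real.sqrt (s₄.real 15 i) = ‖s₃.row 14 d i‖ := by
    rw [b4 i hi, Finset.sum_range, EuclideanSpace.norm_eq]
    congr 1
    refine Finset.sum_congr rfl fun k _ => ?_
    rw [Real.norm_eq_abs, sq_abs, sq]
    rfl
  rw [descentStep, ← r14, ballProj, ← r15]
  ext a
  simp only [Memory.row]
  rw [b5 i hi a a.2]
  simp

lemma exec_updateCmd {s : Memory} {d N T t : ℕ} (h0 : s.nat 0 = d) (h1 : s.nat 1 = N)
    (h2 : s.nat 2 = T) (h3 : s.nat 3 = t) (ht : t < T)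
    (hc : ∀ τ, t < τ → τ < T → ∀ i < N + 1, s.real 5 (τ * (N + 1) + i) = 0) :
    (updateCmd.exec s).nat 3 = t + 1 ∧
    (∀ i < N + 1, (updateCmd.exec s).real 5 (t * (N + 1) + i)
      = 2 * s.real 2 i * (s.real 6 i - s.real 1 0)) ∧
    (∀ τ ≠ t, ∀ i < N + 1,
      (updateCmd.exec s).real 5 (τ * (N + 1) + i) = s.real 5 (τ * (N + 1) + i)) ∧
    (updateCmd.exec s).row 4 d t = WithLp.toLp 2 (fun k : Fin d => s.real 0 k) ∧
    (∀ τ ≠ t, (updateCmd.exec s).row 4 d τ = s.row 4 d τ) ∧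
    (∀ i < N + 1, (updateCmd.exec s).row 3 d i
      = (descentStep ((updateCmd.exec s).grad d N i) t (100 * T + 102400)
          (s.row 3 d i))^[10 * (T * (T + 1))] (s.row 3 d i)) := by
  have hv : ∀ v < 4, (NExpr.var v).VarsBelow 4 := fun v hv => hv
  have v0 := hv 0 (by norm_num)
  have v3 := hv 3 (by norm_num)
  have vs := varsBelow_size
  have ez : ∀ {s' : Memory}, s'.nat 1 = N → NExpr.size.eval s' = N + 1 := eval_size
  -- In the flattened layout, entries of other rows lie outside the block of row `t`, so the new
  -- record leaves the old ones intact.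
  have hrow : ∀ (e τ k : ℕ), τ ≠ t → k < e → τ * e + k < t * e ∨ (t + 1) * e ≤ τ * e + k := by
    intro e τ k hτ hk
    rcases Nat.lt_or_gt_of_ne hτ with h | h
    · left
      calc τ * e + k < τ * e + e := by omega
        _ = (τ + 1) * e := by ring
        _ ≤ t * e := Nat.mul_le_mul_right _ h
    · right
      exact (Nat.mul_le_mul_right _ h).trans (Nat.le_add_right _ _)
  obtain ⟨a1, b1, c1⟩ := Cmd.exec_assign (A := 5) (b := .var 3) (e₁ := .const 1) (e₂ := .size)
    (e₃ := .const 1) (s := s)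
    (r := .mul (.mul (.num 2) (.read 2 (.var 5))) (.sub (.read 6 (.var 5)) (.read 1 (.const 0))))
    t 1 (N + 1) 1 (fun _ i _ => 2 * s.real 2 i * (s.real 6 i - s.real 1 0)) (by norm_num)
    ⟨h3, rfl, ez h1, rfl⟩ ⟨v3, trivial, vs, trivial⟩ (fun i _ a _ k _ s' hs h4 h5 h6 => by
      simp [RExpr.eval, NExpr.eval, hs.real, h5])
  obtain ⟨s₁, hs₁⟩ : ∃ s', s' = (Cmd.assign 5 (.var 3) (.const 1) .size (.const 1)
    (.mul (.mul (.num 2) (.read 2 (.var 5)))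
      (.sub (.read 6 (.var 5)) (.read 1 (.const 0))))).exec s := ⟨_, rfl⟩
  rw [← hs₁] at a1 b1 c1
  have n1 : ∀ v < 4, s₁.nat v = s.nat v := fun v hv =>
    a1.nat v (by omega) (by omega) (by omega)
  obtain ⟨a2, b2, c2⟩ := Cmd.exec_assign (A := 4) (b := .var 3) (e₁ := .const 1) (e₂ := .var 0)
    (e₃ := .const 1) (s := s₁) (r := .read 0 (.var 5))
    t 1 d 1 (fun _ k _ => s.real 0 k) (by norm_num)
    ⟨(n1 3 (by norm_num)).trans h3, rfl, (n1 0 (by norm_num)).trans h0, rfl⟩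
    ⟨v3, trivial, v0, trivial⟩ (fun i _ a _ k _ s' hs h4 h5 h6 => by
      simp [RExpr.eval, NExpr.eval, hs.real, a1.real, h5])
  obtain ⟨s₂, hs₂⟩ : ∃ s', s' = (Cmd.assign 4 (.var 3) (.const 1) (.var 0) (.const 1)
    (.read 0 (.var 5))).exec s₁ := ⟨_, rfl⟩
  rw [← hs₂] at a2 b2 c2
  have n2 : ∀ v < 4, s₂.nat v = s.nat v := fun v hv =>
    (a2.nat v (by omega) (by omega) (by omega)).trans (n1 v hv)
  obtain ⟨a3, b3⟩ := Cmd.exec_assign_rows (A := 11) (e₁ := .size) (e₂ := .var 0) (e₃ := .const 1)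
    (s := s₂) (r := .read 3 (.pos 4 (.var 0) 5)) (N + 1) d 1 (fun i k _ => s.real 3 (i * d + k))
    (by norm_num) ⟨ez ((n2 1 (by norm_num)).trans h1), (n2 0 (by norm_num)).trans h0, rfl⟩
    ⟨vs, v0, trivial⟩ (fun i _ a _ k _ s' hs h4 h5 h6 => by
      simp only [RExpr.eval, hs.eval_pos v0 (n := d) (by simp [NExpr.eval, n2, h0]) h4 h5]
      simp [hs.real, a2.real, a1.real])
  obtain ⟨s₃, hs₃⟩ : ∃ s', s' = (Cmd.assign 11 (.const 0) .size (.var 0) (.const 1)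
    (.read 3 (.pos 4 (.var 0) 5))).exec s₂ := ⟨_, rfl⟩
  rw [← hs₃] at a3 b3
  have n3 : ∀ v < 4, s₃.nat v = s.nat v := fun v hv =>
    (a3.nat v (by omega) (by omega) (by omega)).trans (n2 v hv)
  have r5 : s₃.real 5 = s₁.real 5 := by simp [a3.real, a2.real]
  have r3 : s₃.real 3 = s.real 3 := by simp [a3.real, a2.real, a1.real]
  have r5' : ∀ τ ≠ t, ∀ i < N + 1, s₃.real 5 (τ * (N + 1) + i) = s.real 5 (τ * (N + 1) + i) :=
    fun τ hτ i hi => by rw [r5, c1 _ (hrow (N + 1) τ i hτ hi)]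
  have key := Cmd.exec_loop_induction (v := 7) (e := .gradRounds) (c := gradStep) (s := s₃)
    (I := fun k s' => (∀ v < 4, s'.nat v = s₃.nat v) ∧
      (∀ b, b ≠ 11 → b ≠ 12 → b ≠ 13 → b ≠ 14 → b ≠ 15 → b ≠ 20 → s'.real b = s₃.real b) ∧
      (∀ i < N + 1, s'.row 11 d i = (descentStep (s₃.grad d N i) t (100 * T + 102400)
        (s.row 3 d i))^[k] (s.row 3 d i)))
    ⟨fun _ _ => rfl, fun _ _ _ _ _ _ _ => rfl, fun i hi => by
      ext k
      simp only [Memory.row]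
      rw [b3 i hi k k.2]
      simp⟩ ?_
  · obtain ⟨s₄, hs₄⟩ : ∃ s', s' = (Cmd.loop 7 .gradRounds gradStep).exec s₃ := ⟨_, rfl⟩
    have hM : NExpr.gradRounds.eval s₃ = 10 * (T * (T + 1)) := by
      simp [NExpr.gradRounds, NExpr.eval, n3, h2]
    rw [hM, ← hs₄] at key
    obtain ⟨k1, k2, k3⟩ := key
    have n4 : ∀ v < 4, s₄.nat v = s.nat v := fun v hv => (k1 v hv).trans (n3 v hv)
    obtain ⟨a5, b5⟩ := Cmd.exec_assign_rows (A := 3) (e₁ := .size) (e₂ := .var 0)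
      (e₃ := .const 1) (s := s₄) (r := .read 11 (.pos 4 (.var 0) 5)) (N + 1) d 1
      (fun i k _ => s₄.real 11 (i * d + k)) (by norm_num)
      ⟨ez ((n4 1 (by norm_num)).trans h1), (n4 0 (by norm_num)).trans h0, rfl⟩
      ⟨vs, v0, trivial⟩ (fun i _ a _ k _ s' hs h4 h5 h6 => by
        simp only [RExpr.eval, hs.eval_pos v0 (n := d) (by simp [NExpr.eval, n4, h0]) h4 h5]
        simp [hs.real])
    obtain ⟨s₅, hs₅⟩ : ∃ s', s' = (Cmd.assign 3 (.const 0) .size (.var 0) (.const 1)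
      (.read 11 (.pos 4 (.var 0) 5))).exec s₄ := ⟨_, rfl⟩
    rw [← hs₅] at a5 b5
    have n5 : s₅.nat 3 = t := by simp [a5.nat, n4, h3]
    have e : updateCmd.exec s = s₅.setNat 3 (s₅.nat 3 + 1) := by
      rw [hs₅, hs₄, hs₃, hs₂, hs₁]; rfl
    have er : (updateCmd.exec s).real = s₅.real := by rw [e]; rfl
    have e4 : (updateCmd.exec s).real 4 = s₂.real 4 := by
      rw [er, a5.real 4 (by norm_num) (by norm_num)]
      simp [k2, a3.real]
    have e5 : (updateCmd.exec s).real 5 = s₃.real 5 := by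
      rw [er, a5.real 5 (by norm_num) (by norm_num)]
      simp [k2]
    have e4' : (updateCmd.exec s).real 4 = s₃.real 4 := by
      rw [e4, a3.real 4 (by norm_num) (by norm_num)]
    refine ⟨by rw [e]; simp [n5], fun i hi => ?_, fun τ hτ i hi => ?_, ?_, fun τ hτ => ?_,
      fun i hi => ?_⟩
    · have := b1 0 one_pos i hi
      rw [e5, r5]
      simpa using this
    · rw [e5, r5' τ hτ i hi]
    · ext k
      have := b2 0 one_pos k k.2
      simp only [Memory.row]
      rw [e4]
      simpa using this
    · ext k
      simp only [Memory.row]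
      rw [e4, c2 _ (hrow d τ k hτ k.2), a1.real 4 (by norm_num) (by norm_num)]
    · rw [Memory.grad_congr e4' e5, ← k3 i hi]
      ext k
      simp only [Memory.row]
      rw [er, b5 i hi k k.2]
      simp
  · rintro k - s' ⟨k1, k2, k3⟩
    have m4 : (s'.setNat 7 k).real 4 = s₃.real 4 := by simp [k2]
    have m5 : (s'.setNat 7 k).real 5 = s₃.real 5 := by simp [k2]
    have m3 : (s'.setNat 7 k).real 3 = s.real 3 := by simp [k2, r3]
    obtain ⟨p1, p2, p3⟩ := exec_gradStep (s := s'.setNat 7 k) (d := d) (N := N) (T := T) (t := t)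
      (by simp [k1, n3, h0]) (by simp [k1, n3, h1]) (by simp [k1, n3, h2])
      (by simp [k1, n3, h3]) ht (fun τ hτ hτT i hi => by
        rw [m5, r5' τ hτ.ne' i hi, hc τ hτ hτT i hi])
    refine ⟨fun v hv => ?_, fun b hb11 hb12 hb13 hb14 hb15 hb20 => ?_, fun i hi => ?_⟩
    · rw [p1 v hv, Memory.setNat_nat, if_neg (by omega), k1 v hv]
    · rw [p2 b hb11 hb12 hb13 hb14 hb15 hb20]
      exact k2 b hb11 hb12 hb13 hb14 hb15 hb20
    · rw [p3 i hi, Function.iterate_succ_apply', ← k3 i hi, Memory.grad_congr m4 m5,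
        Memory.row_congr m3]
      rfl

/-! ### The power iteration -/

/-- The machine has no floor operation; the hat function expresses rounding by absolute values and
maxima, which are available through square roots. -/
lemma rround_eq_hat {N : ℕ} {w : ℝ} (hw : 0 ≤ w) (j : Fin (N + 1)) :
    rround N w j = max 0 (1 - |N * w - (j : ℕ)|) := by
  have h0 : 0 ≤ N * w := by positivity
  have h1 := Nat.lt_floor_add_one (N * w : ℝ)
  have h2 := Nat.floor_le h0
  unfold rround
  set m := ⌊N * w⌋₊
  split_ifs with h h'
  · rw [h, abs_of_nonneg (by linarith), max_eq_right (by linarith)]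
    ring
  · rw [h']
    push_cast
    rw [abs_of_nonpos (by linarith), max_eq_right (by linarith)]
    ring
  · rw [max_eq_left]
    rcases Nat.lt_or_gt_of_ne h with hlt | hgt
    · have : ((j : ℕ) : ℝ) + 1 ≤ m := by exact_mod_cast hlt
      rw [abs_of_nonneg (by linarith)]
      linarith
    · have : (m : ℝ) + 2 ≤ (j : ℕ) := by exact_mod_cast (by omega : m + 2 ≤ (j : ℕ))
      rw [abs_of_nonpos (by linarith)]
      linarith

lemma hatWeight_eq_rround {N : ℕ} (v : ℝ) (j : Fin (N + 1)) :
    hatWeight N v j = rround N (clip v) j := (rround_eq_hat (clip_mem v).1 j).symm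

lemma powerIter_nonneg (N : ℕ) (v : ℕ → ℝ) (k j : ℕ) : 0 ≤ powerIter N v k j := by
  induction k generalizing j with
  | zero => simp only [powerIter]; positivity
  | succ k ih =>
    exact Finset.sum_nonneg fun i _ => mul_nonneg (le_max_left _ _) (ih i)

lemma powerIter_succ (N : ℕ) (v : ℕ → ℝ) (k : ℕ) (j : Fin (N + 1)) :
    powerIter N v (k + 1) j
      = ∑ i : Fin (N + 1), rround N (clip (v i)) j * powerIter N v k i := by
  rw [powerIter, Finset.sum_range]
  exact Finset.sum_congr rfl fun i _ => by rw [hatWeight_eq_rround]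

lemma sum_powerIter (N : ℕ) (v : ℕ → ℝ) (k : ℕ) : ∑ j : Fin (N + 1), powerIter N v k j = 1 := by
  induction k with
  | zero =>
    simp [powerIter]
    field_simp
  | succ k ih =>
    simp only [powerIter_succ]
    rw [Finset.sum_comm]
    simp only [← Finset.sum_mul, sum_rround (clip_mem _), one_mul]
    exact ih

lemma average_powerIter_mem_stdSimplex (N : ℕ) (v : ℕ → ℝ) {M : ℕ} (hM : 0 < M) :
    (fun j : Fin (N + 1) => ∑ k ∈ Finset.range M, powerIter N v k j / (M : ℝ))
      ∈ stdSimplex ℝ (Fin (N + 1)) := by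
  have hM' : (0 : ℝ) < M := by exact_mod_cast hM
  refine ⟨fun j => Finset.sum_nonneg fun k _ =>
    div_nonneg (powerIter_nonneg _ _ _ _) hM'.le, ?_⟩
  rw [Finset.sum_comm]
  simp only [← Finset.sum_div, sum_powerIter]
  simp [hM'.ne']

/-- The average of the power iterates is nearly stationary. -/
lemma average_powerIter_near_stationary (N : ℕ) (v : ℕ → ℝ) {M : ℕ} (hM : 0 < M) :
    ∑ j : Fin (N + 1), |(∑ i : Fin (N + 1), rround N (clip (v i)) j *
        ∑ k ∈ Finset.range M, powerIter N v k i / (M : ℝ))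
        - ∑ k ∈ Finset.range M, powerIter N v k j / (M : ℝ)| ≤ 2 / M := by
  have hM' : (0 : ℝ) < M := by exact_mod_cast hM
  -- Applying the rounding matrix shifts the average by one iterate, so the difference telescopes.
  -- The chain may be periodic or reducible; convergence of the iterates is not needed.
  have e : ∀ j : Fin (N + 1), (∑ i : Fin (N + 1), rround N (clip (v i)) j *
        ∑ k ∈ Finset.range M, powerIter N v k i / (M : ℝ))
        - ∑ k ∈ Finset.range M, powerIter N v k j / (M : ℝ)
      = (powerIter N v M j - powerIter N v 0 j) / M := by
    intro j
    have e1 : ∑ i : Fin (N + 1), rround N (clip (v i)) j *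
        ∑ k ∈ Finset.range M, powerIter N v k i / (M : ℝ)
        = ∑ k ∈ Finset.range M, powerIter N v (k + 1) j / (M : ℝ) := by
      simp only [Finset.mul_sum]
      rw [Finset.sum_comm]
      refine Finset.sum_congr rfl fun k _ => ?_
      rw [powerIter_succ, Finset.sum_div]
      exact Finset.sum_congr rfl fun i _ => by ring
    rw [e1, ← Finset.sum_sub_distrib, sub_div]
    exact Finset.sum_range_sub (fun k => powerIter N v k j / (M : ℝ)) M
  simp only [e]
  have h : ∀ j : Fin (N + 1), |(powerIter N v M j - powerIter N v 0 j) / M|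
      ≤ (powerIter N v M j + powerIter N v 0 j) / M := by
    intro j
    rw [abs_div, abs_of_pos hM']
    gcongr
    have h1 := powerIter_nonneg N v M j
    have h2 := powerIter_nonneg N v 0 j
    rw [abs_le]
    constructor <;> linarith
  refine (Finset.sum_le_sum fun j _ => h j).trans (le_of_eq ?_)
  rw [← Finset.sum_div, Finset.sum_add_distrib, sum_powerIter, sum_powerIter]
  norm_num

/-! ### The run of the program -/

section run

variable {d : ℕ} (N T : ℕ) (x : ℕ → Context d) (y : ℕ → ℝ)

/-- The iterate of learner `i` before round `t`. -/
def learnerIterate (t i : ℕ) : Vec d := (forecaster.before d N T x y t).row 3 d i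

/-- The probability of the grid point with index `i` in round `t`. -/
def forecastEntry (t i : ℕ) : ℝ := (forecaster.predicted d N T x y t).real 2 i

/-- The state of the memory before round `t`. -/
structure RunInvariant (t : ℕ) : Prop where
  nat0 : (forecaster.before d N T x y t).nat 0 = d
  nat1 : (forecaster.before d N T x y t).nat 1 = N
  nat2 : (forecaster.before d N T x y t).nat 2 = T
  nat3 : (forecaster.before d N T x y t).nat 3 = t
  context : ∀ τ < t, (forecaster.before d N T x y t).row 4 d τ = (x τ).1
  coeff : ∀ τ < t, ∀ i < N + 1, (forecaster.before d N T x y t).real 5 (τ * (N + 1) + i)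
    = 2 * forecastEntry N T x y τ i * (inner ℝ (learnerIterate N T x y τ i) (x τ).1 - y τ)
  coeff_zero : ∀ τ, t ≤ τ → ∀ i < N + 1,
    (forecaster.before d N T x y t).real 5 (τ * (N + 1) + i) = 0
  norm : ∀ i < N + 1, ‖learnerIterate N T x y t i‖ ≤ 4

variable {N T x y}

lemma giveContext_real_zero (s : Memory) (c : Context d) (k : Fin d) :
    (OnlineProgram.giveContext s c).real 0 k = c.1 k := by
  simp [OnlineProgram.giveContext]

lemma giveContext_real_of_ne (s : Memory) (c : Context d) {b : ℕ} (hb : b ≠ 0) :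
    (OnlineProgram.giveContext s c).real b = s.real b := by
  funext k
  simp [OnlineProgram.giveContext, hb]

lemma RunInvariant.predicted_facts {t : ℕ} (h : RunInvariant N T x y t) :
    (∀ v < 4, (forecaster.predicted d N T x y t).nat v
      = (forecaster.before d N T x y t).nat v) ∧
    (∀ k : Fin d, (forecaster.predicted d N T x y t).real 0 k = (x t).1 k) ∧
    (∀ b, b = 3 ∨ b = 4 ∨ b = 5 → (forecaster.predicted d N T x y t).real b
      = (forecaster.before d N T x y t).real b) ∧
    (∀ i < N + 1, (forecaster.predicted d N T x y t).real 6 i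
      = inner ℝ (learnerIterate N T x y t i) (x t).1) ∧
    (∀ j < N + 1, forecastEntry N T x y t j = ∑ k ∈ Finset.range (2 * (T * T)),
      powerIter N ((forecaster.predicted d N T x y t).real 6) k j / ((2 * (T * T) : ℕ) : ℝ)) := by
  set s := OnlineProgram.giveContext (forecaster.before d N T x y t) (x t) with hs
  obtain ⟨p1, p2, p3, p4⟩ := exec_predictCmd (s := s) (d := d) (N := N) (T := T) h.nat0 h.nat1
    h.nat2
  refine ⟨p1, fun k => ?_, fun b hb => ?_, fun i hi => ?_, p4⟩
  · exact (congrFun (p2 0 (by norm_num) (by norm_num) (by norm_num) (by norm_num) (by norm_num)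
      (by norm_num)) k).trans (giveContext_real_zero _ _ k)
  · exact (p2 b (by omega) (by omega) (by omega) (by omega) (by omega) (by omega)).trans
      (giveContext_real_of_ne _ _ (by omega))
  · refine (p3 i hi).trans ?_
    rw [learnerIterate, Memory.inner_row, Finset.sum_range]
    refine Finset.sum_congr rfl fun k _ => ?_
    rw [hs, giveContext_real_zero, giveContext_real_of_ne _ _ (by norm_num)]

/-- Needed because the memory records the gradients only up to round `t`, whereas the sequence of
the run continues. -/
lemma descentStep_congr {g g' : ℕ → Vec d} {t : ℕ} (h : ∀ τ ≤ t, g τ = g' τ) (L : ℝ) :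
    descentStep g t L = descentStep g' t L := by
  funext θ u
  have e : newtonOp g t = newtonOp g' t := by
    funext w
    unfold newtonOp
    congr 1
    refine Finset.sum_congr rfl fun τ hτ => ?_
    rw [h τ (Nat.lt_succ_iff.mp (Finset.mem_range.mp hτ))]
  simp only [descentStep, e, h t le_rfl]

/-- The new iterates are given along with the invariant, expressed through the gradients of the run,
so that the convergence estimate for descent applies to them directly. -/
lemma RunInvariant.succ {t : ℕ} (h : RunInvariant N T x y t) (ht : t < T) :
    RunInvariant N T x y (t + 1) ∧ ∀ i < N + 1, learnerIterate N T x y (t + 1) i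
      = (descentStep (fun τ => onsGrad (forecastEntry N T x y τ i) (x τ).1 (y τ)
          (learnerIterate N T x y τ i)) t (100 * T + 102400)
            (learnerIterate N T x y t i))^[10 * (T * (T + 1))] (learnerIterate N T x y t i) := by
  obtain ⟨p1, p2, p3, p4, p5⟩ := h.predicted_facts
  set s := OnlineProgram.giveLabel (forecaster.predicted d N T x y t) (y t) with hs
  have hsb : ∀ b, b ≠ 1 → s.real b = (forecaster.predicted d N T x y t).real b := fun b hb =>
    Memory.setReal_real_of_ne _ _ _ hb
  have hs1 : s.real 1 0 = y t := by
    simp [hs, OnlineProgram.giveLabel, Memory.setReal_real_same]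
  have hsn : ∀ v < 4, s.nat v = (forecaster.before d N T x y t).nat v := p1
  have hs5 : s.real 5 = (forecaster.before d N T x y t).real 5 := by
    rw [hsb 5 (by norm_num), p3 5 (by simp)]
  have hs4 : s.real 4 = (forecaster.before d N T x y t).real 4 := by
    rw [hsb 4 (by norm_num), p3 4 (by simp)]
  have hs3 : s.real 3 = (forecaster.before d N T x y t).real 3 := by
    rw [hsb 3 (by norm_num), p3 3 (by simp)]
  have k0 := (hsn 0 (by norm_num)).trans h.nat0
  have k1 := (hsn 1 (by norm_num)).trans h.nat1
  have k2 := (hsn 2 (by norm_num)).trans h.nat2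
  obtain ⟨u1, u2, u3, u4, u5, u6⟩ := exec_updateCmd (s := s) k0 k1 k2
    ((hsn 3 (by norm_num)).trans h.nat3) ht (fun τ hτ _ i hi => by
      rw [hs5]; exact h.coeff_zero τ hτ.le i hi)
  have hB : forecaster.before d N T x y (t + 1) = updateCmd.exec s := rfl
  have hcontext : ∀ τ < t + 1, (updateCmd.exec s).row 4 d τ = (x τ).1 := by
    intro τ hτ
    rcases Nat.lt_succ_iff_lt_or_eq.mp hτ with hlt | rfl
    · rw [u5 τ hlt.ne, Memory.row_congr hs4, h.context τ hlt]
    · rw [u4, hsb 0 (by norm_num)]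
      ext k
      exact p2 k
  have hcoeff : ∀ τ < t + 1, ∀ i < N + 1, (updateCmd.exec s).real 5 (τ * (N + 1) + i)
      = 2 * forecastEntry N T x y τ i
        * (inner ℝ (learnerIterate N T x y τ i) (x τ).1 - y τ) := by
    intro τ hτ i hi
    rcases Nat.lt_succ_iff_lt_or_eq.mp hτ with hlt | rfl
    · rw [u3 τ hlt.ne i hi, hs5, h.coeff τ hlt i hi]
    · rw [u2 i hi, hs1, hsb 2 (by norm_num), hsb 6 (by norm_num), p4 i hi]
      rfl
  have hgrad : ∀ i < N + 1, ∀ τ ≤ t, (updateCmd.exec s).grad d N i τ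
      = onsGrad (forecastEntry N T x y τ i) (x τ).1 (y τ) (learnerIterate N T x y τ i) := by
    intro i hi τ hτ
    rw [Memory.grad, hcontext τ (by omega), hcoeff τ (by omega) i hi, onsGrad]
  have hθ : ∀ i < N + 1, learnerIterate N T x y (t + 1) i
      = (descentStep (fun τ => onsGrad (forecastEntry N T x y τ i) (x τ).1 (y τ)
          (learnerIterate N T x y τ i)) t (100 * T + 102400)
            (learnerIterate N T x y t i))^[10 * (T * (T + 1))] (learnerIterate N T x y t i) := by
    intro i hi
    rw [learnerIterate, hB, u6 i hi, descentStep_congr (hgrad i hi), Memory.row_congr hs3]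
    rfl
  refine ⟨⟨?_, ?_, ?_, u1, hcontext, hcoeff, fun τ hτ i hi => ?_, fun i hi => ?_⟩, hθ⟩
  · exact (tame_updateCmd.nat_exec s (by norm_num)).trans k0
  · exact (tame_updateCmd.nat_exec s (by norm_num)).trans k1
  · exact (tame_updateCmd.nat_exec s (by norm_num)).trans k2
  · rw [hB, u3 τ (by omega) i hi, hs5]
    exact h.coeff_zero τ (by omega) i hi
  · rw [hθ i hi]
    exact norm_iterate_descentStep_le _ _ _ (h.norm i hi) _

lemma runInvariant {t : ℕ} (ht : t ≤ T) : RunInvariant N T x y t := by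
  induction t with
  | zero =>
    refine ⟨rfl, rfl, rfl, rfl, fun τ hτ => absurd hτ (Nat.not_lt_zero τ),
      fun τ hτ => absurd hτ (Nat.not_lt_zero τ), fun _ _ _ _ => rfl, fun i _ => ?_⟩
    have : learnerIterate N T x y 0 i = 0 := rfl
    rw [this, norm_zero]
    norm_num
  | succ t ih => exact ((ih (by omega)).succ (by omega)).1

theorem isBMRun_forecaster (hT : 1 ≤ T) (hy : ∀ t, 0 ≤ y t ∧ y t ≤ 1) :
    IsBMRun (1 / (T : ℝ) ^ 2) d T x y (forecaster.forecast d N T x y) := by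
  have hT' : (1 : ℝ) ≤ T := by exact_mod_cast hT
  have hM : 0 < 2 * (T * T) := by positivity
  have hP : ∀ t < T, forecaster.forecast d N T x y t = fun j : Fin (N + 1) =>
      ∑ k ∈ Finset.range (2 * (T * T)),
        powerIter N ((forecaster.predicted d N T x y t).real 6) k j / ((2 * (T * T) : ℕ) : ℝ) := by
    intro t ht
    funext j
    exact (runInvariant ht.le).predicted_facts.2.2.2.2 j j.2
  have hmem : ∀ t < T, forecaster.forecast d N T x y t ∈ stdSimplex ℝ (Fin (N + 1)) := by
    intro t ht
    rw [hP t ht]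
    exact average_powerIter_mem_stdSimplex _ _ hM
  refine ⟨fun t i => learnerIterate N T x y t i,
    fun i => (runInvariant (Nat.zero_le T)).norm i i.2, fun t ht => ⟨hmem t ht, ?_⟩,
    fun t ht i => ?_⟩
  · rw [hP t ht]
    refine le_trans (le_of_eq ?_) ((average_powerIter_near_stationary N
      ((forecaster.predicted d N T x y t).real 6) hM).trans (le_of_eq ?_))
    · refine Finset.sum_congr rfl fun j _ => ?_
      congr 2
      refine Finset.sum_congr rfl fun i _ => ?_
      rw [(runInvariant ht.le).predicted_facts.2.2.2.1 i i.2]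
    · push_cast
      field_simp
  · intro g
    have hinv := runInvariant (N := N) (x := x) (y := y) (show t ≤ T by omega)
    have hstep := (hinv.succ (by omega)).2 i i.2
    have hg : ∀ τ ≤ t, ‖g τ‖ ≤ 10 := fun τ hτ => by
      have hτT : τ < T := by omega
      refine norm_onsGrad_le (x τ).2.1 ((runInvariant hτT.le).norm i i.2) (hy τ)
        ⟨(hmem τ hτT).1 i, ?_⟩
      rw [← (hmem τ hτT).2]
      exact Finset.single_le_sum (fun j _ => (hmem τ hτT).1 j) (Finset.mem_univ i)
    -- The exact projection exists by compactness of the ball; the program only approaches it.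
    obtain ⟨u, hu⟩ := exists_isProjBall g t (newtonStep (onsMatrix g t)
      (learnerIterate N T x y t i) (g t))
    refine ⟨(runInvariant ht.le).norm i i.2, u, hu, ?_⟩
    simp only
    rw [hstep]
    exact norm_iterate_descentStep_sub_le (by omega) hg (hinv.norm i i.2) hu

end run

/-! ### The cost of the program -/

lemma OnlineProgram.nat_before {A : OnlineProgram} (hi : A.init.Tame) (hp : A.predict.Tame)
    (hu : A.update.Tame) {d : ℕ} (N T : ℕ) (x : ℕ → Context d) (y : ℕ → ℝ) (t : ℕ) {v : ℕ}
    (hv : v < 3) : (A.before d N T x y t).nat v = (OnlineProgram.start d N T).nat v := by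
  induction t with
  | zero => exact hi.nat_exec _ hv
  | succ t ih => exact (hu.nat_exec _ hv).trans ((hp.nat_exec _ hv).trans ih)

lemma OnlineProgram.exists_steps_le {A : OnlineProgram} (hi : A.init.Tame) (hp : A.predict.Tame)
    (hu : A.update.Tame) : ∃ c k : ℕ, ∀ (d N T B : ℕ) (x : ℕ → Context d) (y : ℕ → ℝ),
      1 ≤ B → d ≤ B → N ≤ B → T ≤ B → A.steps d N T x y ≤ c * B ^ k := by
  obtain ⟨a₀, k₀, h0⟩ := hi.exists_cost_le
  obtain ⟨a, k, h1⟩ := hp.exists_cost_le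
  obtain ⟨b, l, h2⟩ := hu.exists_cost_le
  refine ⟨a₀ + (a + b), k₀ + (k + l + 1), fun d N T B x y hB hd hN hT => ?_⟩
  have hstart : ∀ v < 3, (OnlineProgram.start d N T).nat v ≤ B := by
    intro v hv
    simp only [OnlineProgram.start]
    split_ifs <;> omega
  refine add_le_mul_pow_of_le hB (h0 _ B hB hstart) ?_
  have hround : ∀ t ∈ Finset.range T,
      A.predict.cost (OnlineProgram.giveContext (A.before d N T x y t) (x t))
        + A.update.cost (OnlineProgram.giveLabel (A.predicted d N T x y t) (y t))
      ≤ (a + b) * B ^ (k + l) := by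
    intro t _
    refine add_le_mul_pow_of_le hB (h1 _ B hB fun v hv => ?_) (h2 _ B hB fun v hv => ?_)
    · exact (OnlineProgram.nat_before hi hp hu N T x y t hv).trans_le (hstart v hv)
    · exact ((hp.nat_exec (OnlineProgram.giveContext (A.before d N T x y t) (x t)) hv).trans
        (OnlineProgram.nat_before hi hp hu N T x y t hv)).trans_le (hstart v hv)
  refine (Finset.sum_le_sum hround).trans ?_
  rw [Finset.sum_const, Finset.card_range, smul_eq_mul]
  calc T * ((a + b) * B ^ (k + l)) ≤ B * ((a + b) * B ^ (k + l)) := Nat.mul_le_mul_right _ hT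
    _ = _ := by ring

/-- As `D ≥ 1 / 2`, the scale satisfies `r^3 ≤ 2 T ≤ T^3`. Thus costs polynomial in `d, N, T` are
polynomial in `d + T`. -/
lemma gridSize_le_succ {d T : ℕ} (hd : 1 ≤ d) (hT : 2 ≤ T) : gridSize d T ≤ T + 1 := by
  have hT2 : (2 : ℝ) ≤ T := by exact_mod_cast hT
  have hr0 := gridScale_pos hd hT
  have h1 := gridScale_pow hd hT
  have h2 := half_le_mul_log hd hT
  have h3 : gridScale d T ^ 3 ≤ (T : ℝ) ^ 3 := by
    have h4 := mul_le_mul_of_nonneg_left h2 (pow_nonneg hr0.le 3)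
    nlinarith [mul_le_mul hT2 hT2 (by norm_num) (by linarith)]
  have h5 : gridScale d T ≤ T := le_of_pow_le_pow_left₀ (by norm_num) (by linarith) h3
  have h6 := gridSize_le hd hT
  have : (gridSize d T : ℝ) ≤ ((T + 1 : ℕ) : ℝ) := by push_cast; linarith
  exact_mod_cast this

theorem exists_steps_forecaster_le : ∃ c k : ℕ, ∀ (d T : ℕ), 1 ≤ d → 2 ≤ T →
    ∀ (x : ℕ → Context d) (y : ℕ → ℝ),
      forecaster.steps d (gridSize d T) T x y ≤ c * (d + T) ^ k := by
  obtain ⟨c, k, h⟩ := OnlineProgram.exists_steps_le (A := forecaster) trivial tame_predictCmd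
    tame_updateCmd
  refine ⟨c * 2 ^ k, k, fun d T hd hT x y => ?_⟩
  have hN := gridSize_le_succ hd hT
  refine (h d (gridSize d T) T (2 * (d + T)) x y (by omega) (by omega) (by omega)
    (by omega)).trans (le_of_eq ?_)
  rw [mul_pow]
  ring

end SwapMultical

end

/-! ### Assembly of the theorem. -/

theorem mainTheorem1 :
    ∃ C : ℝ, 0 < C ∧
      (∃ (A : OnlineProgram) (c k : ℕ), ∀ (d T : ℕ), 1 ≤ d → 2 ≤ T →
        ∀ (x : ℕ → Context d) (y : ℕ → ℝ), (∀ t, y t = 0 ∨ y t = 1) →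
          A.steps d (gridSize d T) T x y ≤ c * (d + T) ^ k ∧
          IsBMRun (1 / (T : ℝ) ^ 2) d T x y (A.forecast d (gridSize d T) T x y) ∧
          AchievesBounds C d T x y (A.forecast d (gridSize d T) T x y)) ∧
      (∀ (d T : ℕ), 1 ≤ d → 2 ≤ T →
        ∀ (x : ℕ → Context d) (y : ℕ → ℝ), (∀ t, y t = 0 ∨ y t = 1) →
          ∀ P : ℕ → Fin (gridSize d T + 1) → ℝ,
            IsBMRun 0 d T x y P → AchievesBounds C d T x y P) := by
  have hy' : ∀ y : ℕ → ℝ, (∀ t, y t = 0 ∨ y t = 1) → ∀ t, 0 ≤ y t ∧ y t ≤ 1 := fun y hy t => by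
    rcases hy t with h | h <;> rw [h] <;> norm_num
  refine ⟨90000, by norm_num, ?_, fun d T hd hT x y hy P hP =>
    hP.achievesBounds hd hT (hy' y hy) (by positivity)⟩
  obtain ⟨c, k, hsteps⟩ := exists_steps_forecaster_le
  refine ⟨forecaster, c, k, fun d T hd hT x y hy => ?_⟩
  have hrun := isBMRun_forecaster (N := gridSize d T) (x := x) (by omega : 1 ≤ T) (hy' y hy)
  exact ⟨hsteps d T hd hT x y, hrun, hrun.achievesBounds hd hT (hy' y hy) le_rfl⟩
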